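/- Let $\mathbf{M}$ be a complete and cocomplete closed symmetric monoidal category with monoidal unit $I$; categories and sets of colors are small. *Notions.* $\mathbf{Op}_{S}(\mathbf{M})$ is the category of (symmetric) operads with set of colors $S$, and $\mathbf{Op}(\mathbf{M})$ is the category of operads with varying colors: its objects are pairs $(S,\mathcal{O})$ with $\mathcal{O}\in\mathbf{Op}_S(\mathbf{M})$, its morphisms $(S,\mathcal{O})\to(S',\mathcal{O}')$ are pairs of a map $f:S\to S'$ and a morphism $\mathcal{O}\to f^*\mathcal{O}'$ in $\mathbf{Op}_S(\mathbf{M})$, where $f^*\mathcal O'$ is the pullback operad. An orthogonal category $\overline{\mathbf{C}}=(\mathbf{C},\perp)$ is a small category with set of objects $\mathbf{C}_0$ and a symmetric relation $\perp$ on pairs of morphisms with a common target that is stable under pre- and postcomposition; orthogonal functors are functors preserving $\perp$, and $\mathbf{OrthCat}$ is the resulting category. An object $\mathcal{P}^{(r_1,r_2)}$ of $\mathbf{Op}^{2\mathrm{pt}}_{\{*\}}(\mathbf{M})$ is a single-colored operad $\mathcal{P}$ with two morphisms of sequences $r_1,r_2:I[2]\rightrightarrows U(\mathcal{P})$ to its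 underlying sequence $U(\mathcal P)$, where $I[2]$ is $I$ in arity $2$ and initial in the other arities; morphisms are operad morphisms preserving $r_1$ and $r_2$. The operad $\mathcal{P}_{\mathbf{C}}\in\mathbf{Op}_{\mathbf{C}_0}(\mathbf{M})$ has operations $\mathcal{P}_{\mathbf{C}}\binom{t}{\underline{c}}=\coprod_{\underline{f}\in\prod_i\mathbf{C}(c_i,t)}\mathcal{P}(n)$, with inclusions $\iota_{\underline{f}}$, and the structure induced from the composition in $\mathbf{C}$ and from $\mathcal{P}$. The field theory operad $\mathcal{P}_{\overline{\mathbf{C}}}^{(r_1,r_2)}$, with projection $\pi:\mathcal{P}_{\mathbf{C}}\to\mathcal{P}_{\overline{\mathbf{C}}}^{(r_1,r_2)}$, is the coequalizer in $\mathbf{Op}_{\mathbf{C}_0}(\mathbf{M})$ of the two morphisms to $\mathcal{P}_{\mathbf{C}}$ from the free operad on the sequence $R_\perp$ given by $\iota_{(f_1,f_2)}\circ r_1$ and $\iota_{(f_1,f_2)}\circ r_2$; here $R_\perp\binom{t}{(c_1,c_2)}=\coprod_{f_1\perp f_2}I$, over the orthogonal pairs $f_i:c_i\to t$, and $R_\perp$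 is initial in arities $\neq 2$. The category $\mathbf{FT}(\overline{\mathbf{C}},\mathcal{P}^{(r_1,r_2)})$ of field theories is the full subcategory of the functors $\mathfrak{A}:\mathbf{C}\to\mathbf{Alg}_{\mathcal{P}}$ such that, for all $f_1\perp f_2$ with common target $t$, the two morphisms $\mathfrak{A}(c_1)\otimes\mathfrak{A}(c_2)\to\mathfrak{A}(t)$ obtained by applying $\mathfrak{A}(f_1)\otimes\mathfrak{A}(f_2)$ followed by the operation $r_1$, respectively $r_2$, agree. **Proposition.** The operads $\mathcal{P}_{\overline{\mathbf{C}}}^{(r_1,r_2)}$ exist, and for every choice of them the following holds. 1. The assignment $(\overline{\mathbf{C}},\mathcal{P}^{(r_1,r_2)})\mapsto(\mathbf{C}_0,\mathcal{P}_{\overline{\mathbf{C}}}^{(r_1,r_2)})$ extends to a functor $\mathbf{OrthCat}\times\mathbf{Op}^{2\mathrm{pt}}_{\{*\}}(\mathbf{M})\to\mathbf{Op}(\mathbf{M})$. Write $\phi_F:\mathcal{P}_{\overline{\mathbf{C}}}^{(r_1,r_2)}\to\mathcal{Q}_{\overline{\mathbf{D}}}^{(s_1,s_2)}$ for its value on $(F,\phi):(\overline{\mathbf{C}},\mathcal{P}^{(r_1,r_2)})\to(\overline{\mathbf{D}},\mathcal{Q}^{(s_1,s_2)})$.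 There is exactly one extension for which all the $\phi_F$ are compatible, through the projections $\pi$, with the morphisms $\mathcal{P}_{\mathbf{C}}\to\mathcal{Q}_{\mathbf{D}}$ that are $F$ on colors and send the summand of $\underline{f}$ by $\phi$ to the summand of $F(\underline{f})$. In the following $\phi_F$ refers to this extension. 2. For every $(F,\phi)$ the pullback functor $\mathbf{Alg}_{\mathcal{Q}_{\overline{\mathbf{D}}}^{(s_1,s_2)}}\to\mathbf{Alg}_{\mathcal{P}_{\overline{\mathbf{C}}}^{(r_1,r_2)}}$ along $\phi_F$ has a left adjoint (operadic left Kan extension), and the functor $$(\phi_F)^*=\phi^*\circ(-)\circ F:\ \mathbf{FT}(\overline{\mathbf{D}},\mathcal{Q}^{(s_1,s_2)})\to\mathbf{FT}(\overline{\mathbf{C}},\mathcal{P}^{(r_1,r_2)})$$ has a left adjoint $(\phi_F)_!$. These adjunctions correspond to each other: there are equivalences $\mathbf{Alg}_{\mathcal{P}_{\overline{\mathbf{C}}}^{(r_1,r_2)}}\simeq\mathbf{FT}(\overline{\mathbf{C}},\mathcal{P}^{(r_1,r_2)})$ which, up to natural isomorphism, intertwine the two pullback functors for every $(F,\phi)$,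 and under which the pullback of algebras along $\pi$ becomes the functor that regards a functor $\mathfrak{A}:\mathbf{C}\to\mathbf{Alg}_{\mathcal{P}}$ as a $\mathcal{P}_{\mathbf{C}}$-algebra (the summand of $\underline{f}$ acts by the $\mathfrak{A}(f_i)$ followed by the action of $\mathcal{P}$ on $\mathfrak{A}(t)$). -/

import Mathlib

open CategoryTheory MonoidalCategory Limits

universe w v u

namespace FieldTheory

section Tensor

/-- The position, in the concatenation of `n` lists of lengths `k 0, …, k (n - 1)`,
of the `j`-th entry of the `i`-th list. -/
abbrev pos {n : ℕ} {k : Fin n → ℕ} (i : Fin n) (j : Fin (k i)) : Fin (∑ i, k i) :=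
  finSigmaFinEquiv ⟨i, j⟩

/-- The pair (number of the list, position in that list) of a position in a concatenation. -/
abbrev unpos {n : ℕ} {k : Fin n → ℕ} (x : Fin (∑ i, k i)) : Σ i, Fin (k i) :=
  finSigmaFinEquiv.symm x

/-- Concatenation of `n` lists. -/
abbrev concat {α : Type*} {n : ℕ} {k : Fin n → ℕ} (b : ∀ i, Fin (k i) → α) (x : Fin (∑ i, k i)) :
    α :=
  b (unpos x).1 (unpos x).2

theorem unpos_zero {n : ℕ} (k : Fin (n + 1) → ℕ) (j : Fin (k 0)) :
    unpos (Fin.cast (Fin.sum_univ_succ k).symm (Fin.castAdd _ j)) = ⟨0, j⟩ := by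
  rw [unpos, Equiv.symm_apply_eq]
  apply Fin.ext
  rw [finSigmaFinEquiv_apply]
  simp

theorem unpos_succ {n : ℕ} (k : Fin (n + 1) → ℕ) (x : Fin (∑ i : Fin n, k i.succ)) :
    unpos (Fin.cast (Fin.sum_univ_succ k).symm (Fin.natAdd (k 0) x)) =
      ⟨(unpos (k := fun i => k i.succ) x).1.succ, (unpos (k := fun i => k i.succ) x).2⟩ := by
  obtain ⟨⟨i, j⟩, rfl⟩ := finSigmaFinEquiv.surjective x
  rw [unpos, Equiv.symm_apply_eq]
  apply Fin.ext
  rw [unpos, Equiv.symm_apply_apply, finSigmaFinEquiv_apply]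
  simp only [Fin.val_cast, Fin.val_natAdd]
  rw [finSigmaFinEquiv_apply]
  simp only [Fin.val_succ, Fin.sum_univ_succ, add_assoc]
  rfl

variable {M : Type u} [Category.{v} M]

theorem hom_transport {ι : Type*} {A B : ι → M} (F : ∀ p, A p ⟶ B p) {p q : ι} (h : p = q) :
    F p ≫ eqToHom (congrArg B h) = eqToHom (congrArg A h) ≫ F q := by
  subst h; simp

variable [MonoidalCategory M]

theorem hom_whisker {A A' B B' D : M} (a : A ⟶ A') (b : B ⟶ B') (c : B' ⟶ D) :
    (a ⊗ₘ b) ≫ (A' ◁ c) = a ⊗ₘ (b ≫ c) := by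
  rw [← id_tensorHom, tensorHom_comp_tensorHom, Category.comp_id]

theorem whisker_hom {A A' B B' D : M} (a : A ⟶ A') (c : B ⟶ B') (b : B' ⟶ D) :
    (A ◁ c) ≫ (a ⊗ₘ b) = a ⊗ₘ (c ≫ b) := by
  rw [← id_tensorHom, tensorHom_comp_tensorHom, Category.id_comp]

/-- The iterated tensor product `X 0 ⊗ (X 1 ⊗ (⋯ ⊗ 𝟙_ M))`; it is `𝟙_ M` for `n = 0`. -/
@[reducible] def tens : {n : ℕ} → (Fin n → M) → M
  | 0, _ => 𝟙_ M
  | _ + 1, X => X 0 ⊗ tens (fun i => X i.succ)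

/-- The iterated tensor product of morphisms. -/
def tensMap : {n : ℕ} → {X Y : Fin n → M} → (∀ i, X i ⟶ Y i) → (tens X ⟶ tens Y)
  | 0, _, _, _ => 𝟙 (𝟙_ M)
  | _ + 1, _, _, f => f 0 ⊗ₘ tensMap (fun i => f i.succ)

theorem tensMap_succ {n : ℕ} {X Y : Fin (n + 1) → M} (f : ∀ i, X i ⟶ Y i) :
    tensMap f = (f 0 ⊗ₘ tensMap (fun i => f i.succ)) :=
  rfl

theorem tensMap_id : ∀ {n : ℕ} (X : Fin n → M), tensMap (fun i => 𝟙 (X i)) = 𝟙 (tens X)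
  | 0, _ => rfl
  | _ + 1, X =>
    (congrArg (fun z => 𝟙 (X 0) ⊗ₘ z) (tensMap_id (fun i => X i.succ))).trans
      (id_tensorHom_id _ _)

theorem tensMap_comp : ∀ {n : ℕ} {X Y Z : Fin n → M} (f : ∀ i, X i ⟶ Y i) (g : ∀ i, Y i ⟶ Z i),
    tensMap (fun i => f i ≫ g i) = tensMap f ≫ tensMap g
  | 0, _, _, _, _, _ => (Category.comp_id (𝟙 (𝟙_ M))).symm
  | _ + 1, _, _, _, f, g =>
    (congrArg (fun z => (f 0 ≫ g 0) ⊗ₘ z)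
      (tensMap_comp (fun i => f i.succ) (fun i => g i.succ))).trans
      (tensorHom_comp_tensorHom _ _ _ _).symm

/-- The identity, between two listings of the same factors in the same order that are equal
only propositionally. -/
def tensCast {m n : ℕ} (h : m = n) {X : Fin m → M} {Y : Fin n → M}
    (hX : ∀ i, X i = Y (Fin.cast h i)) : tens X ⟶ tens Y :=
  eqToHom (by subst h; exact congrArg tens (funext hX))

theorem tensCast_natural {m n : ℕ} (h : m = n) {X X' : Fin m → M} {Y Y' : Fin n → M}
    (hX : ∀ i, X i = Y (Fin.cast h i)) (hX' : ∀ i, X' i = Y' (Fin.cast h i))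
    (f : ∀ i, X i ⟶ X' i) (g : ∀ i, Y i ⟶ Y' i)
    (hfg : ∀ i, f i ≫ eqToHom (hX' i) = eqToHom (hX i) ≫ g (Fin.cast h i)) :
    tensMap f ≫ tensCast h hX' = tensCast h hX ≫ tensMap g := by
  subst h
  obtain rfl : X = Y := funext hX
  obtain rfl : X' = Y' := funext hX'
  obtain rfl : f = g := by
    funext i
    simpa using hfg i
  simp [tensCast]

/-- A variant of `tensCast` in which the first factor is listed separately. -/
def consCast {n : ℕ} {A : M} {Y : Fin n → M} {Z : Fin (n + 1) → M} (hA : A = Z 0)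
    (hY : ∀ i, Y i = Z i.succ) : A ⊗ tens Y ⟶ tens Z :=
  eqToHom hA ⊗ₘ tensCast rfl hY

theorem consCast_natural {n : ℕ} {A A' : M} {Y Y' : Fin n → M} {Z Z' : Fin (n + 1) → M}
    (hA : A = Z 0) (hY : ∀ i, Y i = Z i.succ) (hA' : A' = Z' 0) (hY' : ∀ i, Y' i = Z' i.succ)
    (a : A ⟶ A') (f : ∀ i, Y i ⟶ Y' i) (g : ∀ i, Z i ⟶ Z' i)
    (ha : a ≫ eqToHom hA' = eqToHom hA ≫ g 0)
    (hf : ∀ i, f i ≫ eqToHom (hY' i) = eqToHom (hY i) ≫ g i.succ) :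
    (a ⊗ₘ tensMap f) ≫ consCast hA' hY' = consCast hA hY ≫ tensMap g := by
  have h := tensCast_natural rfl hY hY' f (fun i => g i.succ) hf
  simp only [consCast, tensMap]
  rw [tensorHom_comp_tensorHom, tensorHom_comp_tensorHom, ha, h]

/-- The canonical isomorphism `𝟙_ M ⟶ 𝟙_ M ⊗ (𝟙_ M ⊗ ⋯)`. -/
def tensUnit : (n : ℕ) → (𝟙_ M ⟶ tens (fun _ : Fin n => 𝟙_ M))
  | 0 => 𝟙 (𝟙_ M)
  | n + 1 => (λ_ (𝟙_ M)).inv ≫ (𝟙_ M ◁ tensUnit n)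

/-- The canonical isomorphism (associators and unitors only) from the tensor product of the first
`m` factors and the last `n` factors to the tensor product of all of them. -/
def tensAppend : (m n : ℕ) → (Z : Fin (m + n) → M) →
    (tens (fun i => Z (Fin.castAdd n i)) ⊗ tens (fun i => Z (Fin.natAdd m i)) ⟶ tens Z)
  | 0, n, Z => (λ_ _).hom ≫ tensCast (Nat.zero_add n).symm
      (fun i => congrArg Z (Fin.ext (by simp)))
  | m + 1, n, Z =>
      (α_ _ _ _).hom ≫
        (Z (Fin.castAdd n 0) ◁
          ((_ ◁ tensCast rfl (fun i => congrArg Z (Fin.ext (by simp; omega)))) ≫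
            tensAppend m n (fun i => Z (Fin.cast (by omega) i.succ)))) ≫
        consCast (Z := fun i => Z (Fin.cast (by omega) i)) (congrArg Z (Fin.ext (by simp)))
          (fun _ => rfl) ≫
        tensCast (m := m + n + 1) (by omega) (fun _ => rfl)

theorem tensAppend_natural : ∀ (m n : ℕ) {Z Z' : Fin (m + n) → M} (h : ∀ i, Z i ⟶ Z' i),
    (tensMap (fun i => h (Fin.castAdd n i)) ⊗ₘ tensMap (fun i => h (Fin.natAdd m i))) ≫
      tensAppend m n Z' = tensAppend m n Z ≫ tensMap h
  | 0, n, Z, Z', h => by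
    simp only [tensAppend, Category.assoc]
    rw [← tensCast_natural _ _ _ (fun i => h (Fin.natAdd 0 i)) h
      (fun i => hom_transport h (Fin.ext (by simp)))]
    simp [tensMap]
  | m + 1, n, Z, Z', h => by
    have ih := tensAppend_natural m n (fun i => h (Fin.cast (by omega) i.succ))
    have hc := tensCast_natural (rfl : n = n)
      (X := fun i => Z (Fin.natAdd (m + 1) i)) (X' := fun i => Z' (Fin.natAdd (m + 1) i))
      (Y := fun i => Z (Fin.cast (by omega) (Fin.natAdd m i).succ))
      (Y' := fun i => Z' (Fin.cast (by omega) (Fin.natAdd m i).succ))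
      (fun i => congrArg Z (Fin.ext (by simp; omega)))
      (fun i => congrArg Z' (Fin.ext (by simp; omega)))
      (fun i => h (Fin.natAdd (m + 1) i)) (fun i => h (Fin.cast (by omega) (Fin.natAdd m i).succ))
      (fun i => hom_transport h (Fin.ext (by simp; omega)))
    have h1 := consCast_natural (Z := fun i => Z (Fin.cast (by omega) i))
      (Z' := fun i => Z' (Fin.cast (by omega) i))
      (congrArg Z (Fin.ext (by simp))) (fun i => rfl)
      (congrArg Z' (Fin.ext (by simp))) (fun i => rfl) (h (Fin.castAdd n 0))
      (fun i : Fin (m + n) => h (Fin.cast (by omega) i.succ))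
      (fun i => h (Fin.cast (by omega) i))
      (hom_transport h (Fin.ext (by simp))) (fun i => by simp)
    have h2 := tensCast_natural (m := m + n + 1) (n := m + 1 + n) (by omega)
      (X := fun i => Z (Fin.cast (by omega) i)) (X' := fun i => Z' (Fin.cast (by omega) i))
      (Y := Z) (Y' := Z') (fun _ => rfl) (fun _ => rfl) (fun i => h (Fin.cast (by omega) i)) h
      (fun i => by simp)
    simp only [tensAppend, Category.assoc]
    rw [← h2, ← reassoc_of% h1]
    simp only [tensMap, ← Category.assoc]
    refine eq_whisker ?_ _
    refine eq_whisker ?_ _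
    rw [associator_naturality, Category.assoc, Category.assoc, hom_whisker, whisker_hom]
    refine congrArg (fun z => (α_ _ _ _).hom ≫ (h (Fin.castAdd n 0) ⊗ₘ z)) ?_
    rw [Category.assoc, ← ih, ← Category.assoc, ← Category.assoc]
    refine eq_whisker ?_ _
    rw [hom_whisker, whisker_hom, hc]
    rfl

/-- The canonical isomorphism (associators and unitors only) from an iterated tensor product of
iterated tensor products to the iterated tensor product over the concatenated list. -/
def tensFlat : {n : ℕ} → {k : Fin n → ℕ} → (Y : ∀ i, Fin (k i) → M) →
    ((tens (fun i => (tens (Y i) : M)) : M) ⟶ tens (concat Y))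
  | 0, _, _ => 𝟙 (𝟙_ M)
  | n + 1, k, Y =>
      (tensCast rfl (fun j => (congrArg (fun p : Σ i, Fin (k i) => Y p.1 p.2)
          (unpos_zero k j)).symm) ⊗ₘ
        (tensFlat (fun i => Y i.succ) ≫
          tensCast rfl (fun x => (congrArg (fun p : Σ i, Fin (k i) => Y p.1 p.2)
            (unpos_succ k x)).symm))) ≫
        tensAppend (k 0) (∑ i : Fin n, k i.succ)
          (fun x => concat Y (Fin.cast (Fin.sum_univ_succ k).symm x)) ≫
        tensCast (Fin.sum_univ_succ k).symm (fun _ => rfl)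

theorem tensFlat_natural : ∀ {n : ℕ} {k : Fin n → ℕ} {Y Y' : ∀ i, Fin (k i) → M}
    (f : ∀ i j, Y i j ⟶ Y' i j),
    tensMap (X := fun i => (tens (Y i) : M)) (Y := fun i => (tens (Y' i) : M))
        (fun i => tensMap (f i)) ≫ tensFlat Y' =
      tensFlat Y ≫ tensMap (fun x => f (unpos x).1 (unpos x).2)
  | 0, _, _, _, _ => rfl
  | n + 1, k, Y, Y', f => by
    have ih := tensFlat_natural (fun i => f i.succ)
    have h0 := tensCast_natural rfl
      (fun j => (congrArg (fun p : Σ i, Fin (k i) => Y p.1 p.2) (unpos_zero k j)).symm)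
      (fun j => (congrArg (fun p : Σ i, Fin (k i) => Y' p.1 p.2) (unpos_zero k j)).symm)
      (f 0) (fun j => f (unpos (Fin.cast (Fin.sum_univ_succ k).symm (Fin.castAdd _ j))).1
        (unpos (Fin.cast (Fin.sum_univ_succ k).symm (Fin.castAdd _ j))).2)
      (fun j => hom_transport (fun p : Σ i, Fin (k i) => f p.1 p.2) (unpos_zero k j).symm)
    have h1 := tensCast_natural rfl
      (fun x => (congrArg (fun p : Σ i, Fin (k i) => Y p.1 p.2) (unpos_succ k x)).symm)
      (fun x => (congrArg (fun p : Σ i, Fin (k i) => Y' p.1 p.2) (unpos_succ k x)).symm)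
      (fun x => f (unpos (k := fun i => k i.succ) x).1.succ (unpos (k := fun i => k i.succ) x).2)
      (fun x => f (unpos (Fin.cast (Fin.sum_univ_succ k).symm (Fin.natAdd (k 0) x))).1
        (unpos (Fin.cast (Fin.sum_univ_succ k).symm (Fin.natAdd (k 0) x))).2)
      (fun x => hom_transport (fun p : Σ i, Fin (k i) => f p.1 p.2) (unpos_succ k x).symm)
    have h2 := tensAppend_natural (k 0) (∑ i : Fin n, k i.succ)
      (fun x => f (unpos (Fin.cast (Fin.sum_univ_succ k).symm x)).1
        (unpos (Fin.cast (Fin.sum_univ_succ k).symm x)).2)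
    have h3 := tensCast_natural (Fin.sum_univ_succ k).symm (X := fun x =>
        concat Y (Fin.cast (Fin.sum_univ_succ k).symm x)) (Y := concat Y)
      (X' := fun x => concat Y' (Fin.cast (Fin.sum_univ_succ k).symm x)) (Y' := concat Y')
      (fun _ => rfl) (fun _ => rfl)
      (fun x => f (unpos (Fin.cast (Fin.sum_univ_succ k).symm x)).1
        (unpos (Fin.cast (Fin.sum_univ_succ k).symm x)).2)
      (fun x => f (unpos x).1 (unpos x).2) (fun x => by simp)
    simp only [tensFlat, Category.assoc]
    rw [← h3, ← reassoc_of% h2]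
    simp only [← Category.assoc]
    refine eq_whisker ?_ _
    refine eq_whisker ?_ _
    refine (tensorHom_comp_tensorHom _ _ _ _).trans ?_
    refine Eq.trans ?_ (tensorHom_comp_tensorHom _ _ _ _).symm
    rw [h0, ← Category.assoc]
    refine congrArg (fun z => _ ⊗ₘ z) ?_
    refine (congrArg (fun z => z ≫ tensCast rfl (fun x => (congrArg (fun p : Σ i, Fin (k i) =>
      Y' p.1 p.2) (unpos_succ k x)).symm)) ih).trans ?_
    rw [Category.assoc, Category.assoc]
    exact congrArg (fun z => tensFlat _ ≫ z) h1

end Tensor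

section Symm

variable {M : Type u} [Category.{v} M] [MonoidalCategory M] [BraidedCategory M]

/-- The canonical isomorphism `⊗ i, (X i ⊗ Y i) ⟶ (⊗ i, X i) ⊗ (⊗ i, Y i)`. -/
def tensZip : {n : ℕ} → (X Y : Fin n → M) → ((tens (fun i => (X i ⊗ Y i : M)) : M) ⟶ tens X ⊗ tens Y)
  | 0, _, _ => (λ_ (𝟙_ M)).inv
  | _ + 1, X, Y =>
      ((X 0 ⊗ Y 0) ◁ tensZip (fun i => X i.succ) (fun i => Y i.succ)) ≫ tensorμ _ _ _ _

theorem tensZip_natural : ∀ {n : ℕ} {X Y X' Y' : Fin n → M} (f : ∀ i, X i ⟶ X' i)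
    (g : ∀ i, Y i ⟶ Y' i),
    tensMap (X := fun i => (X i ⊗ Y i : M)) (Y := fun i => (X' i ⊗ Y' i : M))
      (fun i => f i ⊗ₘ g i) ≫ tensZip X' Y' = tensZip X Y ≫ (tensMap f ⊗ₘ tensMap g)
  | 0, _, _, _, _, _, _ => by simp [tensZip, tensMap]
  | _ + 1, X, Y, X', Y', f, g => by
    have ih := tensZip_natural (fun i => f i.succ) (fun i => g i.succ)
    simp only [tensZip, tensMap, Category.assoc]
    rw [← tensorμ_natural, ← Category.assoc, ← Category.assoc, hom_whisker, whisker_hom, ih]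

/-- The canonical isomorphism that moves the `i`-th factor to the front. -/
def tensPull : {n : ℕ} → (i : Fin (n + 1)) → (X : Fin (n + 1) → M) →
    (tens X ⟶ X i ⊗ tens (fun j => X (i.succAbove j)))
  | 0, i, X => eqToHom (congrArg X (Fin.ext (by omega))) ▷ 𝟙_ M
  | n + 1, i, X =>
      Fin.cases (motive := fun i => tens X ⟶ X i ⊗ tens (fun j => X (i.succAbove j)))
        (X 0 ◁ tensCast rfl (fun j => congrArg X (Fin.zero_succAbove j).symm))
        (fun j => (X 0 ◁ tensPull j (fun l => X l.succ)) ≫ (α_ _ _ _).inv ≫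
          ((β_ (X 0) (X j.succ)).hom ▷ _) ≫ (α_ _ _ _).hom ≫
          (X j.succ ◁ consCast (congrArg X (Fin.succ_succAbove_zero j).symm)
            (fun l => congrArg X (Fin.succ_succAbove_succ j l).symm))) i

theorem tensPull_natural : ∀ {n : ℕ} (i : Fin (n + 1)) {X Y : Fin (n + 1) → M}
    (f : ∀ i, X i ⟶ Y i),
    tensMap f ≫ tensPull i Y = tensPull i X ≫ (f i ⊗ₘ tensMap (fun j => f (i.succAbove j)))
  | 0, i, X, Y, f => by
    obtain rfl : i = 0 := Fin.ext (by omega)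
    simp [tensPull, tensMap]
  | n + 1, i, X, Y, f => by
    cases i using Fin.cases with
    | zero =>
      have h := tensCast_natural rfl (X := fun j => X j.succ) (X' := fun j => Y j.succ)
        (Y := fun j => X ((0 : Fin (n + 2)).succAbove j))
        (Y' := fun j => Y ((0 : Fin (n + 2)).succAbove j)) (fun j => congrArg X (Fin.zero_succAbove j).symm)
        (fun j => congrArg Y (Fin.zero_succAbove j).symm)
        (fun j => f j.succ) (fun j => f ((0 : Fin (n + 2)).succAbove j))
        (fun j => hom_transport f (Fin.zero_succAbove j).symm)
      simp only [tensPull, Fin.cases_zero, tensMap_succ f]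
      rw [hom_whisker, whisker_hom, h]
    | succ j =>
      have ih := tensPull_natural j (fun l => f l.succ)
      have h := consCast_natural
        (Y := fun l => X (j.succAbove l).succ) (Z := fun l => X (j.succ.succAbove l))
        (Y' := fun l => Y (j.succAbove l).succ) (Z' := fun l => Y (j.succ.succAbove l))
        (congrArg X (Fin.succ_succAbove_zero j).symm)
        (fun l => congrArg X (Fin.succ_succAbove_succ j l).symm)
        (congrArg Y (Fin.succ_succAbove_zero j).symm)
        (fun l => congrArg Y (Fin.succ_succAbove_succ j l).symm) (f 0)
        (fun l => f (j.succAbove l).succ) (fun l => f (j.succ.succAbove l))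
        (hom_transport f (Fin.succ_succAbove_zero j).symm)
        (fun l => hom_transport f (Fin.succ_succAbove_succ j l).symm)
      simp only [tensPull, Fin.cases_succ, tensMap_succ f, Category.assoc]
      rw [whisker_hom (f j.succ), ← h, ← Category.assoc, hom_whisker, ih, ← whisker_hom,
        Category.assoc, associator_inv_naturality_assoc, ← hom_whisker (f j.succ),
        ← associator_naturality_assoc,
        ← tensorHom_id, ← tensorHom_id, tensorHom_comp_tensorHom_assoc,
        tensorHom_comp_tensorHom_assoc, BraidedCategory.braiding_naturality, Category.comp_id,
        Category.id_comp]

/-- The bijection obtained from `e` by removing `0` and its image. -/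
def removeZero {m n : ℕ} (e : Fin (m + 1) ≃ Fin (n + 1)) : Fin m ≃ Fin n :=
  Equiv.removeNone ((finSuccEquiv' 0).symm.trans (e.trans (finSuccEquiv' (e 0))))

theorem succAbove_removeZero {m n : ℕ} (e : Fin (m + 1) ≃ Fin (n + 1)) (j : Fin m) :
    (e 0).succAbove (removeZero e j) = e j.succ := by
  have hne : e j.succ ≠ e 0 := fun h => Fin.succ_ne_zero j (e.injective h)
  obtain ⟨l, hl⟩ := Fin.exists_succAbove_eq hne
  have h1 : ((finSuccEquiv' 0).symm.trans (e.trans (finSuccEquiv' (e 0)))) (some j) = some l := by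
    simp [← hl]
  have h2 := Equiv.removeNone_some _ ⟨l, h1⟩
  rw [h1] at h2
  rw [← hl]
  exact congrArg _ (Option.some_injective _ h2)

/-- The canonical isomorphism that permutes the factors of an iterated tensor product. -/
def tensPerm : {m n : ℕ} → (e : Fin m ≃ Fin n) → (X : Fin n → M) →
    (tens X ⟶ tens (fun i => X (e i)))
  | 0, 0, _, _ => 𝟙 (𝟙_ M)
  | 0, _ + 1, e, _ => (e.symm 0).elim0
  | _ + 1, 0, e, _ => (e 0).elim0
  | _ + 1, _ + 1, e, X =>
      tensPull (e 0) X ≫ (X (e 0) ◁ (tensPerm (removeZero e) (fun j => X ((e 0).succAbove j)) ≫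
        tensCast rfl (fun j => congrArg X (succAbove_removeZero e j))))

theorem tensPerm_natural : ∀ {m n : ℕ} (e : Fin m ≃ Fin n) {X Y : Fin n → M} (f : ∀ i, X i ⟶ Y i),
    tensMap f ≫ tensPerm e Y = tensPerm e X ≫ tensMap (fun i => f (e i))
  | 0, 0, _, _, _, _ => by simp [tensPerm, tensMap]
  | 0, _ + 1, e, _, _, _ => (e.symm 0).elim0
  | _ + 1, 0, e, _, _, _ => (e 0).elim0
  | m + 1, n + 1, e, X, Y, f => by
    rw [tensMap_succ (fun i => f (e i))]
    have ih := tensPerm_natural (removeZero e) (fun j => f ((e 0).succAbove j))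
    have h := tensCast_natural rfl
      (X := fun j => X ((e 0).succAbove (removeZero e j))) (Y := fun j => X (e j.succ))
      (X' := fun j => Y ((e 0).succAbove (removeZero e j))) (Y' := fun j => Y (e j.succ))
      (fun j => congrArg X (succAbove_removeZero e j))
      (fun j => congrArg Y (succAbove_removeZero e j))
      (fun j => f ((e 0).succAbove (removeZero e j))) (fun j => f (e j.succ))
      (fun j => hom_transport f (succAbove_removeZero e j))
    have hp := tensPull_natural (e 0) f
    simp only [tensPerm]
    rw [reassoc_of% hp, Category.assoc, hom_whisker, whisker_hom, reassoc_of% ih, h,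
      Category.assoc]

end Symm

section Index

/-- The block permutation `Σ_i k (e i) → Σ_i k i` induced by a permutation `e` of the blocks. -/
def blockEquiv {m n : ℕ} (e : Fin m ≃ Fin n) (k : Fin n → ℕ) :
    Fin (∑ i, k (e i)) ≃ Fin (∑ i, k i) :=
  finSigmaFinEquiv.symm.trans
    ((Equiv.sigmaCongrLeft (β := fun i => Fin (k i)) e).trans finSigmaFinEquiv)

/-- The direct sum of permutations of the single blocks. -/
def sumEquiv {n : ℕ} {k k' : Fin n → ℕ} (e : ∀ i, Fin (k' i) ≃ Fin (k i)) :
    Fin (∑ i, k' i) ≃ Fin (∑ i, k i) :=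
  finSigmaFinEquiv.symm.trans ((Equiv.sigmaCongrRight e).trans finSigmaFinEquiv)

/-- The order preserving identification of the two ways to number a list of lists of lists. -/
def assocEquiv {n : ℕ} {k : Fin n → ℕ} (m : ∀ i, Fin (k i) → ℕ) :
    Fin (∑ i, ∑ j, m i j) ≃ Fin (∑ z : Fin (∑ i, k i), concat m z) :=
  finSigmaFinEquiv.symm.trans
    ((Equiv.sigmaCongrRight fun _ => finSigmaFinEquiv.symm).trans
      ((Equiv.sigmaAssoc fun i j => Fin (m i j)).symm.trans
        ((Equiv.sigmaCongrLeft (β := fun p : Σ i, Fin (k i) => Fin (m p.1 p.2))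
          finSigmaFinEquiv.symm).symm.trans finSigmaFinEquiv)))

/-- The order preserving bijection `{1, …, n} → Σ_{i ∈ {1}} {1, …, n}`. -/
def oneSumEquiv (n : ℕ) : Fin n ≃ Fin (∑ _i : Fin 1, n) :=
  (Equiv.uniqueSigma fun _ : Fin 1 => Fin n).symm.trans finSigmaFinEquiv

/-- The order preserving bijection `{1, …, n} → Σ_{i ∈ {1, …, n}} {1}`. -/
def sumOneEquiv (n : ℕ) : Fin n ≃ Fin (∑ _i : Fin n, 1) :=
  (Equiv.sigmaUnique (Fin n) fun _ => Fin 1).symm.trans finSigmaFinEquiv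

theorem unpos_blockEquiv {m n : ℕ} (e : Fin m ≃ Fin n) (k : Fin n → ℕ)
    (x : Fin (∑ i, k (e i))) :
    unpos (blockEquiv e k x) = ⟨e (unpos x).1, (unpos x).2⟩ := by
  simp [blockEquiv, unpos]

theorem unpos_sumEquiv {n : ℕ} {k k' : Fin n → ℕ} (e : ∀ i, Fin (k' i) ≃ Fin (k i))
    (x : Fin (∑ i, k' i)) :
    unpos (sumEquiv e x) = ⟨(unpos x).1, e _ (unpos x).2⟩ := by
  simp [sumEquiv, unpos, Equiv.sigmaCongrRight]

theorem unpos_assocEquiv {n : ℕ} {k : Fin n → ℕ} (m : ∀ i, Fin (k i) → ℕ)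
    (x : Fin (∑ i, ∑ j, m i j)) :
    (⟨unpos (unpos (assocEquiv m x)).1, (unpos (assocEquiv m x)).2⟩ :
        Σ p : (Σ i, Fin (k i)), Fin (m p.1 p.2)) =
      ⟨⟨(unpos x).1, (unpos (unpos x).2).1⟩, (unpos (unpos x).2).2⟩ := by
  have h : unpos (assocEquiv m x) =
      (Equiv.sigmaCongrLeft (β := fun p : Σ i, Fin (k i) => Fin (m p.1 p.2))
          finSigmaFinEquiv.symm).symm
        ⟨⟨(unpos x).1, (unpos (unpos x).2).1⟩, (unpos (unpos x).2).2⟩ := by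
    simp only [assocEquiv, unpos, Equiv.trans_apply, Equiv.symm_apply_apply]
    rfl
  exact (Equiv.eq_symm_apply _).1 h

theorem unpos_oneSumEquiv {n : ℕ} (x : Fin n) :
    unpos (k := fun _ : Fin 1 => n) (oneSumEquiv n x) = ⟨0, x⟩ := by
  simp only [oneSumEquiv, unpos, Equiv.trans_apply, Equiv.symm_apply_apply]
  rfl

theorem unpos_sumOneEquiv {n : ℕ} (x : Fin n) :
    unpos (k := fun _ : Fin n => 1) (sumOneEquiv n x) = ⟨x, 0⟩ := by
  simp only [sumOneEquiv, unpos, Equiv.trans_apply, Equiv.symm_apply_apply]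
  rfl

variable {α : Type*}

theorem concat_blockEquiv {m n : ℕ} (e : Fin m ≃ Fin n) {k : Fin n → ℕ}
    (b : ∀ i, Fin (k i) → α) (x : Fin (∑ i, k (e i))) :
    concat (fun i => b (e i)) x = concat b (blockEquiv e k x) :=
  (congrArg (fun p : Σ i, Fin (k i) => b p.1 p.2) (unpos_blockEquiv e k x)).symm

theorem concat_sumEquiv {n : ℕ} {k k' : Fin n → ℕ} (e : ∀ i, Fin (k' i) ≃ Fin (k i))
    (b : ∀ i, Fin (k i) → α) (x : Fin (∑ i, k' i)) :
    concat (fun i j => b i (e i j)) x = concat b (sumEquiv e x) :=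
  (congrArg (fun p : Σ i, Fin (k i) => b p.1 p.2) (unpos_sumEquiv e x)).symm

theorem concat_assocEquiv {n : ℕ} {k : Fin n → ℕ} {m : ∀ i, Fin (k i) → ℕ}
    (c : ∀ i j, Fin (m i j) → α) (x : Fin (∑ i, ∑ j, m i j)) :
    concat (fun i => concat (c i)) x =
      concat (k := fun z => concat m z) (fun z => c (unpos z).1 (unpos z).2) (assocEquiv m x) :=
  (congrArg (fun q : Σ p : (Σ i, Fin (k i)), Fin (m p.1 p.2) => c q.1.1 q.1.2 q.2)
    (unpos_assocEquiv m x)).symm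

theorem concat_oneSumEquiv {n : ℕ} (c : Fin n → α) (x : Fin n) :
    c x = concat (fun _ : Fin 1 => c) (oneSumEquiv n x) :=
  (congrArg (fun p : Σ _ : Fin 1, Fin n => c p.2) (unpos_oneSumEquiv x)).symm

theorem concat_sumOneEquiv {n : ℕ} (c : Fin n → α) (x : Fin n) :
    c x = concat (fun (i : Fin n) (_ : Fin 1) => c i) (sumOneEquiv n x) :=
  (congrArg (fun p : Σ _ : Fin n, Fin 1 => c p.1) (unpos_sumOneEquiv x)).symm

end Index

section Operad

/-- A `C`-colored operad with values in the symmetric monoidal category `M`.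

The symmetric groups act through bijections `e : Fin m ≃ Fin n`, which exist only for `m = n`;
the list `d` is the permuted list `(c (e 0), …, c (e (n - 1)))`. In this form the action also
contains the identifications of `ops c t` with `ops d t` for propositionally equal lists. -/
structure ColoredOperad (M : Type u) [Category.{v} M] [MonoidalCategory M] [SymmetricCategory M]
    (C : Type w) where
  /-- The object of operations from `c` to `t`. -/
  ops : {n : ℕ} → (Fin n → C) → C → M
  /-- The permutation action. -/
  perm : {m n : ℕ} → (e : Fin m ≃ Fin n) → {c : Fin n → C} → {d : Fin m → C} →
    (∀ i, d i = c (e i)) → (t : C) → (ops c t ⟶ ops d t)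
  /-- The operadic composition. -/
  comp : {n : ℕ} → {k : Fin n → ℕ} → (a : Fin n → C) → (b : ∀ i, Fin (k i) → C) → (t : C) →
    (ops a t ⊗ tens (fun i => ops (b i) (a i)) ⟶ ops (concat b) t)
  /-- The operadic unit. -/
  one : (c : C) → (𝟙_ M ⟶ ops (fun _ : Fin 1 => c) c)
  perm_refl : ∀ {n : ℕ} (c : Fin n → C) (t : C),
    perm (Equiv.refl _) (fun _ => rfl) t = 𝟙 (ops c t)
  perm_trans : ∀ {l m n : ℕ} (e : Fin m ≃ Fin n) (e' : Fin l ≃ Fin m) {c : Fin n → C}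
    {c' : Fin m → C} {c'' : Fin l → C} (h : ∀ i, c' i = c (e i)) (h' : ∀ i, c'' i = c' (e' i))
    (t : C),
    perm e h t ≫ perm e' h' t = perm (e'.trans e) (fun i => (h' i).trans (h (e' i))) t
  /-- Equivariance with respect to permutations of the blocks. -/
  comp_perm_block : ∀ {m n : ℕ} (e : Fin m ≃ Fin n) {k : Fin n → ℕ} (a : Fin n → C)
    (b : ∀ i, Fin (k i) → C) (t : C),
    (perm e (fun _ => rfl) t ⊗ₘ tensPerm e (fun i => ops (b i) (a i))) ≫
        comp (fun i => a (e i)) (fun i => b (e i)) t =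
      comp a b t ≫ perm (blockEquiv e k) (concat_blockEquiv e b) t
  /-- Equivariance with respect to permutations inside the blocks. -/
  comp_perm_sum : ∀ {n : ℕ} {k k' : Fin n → ℕ} (e : ∀ i, Fin (k' i) ≃ Fin (k i)) (a : Fin n → C)
    (b : ∀ i, Fin (k i) → C) (t : C),
    (ops a t ◁ tensMap (fun i => perm (e i) (fun _ => rfl) (a i))) ≫
        comp a (fun i j => b i (e i j)) t =
      comp a b t ≫ perm (sumEquiv e) (concat_sumEquiv e b) t
  /-- Associativity. -/
  comp_assoc : ∀ {n : ℕ} {k : Fin n → ℕ} {m : ∀ i, Fin (k i) → ℕ} (a : Fin n → C)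
    (b : ∀ i, Fin (k i) → C) (c : ∀ i j, Fin (m i j) → C) (t : C),
    (ops a t ◁ tensMap (fun i => comp (b i) (c i) (a i))) ≫ comp a (fun i => concat (c i)) t =
      (ops a t ◁ (tensZip (fun i => ops (b i) (a i))
          (fun i => tens (fun j => ops (c i j) (b i j))) ≫
        (tens (fun i => ops (b i) (a i)) ◁ tensFlat (fun i j => ops (c i j) (b i j))))) ≫
      (α_ _ _ _).inv ≫
      (comp a b t ▷ tens (concat fun i j => ops (c i j) (b i j))) ≫
      comp (k := fun z => concat m z) (concat b) (fun z => c (unpos z).1 (unpos z).2) t ≫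
      perm (assocEquiv m) (concat_assocEquiv c) t
  /-- Left unitality. -/
  one_comp : ∀ {n : ℕ} (c : Fin n → C) (t : C),
    (one t ▷ tens (fun _ : Fin 1 => ops c t)) ≫
        comp (fun _ : Fin 1 => t) (fun _ => c) t ≫ perm (oneSumEquiv n) (concat_oneSumEquiv c) t =
      (λ_ _).hom ≫ (ρ_ (ops c t)).hom
  /-- Right unitality. -/
  comp_one : ∀ {n : ℕ} (c : Fin n → C) (t : C),
    (ops c t ◁ (tensUnit n ≫ tensMap (fun i => one (c i)))) ≫
        comp c (fun i _ => c i) t ≫ perm (sumOneEquiv n) (concat_sumOneEquiv c) t =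
      (ρ_ (ops c t)).hom

variable {M : Type u} [Category.{v} M] [MonoidalCategory M] [SymmetricCategory M]

namespace ColoredOperad

/-- A morphism of operads with the same colors. -/
@[ext]
structure Hom {C : Type w} (O P : ColoredOperad M C) where
  app : {n : ℕ} → (c : Fin n → C) → (t : C) → (O.ops c t ⟶ P.ops c t)
  app_perm : ∀ {m n : ℕ} (e : Fin m ≃ Fin n) {c : Fin n → C} {d : Fin m → C}
    (h : ∀ i, d i = c (e i)) (t : C), O.perm e h t ≫ app d t = app c t ≫ P.perm e h t
  app_comp : ∀ {n : ℕ} {k : Fin n → ℕ} (a : Fin n → C) (b : ∀ i, Fin (k i) → C) (t : C),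
    O.comp a b t ≫ app (concat b) t =
      (app a t ⊗ₘ tensMap (fun i => app (b i) (a i))) ≫ P.comp a b t
  app_one : ∀ c : C, O.one c ≫ app (fun _ : Fin 1 => c) c = P.one c

instance category {C : Type w} : Category (ColoredOperad M C) where
  Hom := Hom
  id O :=
    { app := fun c t => 𝟙 (O.ops c t)
      app_perm := fun e _ _ h t => by simp
      app_comp := fun a b t => by
        rw [tensMap_id]; simp
      app_one := fun c => by simp }
  comp {O P Q} φ ψ :=
    { app := fun c t => φ.app c t ≫ ψ.app c t
      app_perm := fun e _ _ h t => by
        rw [← Category.assoc, φ.app_perm, Category.assoc, ψ.app_perm, Category.assoc]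
      app_comp := fun a b t => by
        rw [← Category.assoc, φ.app_comp, Category.assoc, ψ.app_comp, tensMap_comp,
          tensorHom_comp_tensorHom_assoc]
      app_one := fun c => by rw [← Category.assoc, φ.app_one, ψ.app_one] }
  id_comp φ := by ext; simp
  comp_id φ := by ext; simp
  assoc φ ψ χ := by ext; simp

/-- The pullback of an operad along a map of colors. -/
def pullback {C D : Type*} (f : C → D) (P : ColoredOperad M D) : ColoredOperad M C where
  ops c t := P.ops (fun i => f (c i)) (f t)
  perm e _ _ h t := P.perm e (fun i => congrArg f (h i)) (f t)
  comp a b t := P.comp (fun i => f (a i)) (fun i j => f (b i j)) (f t)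
  one c := P.one (f c)
  perm_refl _ _ := P.perm_refl _ _
  perm_trans e e' _ _ _ _ _ _ := P.perm_trans e e' _ _ _
  comp_perm_block e _ _ b _ := P.comp_perm_block e _ (fun i j => f (b i j)) _
  comp_perm_sum e _ b _ := P.comp_perm_sum e _ (fun i j => f (b i j)) _
  comp_assoc _ b c _ := P.comp_assoc _ (fun i j => f (b i j)) (fun i j l => f (c i j l)) _
  one_comp _ _ := P.one_comp _ _
  comp_one c _ := P.comp_one (fun i => f (c i)) _

/-- The pullback of a morphism of operads along a map of colors. -/
def pullbackMap {C D : Type*} (f : C → D) {P Q : ColoredOperad M D} (φ : P ⟶ Q) :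
    P.pullback f ⟶ Q.pullback f where
  app c t := φ.app (fun i => f (c i)) (f t)
  app_perm e _ _ _ _ := φ.app_perm e _ _
  app_comp _ b _ := φ.app_comp _ (fun i j => f (b i j)) _
  app_one _ := φ.app_one _

@[ext]
theorem hom_ext {C : Type w} {O P : ColoredOperad M C} {φ ψ : O ⟶ P}
    (h : ∀ {n : ℕ} (c : Fin n → C) (t : C), φ.app c t = ψ.app c t) : φ = ψ := by
  apply Hom.ext
  funext n c t
  exact h c t

/-- The object of `n`-ary operations of a single-colored operad. -/
abbrev ar (P : ColoredOperad M PUnit.{w + 1}) (n : ℕ) : M :=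
  P.ops (fun _ : Fin n => PUnit.unit) PUnit.unit

/-- The permutation action of a single-colored operad. -/
abbrev arPerm (P : ColoredOperad M PUnit.{w + 1}) {m n : ℕ} (e : Fin m ≃ Fin n) :
    P.ar n ⟶ P.ar m :=
  P.perm e (fun _ => rfl) PUnit.unit

/-- The composition of a single-colored operad. -/
abbrev arComp (P : ColoredOperad M PUnit.{w + 1}) {n : ℕ} (k : Fin n → ℕ) :
    P.ar n ⊗ tens (fun i => P.ar (k i)) ⟶ P.ar (∑ i, k i) :=
  P.comp (fun _ => PUnit.unit) (fun _ _ => PUnit.unit) PUnit.unit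

/-- The unit of a single-colored operad. -/
abbrev arOne (P : ColoredOperad M PUnit.{w + 1}) : 𝟙_ M ⟶ P.ar 1 :=
  P.one PUnit.unit

end ColoredOperad

/-- Operads with varying sets of colors. -/
structure OperadVar (M : Type u) [Category.{v} M] [MonoidalCategory M] [SymmetricCategory M] where
  colors : Type w
  operad : ColoredOperad M colors

namespace OperadVar

/-- A morphism `(C, O) ⟶ (D, P)` is a map `f : C → D` and a morphism from `O` to the pullback of
`P` along `f`. -/
structure Hom (O P : OperadVar.{w} M) where
  onColors : O.colors → P.colors
  onOps : O.operad ⟶ P.operad.pullback onColors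

instance category : Category (OperadVar.{w} M) where
  Hom := Hom
  id O := ⟨id, 𝟙 O.operad⟩
  comp φ ψ := ⟨ψ.onColors ∘ φ.onColors,
    φ.onOps ≫ ColoredOperad.pullbackMap φ.onColors ψ.onOps⟩
  id_comp φ := congrArg (Hom.mk φ.onColors) (Category.id_comp φ.onOps)
  comp_id φ := congrArg (Hom.mk φ.onColors) (Category.comp_id φ.onOps)
  assoc φ ψ χ := congrArg (Hom.mk (χ.onColors ∘ ψ.onColors ∘ φ.onColors))
    (Category.assoc φ.onOps (ColoredOperad.pullbackMap φ.onColors ψ.onOps)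
      (ColoredOperad.pullbackMap (ψ.onColors ∘ φ.onColors) χ.onOps))

/-- A morphism of operads with the same colors, as a morphism of operads with varying colors. -/
def ofHom {C : Type w} {O P : ColoredOperad M C} (φ : O ⟶ P) :
    (⟨C, O⟩ : OperadVar.{w} M) ⟶ ⟨C, P⟩ :=
  ({ onColors := id, onOps := φ } : Hom ⟨C, O⟩ ⟨C, P⟩)

/-- The components of a morphism on the objects of operations. -/
def opsMap {X Y : OperadVar.{w} M} (φ : X ⟶ Y) {n : ℕ} (c : Fin n → X.colors) (t : X.colors) :
    X.operad.ops c t ⟶ Y.operad.ops (fun i => φ.onColors (c i)) (φ.onColors t) :=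
  φ.onOps.app c t

theorem opsMap_perm {X Y : OperadVar.{w} M} (φ : X ⟶ Y) {m n : ℕ} (e : Fin m ≃ Fin n)
    {c : Fin n → X.colors} {d : Fin m → X.colors} (h : ∀ i, d i = c (e i)) (t : X.colors) :
    X.operad.perm e h t ≫ opsMap φ d t =
      opsMap φ c t ≫ Y.operad.perm e (fun i => congrArg φ.onColors (h i)) (φ.onColors t) :=
  φ.onOps.app_perm e h t

theorem opsMap_comp {X Y : OperadVar.{w} M} (φ : X ⟶ Y) {n : ℕ} {k : Fin n → ℕ}
    (a : Fin n → X.colors) (b : ∀ i, Fin (k i) → X.colors) (t : X.colors) :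
    X.operad.comp a b t ≫ opsMap φ (concat b) t =
      (opsMap φ a t ⊗ₘ tensMap (fun i => opsMap φ (b i) (a i))) ≫
        Y.operad.comp (fun i => φ.onColors (a i)) (fun i j => φ.onColors (b i j))
          (φ.onColors t) :=
  φ.onOps.app_comp a b t

theorem opsMap_one {X Y : OperadVar.{w} M} (φ : X ⟶ Y) (c : X.colors) :
    X.operad.one c ≫ opsMap φ (fun _ : Fin 1 => c) c = Y.operad.one (φ.onColors c) :=
  φ.onOps.app_one c

end OperadVar

end Operad

section Algebra

variable {M : Type u} [Category.{v} M] [MonoidalCategory M] [SymmetricCategory M]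

/-- An algebra over a colored operad. -/
structure OpAlgebra {C : Type w} (O : ColoredOperad M C) where
  carrier : C → M
  /-- The action of the operad. -/
  act : {n : ℕ} → (c : Fin n → C) → (t : C) →
    (O.ops c t ⊗ tens (fun i => carrier (c i)) ⟶ carrier t)
  act_assoc : ∀ {n : ℕ} {k : Fin n → ℕ} (a : Fin n → C) (b : ∀ i, Fin (k i) → C) (t : C),
    (O.ops a t ◁ tensMap (fun i => act (b i) (a i))) ≫ act a t =
      (O.ops a t ◁ (tensZip (fun i => O.ops (b i) (a i))
          (fun i => tens (fun j => carrier (b i j))) ≫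
        (tens (fun i => O.ops (b i) (a i)) ◁ tensFlat (fun i j => carrier (b i j))))) ≫
      (α_ _ _ _).inv ≫
      (O.comp a b t ▷ tens (fun x => carrier (concat b x))) ≫
      act (concat b) t
  act_one : ∀ c : C,
    (O.one c ▷ tens (fun _ : Fin 1 => carrier c)) ≫ act (fun _ : Fin 1 => c) c =
      (λ_ _).hom ≫ (ρ_ (carrier c)).hom
  act_perm : ∀ {m n : ℕ} (e : Fin m ≃ Fin n) (c : Fin n → C) (t : C),
    (O.perm e (fun _ => rfl) t ⊗ₘ tensPerm e (fun i => carrier (c i))) ≫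
      act (fun i => c (e i)) t = act c t

namespace OpAlgebra

/-- A morphism of algebras. -/
@[ext]
structure Hom {C : Type w} {O : ColoredOperad M C} (A B : OpAlgebra O) where
  app : (c : C) → (A.carrier c ⟶ B.carrier c)
  app_act : ∀ {n : ℕ} (c : Fin n → C) (t : C),
    A.act c t ≫ app t = (O.ops c t ◁ tensMap (fun i => app (c i))) ≫ B.act c t

instance category {C : Type w} (O : ColoredOperad M C) : Category (OpAlgebra O) where
  Hom := Hom
  id A :=
    { app := fun c => 𝟙 (A.carrier c)
      app_act := fun c t => by rw [tensMap_id]; simp }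
  comp φ ψ :=
    { app := fun c => φ.app c ≫ ψ.app c
      app_act := fun c t => by
        rw [tensMap_comp, ← Category.assoc, φ.app_act, Category.assoc, ψ.app_act]
        simp }
  id_comp φ := by ext; simp
  comp_id φ := by ext; simp
  assoc φ ψ χ := by ext; simp

@[ext]
theorem hom_ext {C : Type w} {O : ColoredOperad M C} {A B : OpAlgebra O} {φ ψ : A ⟶ B}
    (h : ∀ c : C, φ.app c = ψ.app c) : φ = ψ := by
  apply Hom.ext
  funext c
  exact h c

@[simp]
theorem id_app {C : Type w} {O : ColoredOperad M C} (A : OpAlgebra O) (c : C) :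
    Hom.app (𝟙 A) c = 𝟙 (A.carrier c) := rfl

@[simp]
theorem comp_app {C : Type w} {O : ColoredOperad M C} {A B D : OpAlgebra O} (φ : A ⟶ B)
    (ψ : B ⟶ D) (c : C) : Hom.app (φ ≫ ψ) c = φ.app c ≫ ψ.app c := rfl

end OpAlgebra

/-- The pullback of algebras along a morphism of operads with varying colors. -/
def algPullback {X Y : OperadVar.{w} M} (φ : X ⟶ Y) :
    OpAlgebra Y.operad ⥤ OpAlgebra X.operad where
  obj A :=
    { carrier := fun c => A.carrier (φ.onColors c)
      act := fun c t => (OperadVar.opsMap φ c t ▷ _) ≫ A.act (fun i => φ.onColors (c i)) (φ.onColors t)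
      act_assoc := fun a b t => by
        have h := A.act_assoc (fun i => φ.onColors (a i)) (fun i j => φ.onColors (b i j))
          (φ.onColors t)
        have hz := tensZip_natural (fun i => OperadVar.opsMap φ (b i) (a i))
          (fun i => 𝟙 (tens (fun j => A.carrier (φ.onColors (b i j)))))
        have hc := OperadVar.opsMap_comp φ a b t
        rw [tensMap_id] at hz
        simp only [tensorHom_id] at hz
        rw [tensMap_comp, MonoidalCategory.whiskerLeft_comp, Category.assoc,
          whisker_exchange_assoc, h, ← whisker_exchange_assoc,
          ← MonoidalCategory.whiskerLeft_comp_assoc, ← Category.assoc (tensMap _), hz,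
          ← comp_whiskerRight_assoc, hc]
        simp only [MonoidalCategory.whiskerLeft_comp, Category.assoc,
          associator_inv_naturality_left_assoc, tensorHom_def',
          comp_whiskerRight]
        rw [← MonoidalCategory.whiskerLeft_comp_assoc (X.operad.ops a t) (_ ▷ _),
          ← whisker_exchange, MonoidalCategory.whiskerLeft_comp_assoc,
          associator_inv_naturality_middle_assoc]
      act_one := fun c => by
        rw [← A.act_one, ← OperadVar.opsMap_one φ c, comp_whiskerRight, Category.assoc]
      act_perm := fun e c t => by
        have h := OperadVar.opsMap_perm φ e (c := c) (fun _ => rfl) t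
        rw [← A.act_perm e, ← tensorHom_id, ← tensorHom_id, tensorHom_comp_tensorHom_assoc,
          tensorHom_comp_tensorHom_assoc, h, Category.comp_id, Category.id_comp] }
  map f :=
    { app := fun c => f.app (φ.onColors c)
      app_act := fun c t => by
        have h := f.app_act (fun i => φ.onColors (c i)) (φ.onColors t)
        rw [Category.assoc, h, whisker_exchange_assoc] }

end Algebra

section Orthogonal

/-- An orthogonal category: a small category with a relation on the pairs of morphisms with a
common target that is symmetric and stable under compositions. -/
structure OrthCat where
  carrier : Type v
  [cat : SmallCategory carrier]
  perp : ∀ {c₁ c₂ c : carrier}, (c₁ ⟶ c) → (c₂ ⟶ c) → Prop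
  perp_symm : ∀ {c₁ c₂ c : carrier} {f₁ : c₁ ⟶ c} {f₂ : c₂ ⟶ c}, perp f₁ f₂ → perp f₂ f₁
  perp_comp : ∀ {b₁ b₂ c₁ c₂ c d : carrier} {f₁ : c₁ ⟶ c} {f₂ : c₂ ⟶ c} (g : c ⟶ d)
    (h₁ : b₁ ⟶ c₁) (h₂ : b₂ ⟶ c₂), perp f₁ f₂ → perp (h₁ ≫ f₁ ≫ g) (h₂ ≫ f₂ ≫ g)

attribute [instance] OrthCat.cat

namespace OrthCat

/-- An orthogonal functor. -/
structure Hom (C D : OrthCat.{v}) where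
  functor : C.carrier ⥤ D.carrier
  map_perp : ∀ {c₁ c₂ c : C.carrier} {f₁ : c₁ ⟶ c} {f₂ : c₂ ⟶ c}, C.perp f₁ f₂ →
    D.perp (functor.map f₁) (functor.map f₂)

instance category : Category OrthCat.{v} where
  Hom := Hom
  id C := ⟨𝟭 C.carrier, fun h => h⟩
  comp F G := ⟨F.functor ⋙ G.functor, fun h => G.map_perp (F.map_perp h)⟩

end OrthCat

end Orthogonal

section Sequences

variable (M : Type u) [Category.{v} M]

/-- `C`-colored (non-symmetric) sequences with values in `M`. -/
def ColoredSeq (C : Type w) : Type (max w u) :=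
  ∀ n : ℕ, (Fin n → C) → C → M

instance ColoredSeq.category (C : Type w) : Category (ColoredSeq M C) :=
  inferInstanceAs (Category (∀ n : ℕ, (Fin n → C) → C → M))

variable {M} [MonoidalCategory M] [SymmetricCategory M]

/-- The forgetful functor from operads to sequences. -/
def forgetSeq (C : Type w) : ColoredOperad M C ⥤ ColoredSeq M C where
  obj O := fun _ c t => O.ops c t
  map φ := fun _ c t => φ.app c t

/-- `π : P ⟶ Q` exhibits the operad `Q` as the coequalizer, in the category of `C`-colored operads,
of the two morphisms from the free operad on the sequence `R` to `P` that correspond to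
`r₁, r₂ : R ⟶ P`, i.e. it is universal among the operad morphisms out of `P` that identify `r₁`
and `r₂`. -/
structure IsQuotientBy {C : Type w} {R : ColoredSeq M C} {P Q : ColoredOperad M C}
    (r₁ r₂ : R ⟶ (forgetSeq C).obj P) (π : P ⟶ Q) : Prop where
  condition : r₁ ≫ (forgetSeq C).map π = r₂ ≫ (forgetSeq C).map π
  existsUnique : ∀ {X : ColoredOperad M C} (φ : P ⟶ X),
    r₁ ≫ (forgetSeq C).map φ = r₂ ≫ (forgetSeq C).map φ → ∃! ψ : Q ⟶ X, π ≫ ψ = φ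

/-- For every free operad functor (left adjoint of the forgetful functor) this is the coequalizer
property. -/
theorem isQuotientBy_iff {C : Type w} {F : ColoredSeq M C ⥤ ColoredOperad M C}
    (adj : F ⊣ forgetSeq C) {R : ColoredSeq M C} {P Q : ColoredOperad M C}
    (r₁ r₂ : R ⟶ (forgetSeq C).obj P) (π : P ⟶ Q) :
    IsQuotientBy r₁ r₂ π ↔
      ∃ h : (adj.homEquiv R P).symm r₁ ≫ π = (adj.homEquiv R P).symm r₂ ≫ π,
        Nonempty (IsColimit (Cofork.ofπ π h)) := by
  have key : ∀ {X : ColoredOperad M C} (φ : P ⟶ X),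
      r₁ ≫ (forgetSeq C).map φ = r₂ ≫ (forgetSeq C).map φ ↔
        (adj.homEquiv R P).symm r₁ ≫ φ = (adj.homEquiv R P).symm r₂ ≫ φ := by
    intro X φ
    rw [← adj.homEquiv_naturality_right_symm, ← adj.homEquiv_naturality_right_symm,
      EmbeddingLike.apply_eq_iff_eq]
  constructor
  · intro H
    refine ⟨(key π).1 H.condition, ⟨Cofork.IsColimit.mk' _ fun s => ?_⟩⟩
    have e := H.existsUnique s.π ((key _).2 s.condition)
    exact ⟨e.choose, e.choose_spec.1, fun hm => e.choose_spec.2 _ hm⟩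
  · rintro ⟨h, ⟨hl⟩⟩
    refine ⟨(key π).2 h, fun φ hφ => ?_⟩
    refine ⟨hl.desc (Cofork.ofπ φ ((key φ).1 hφ)), hl.fac _ WalkingParallelPair.one, ?_⟩
    intro ψ hψ
    refine Cofork.IsColimit.hom_ext hl ?_
    exact hψ.trans (hl.fac (Cofork.ofπ φ ((key φ).1 hφ)) WalkingParallelPair.one).symm

variable [HasColimits M]

variable (M) in
/-- The single-colored sequence `I[2]`: the monoidal unit in arity `2`, initial otherwise. -/
noncomputable def arityTwo : ColoredSeq M PUnit.{v + 1} := fun n _ _ =>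
  match n with
  | 2 => 𝟙_ M
  | _ => ⊥_ M

variable (M) in
/-- An (arity 2) bipointed single-colored operad. -/
structure BipointedOperad where
  operad : ColoredOperad M PUnit.{v + 1}
  r₁ : arityTwo M ⟶ (forgetSeq _).obj operad
  r₂ : arityTwo M ⟶ (forgetSeq _).obj operad

namespace BipointedOperad

/-- A morphism of single-colored operads that preserves the points. -/
@[ext]
structure Hom (P Q : BipointedOperad M) where
  hom : P.operad ⟶ Q.operad
  map_r₁ : P.r₁ ≫ (forgetSeq _).map hom = Q.r₁
  map_r₂ : P.r₂ ≫ (forgetSeq _).map hom = Q.r₂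

noncomputable instance category : Category (BipointedOperad M) where
  Hom := Hom
  id P := ⟨𝟙 P.operad, by simp, by simp⟩
  comp φ ψ := ⟨φ.hom ≫ ψ.hom, by
    rw [Functor.map_comp, ← Category.assoc, φ.map_r₁, ψ.map_r₁], by
    rw [Functor.map_comp, ← Category.assoc, φ.map_r₂, ψ.map_r₂]⟩
  id_comp φ := by apply Hom.ext; simp
  comp_id φ := by apply Hom.ext; simp
  assoc φ ψ χ := by apply Hom.ext; simp

/-- The operation of arity `2` picked out by a morphism from `I[2]`. -/
noncomputable def point (P : BipointedOperad M) (r : arityTwo M ⟶ (forgetSeq _).obj P.operad) :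
    𝟙_ M ⟶ P.operad.ar 2 :=
  r 2 (fun _ => PUnit.unit) PUnit.unit

end BipointedOperad

end Sequences

section FieldTheories

variable {M : Type u} [Category.{v} M] [MonoidalCategory M] [SymmetricCategory M] [HasColimits M]

/-- The object underlying an algebra over a single-colored operad. -/
abbrev OpAlgebra.pt {P : ColoredOperad M PUnit.{w + 1}} (A : OpAlgebra P) : M :=
  A.carrier PUnit.unit

/-- The action of the `n`-ary operations of a single-colored operad. -/
abbrev OpAlgebra.actPt {P : ColoredOperad M PUnit.{w + 1}} (A : OpAlgebra P) (n : ℕ) :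
    P.ar n ⊗ tens (fun _ : Fin n => A.pt) ⟶ A.pt :=
  A.act (fun _ : Fin n => PUnit.unit) PUnit.unit

/-- The defining property of field theories: the two distinguished operations agree after
precomposition with an orthogonal pair of morphisms. -/
def IsFieldTheory (C : OrthCat.{v}) (P : BipointedOperad M)
    (A : C.carrier ⥤ OpAlgebra P.operad) : Prop :=
  ∀ (c : Fin 2 → C.carrier) (t : C.carrier) (f : ∀ i, c i ⟶ t), C.perp (f 0) (f 1) →
    (P.point P.r₁ ⊗ₘ tensMap (fun i => (A.map (f i)).app PUnit.unit)) ≫ (A.obj t).actPt 2 =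
      (P.point P.r₂ ⊗ₘ tensMap (fun i => (A.map (f i)).app PUnit.unit)) ≫ (A.obj t).actPt 2

/-- The category of field theories of type `P` on `C`: a full subcategory of the functors from
`C` to `P`-algebras. -/
abbrev FT (C : OrthCat.{v}) (P : BipointedOperad M) :=
  ObjectProperty.FullSubcategory (IsFieldTheory C P)

/-- The pullback of algebras along a morphism of single-colored operads. -/
abbrev pointedPullback {P Q : BipointedOperad M} (φ : P ⟶ Q) :
    OpAlgebra Q.operad ⥤ OpAlgebra P.operad :=
  algPullback (OperadVar.ofHom φ.hom)

theorem isFieldTheory_pullback {C D : OrthCat.{v}} {P Q : BipointedOperad M} (F : C ⟶ D)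
    (φ : P ⟶ Q) (A : D.carrier ⥤ OpAlgebra Q.operad) (hA : IsFieldTheory D Q A) :
    IsFieldTheory C P (F.functor ⋙ A ⋙ pointedPullback φ) := by
  intro c t f hf
  have h := hA (fun i => F.functor.obj (c i)) (F.functor.obj t) (fun i => F.functor.map (f i))
    (F.map_perp hf)
  have h₁ : P.point P.r₁ ≫ φ.hom.app (fun _ => PUnit.unit) PUnit.unit = Q.point Q.r₁ :=
    congrFun (congrFun (congrFun φ.map_r₁ 2) fun _ => PUnit.unit) PUnit.unit
  have h₂ : P.point P.r₂ ≫ φ.hom.app (fun _ => PUnit.unit) PUnit.unit = Q.point Q.r₂ :=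
    congrFun (congrFun (congrFun φ.map_r₂ 2) fun _ => PUnit.unit) PUnit.unit
  have key : ∀ {p : 𝟙_ M ⟶ P.operad.ar 2} {q : 𝟙_ M ⟶ Q.operad.ar 2},
      p ≫ φ.hom.app (fun _ => PUnit.unit) PUnit.unit = q →
      (p ⊗ₘ tensMap (fun i => (A.map (F.functor.map (f i))).app PUnit.unit)) ≫
        (φ.hom.app (fun _ => PUnit.unit) PUnit.unit ▷ _) ≫ (A.obj (F.functor.obj t)).actPt 2 =
      (q ⊗ₘ tensMap (fun i => (A.map (F.functor.map (f i))).app PUnit.unit)) ≫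
        (A.obj (F.functor.obj t)).actPt 2 := by
    rintro p q rfl
    rw [← tensorHom_id, tensorHom_comp_tensorHom_assoc, Category.comp_id]
  exact (key h₁).trans (h.trans (key h₂).symm)

/-- The functor `A ↦ φ^* ∘ A ∘ F` on field theories. -/
def ftPullback {C D : OrthCat.{v}} {P Q : BipointedOperad M} (F : C ⟶ D) (φ : P ⟶ Q) :
    FT D Q ⥤ FT C P :=
  ObjectProperty.lift _
    (ObjectProperty.ι _ ⋙ (Functor.whiskeringLeft _ _ _).obj F.functor ⋙
      (Functor.whiskeringRight _ _ _).obj (pointedPullback φ))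
    (fun A => isFieldTheory_pullback F φ A.obj A.property)

end FieldTheories

section Coproducts

variable {M : Type u} [Category.{v} M]

/-- A family of morphisms with a common target is jointly epimorphic. -/
def JointEpi {S : Type*} {X : S → M} {Y : M} (i : ∀ s, X s ⟶ Y) : Prop :=
  ∀ ⦃Z : M⦄ ⦃f g : Y ⟶ Z⦄, (∀ s, i s ≫ f = i s ≫ g) → f = g

theorem jointEpi_sigma [HasColimits M] {S : Type v} (X : S → M) : JointEpi (Sigma.ι X) :=
  fun _ _ _ h => Sigma.hom_ext _ _ h

variable [MonoidalCategory M]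

theorem JointEpi.whiskerLeft [MonoidalClosed M] {S : Type*} {X : S → M} {Y : M} {i : ∀ s, X s ⟶ Y}
    (h : JointEpi i) (A : M) : JointEpi (fun s => A ◁ i s) := by
  intro Z f g hfg
  apply MonoidalClosed.curry_injective
  apply h
  intro s
  rw [← MonoidalClosed.curry_natural_left, ← MonoidalClosed.curry_natural_left, hfg]

variable [SymmetricCategory M] [MonoidalClosed M]

theorem JointEpi.whiskerRight {S : Type*} {X : S → M} {Y : M} {i : ∀ s, X s ⟶ Y}
    (h : JointEpi i) (A : M) : JointEpi (fun s => i s ▷ A) := by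
  intro Z f g hfg
  rw [← cancel_epi (β_ A Y).hom]
  apply h.whiskerLeft A
  intro s
  have := hfg s
  dsimp only at this ⊢
  rw [BraidedCategory.braiding_naturality_right_assoc,
    BraidedCategory.braiding_naturality_right_assoc, this]

theorem JointEpi.tensor {S T : Type*} {X : S → M} {Y : M} {i : ∀ s, X s ⟶ Y} (h : JointEpi i)
    {X' : T → M} {Y' : M} {i' : ∀ t, X' t ⟶ Y'} (h' : JointEpi i') :
    JointEpi (fun p : S × T => i p.1 ⊗ₘ i' p.2) := by
  intro Z f g hfg
  apply h.whiskerRight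
  intro s
  apply h'.whiskerLeft
  intro t
  have := hfg (s, t)
  dsimp only at this ⊢
  rwa [tensorHom_def', Category.assoc, Category.assoc] at this

theorem jointEpi_tens : ∀ {n : ℕ} {S : Fin n → Type*} {X : ∀ i, S i → M} {Y : Fin n → M}
    {j : ∀ i s, X i s ⟶ Y i}, (∀ i, JointEpi (j i)) →
      JointEpi (fun s : ∀ i, S i => tensMap (fun i => j i (s i)))
  | 0, S, X, Y, j, h => by
    intro Z f g hfg
    have := hfg (fun i => i.elim0)
    exact (Category.id_comp f).symm.trans (this.trans (Category.id_comp g))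
  | n + 1, S, X, Y, j, h => by
    intro Z f g hfg
    apply (h 0).tensor (jointEpi_tens fun i => h i.succ)
    rintro ⟨s, s'⟩
    exact hfg (Fin.cons s s')

variable [HasColimits M]

/-- The morphism out of `(∐ X) ⊗ B` with the given components. -/
noncomputable def descRight {S : Type v} {X : S → M} {B Z : M} (φ : ∀ s, X s ⊗ B ⟶ Z) :
    (∐ X) ⊗ B ⟶ Z :=
  (β_ _ _).hom ≫
    MonoidalClosed.uncurry (Sigma.desc fun s => MonoidalClosed.curry ((β_ _ _).hom ≫ φ s))

theorem ι_descRight {S : Type v} {X : S → M} {B Z : M} (φ : ∀ s, X s ⊗ B ⟶ Z) (s : S) :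
    (Sigma.ι X s ▷ B) ≫ descRight φ = φ s := by
  rw [descRight, BraidedCategory.braiding_naturality_left_assoc,
    ← MonoidalClosed.uncurry_natural_left, Sigma.ι_desc, MonoidalClosed.uncurry_curry]
  simp

/-- The morphism out of `⊗ i, ∐ (X i)` with the given components. -/
noncomputable def tensDesc : {n : ℕ} → {S : Fin n → Type v} → {X : ∀ i, S i → M} → {Z : M} →
    (∀ s : (∀ i, S i), tens (fun i => X i (s i)) ⟶ Z) → (tens (fun i => ∐ X i) ⟶ Z)
  | 0, _, _, _, φ => φ (fun i => i.elim0)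
  | _ + 1, _, X, _, φ =>
      descRight fun s => MonoidalClosed.uncurry (tensDesc fun s' =>
        MonoidalClosed.curry (A := X 0 s) (Y := tens fun i => X i.succ (s' i))
          (φ (Fin.cons s s')))

theorem ι_tensDesc : ∀ {n : ℕ} {S : Fin n → Type v} {X : ∀ i, S i → M} {Z : M}
    (φ : ∀ s : (∀ i, S i), tens (fun i => X i (s i)) ⟶ Z) (s : ∀ i, S i),
    tensMap (fun i => Sigma.ι (X i) (s i)) ≫ tensDesc φ = φ s
  | 0, S, X, Z, φ, s => by
    obtain rfl : s = fun i => i.elim0 := funext fun i => i.elim0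
    exact Category.id_comp _
  | n + 1, S, X, Z, φ, s => by
    obtain ⟨s₀, s', rfl⟩ : ∃ s₀ s', s = Fin.cons s₀ s' :=
      ⟨s 0, Fin.tail s, (Fin.cons_self_tail s).symm⟩
    have ih := ι_tensDesc (fun s' => MonoidalClosed.curry (A := X 0 s₀)
      (Y := tens fun i => X i.succ (s' i)) (φ (Fin.cons s₀ s'))) s'
    have h : (Sigma.ι (X 0) s₀ ⊗ₘ tensMap (fun i => Sigma.ι (X (Fin.succ i)) (s' i))) ≫
        tensDesc φ = φ (Fin.cons s₀ s') := by
      rw [tensDesc, tensorHom_def', Category.assoc, ι_descRight,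
        ← MonoidalClosed.uncurry_natural_left, ih]
      exact MonoidalClosed.uncurry_curry _
    exact h

end Coproducts

section PC

variable {M : Type u} [Category.{v} M] [MonoidalCategory M] [SymmetricCategory M]
  [MonoidalClosed M] [HasColimits M]

variable {K : Type v} [SmallCategory K]

/-- The tuple `(f₁ g₁₁, …, fₙ gₙₖ)` of composite morphisms. -/
def homComp {n : ℕ} {k : Fin n → ℕ} {a : Fin n → K} {b : ∀ i, Fin (k i) → K} {t : K}
    (f : ∀ i, a i ⟶ t) (g : ∀ i j, b i j ⟶ a i) (x : Fin (∑ i, k i)) : concat b x ⟶ t :=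
  g (unpos x).1 (unpos x).2 ≫ f (unpos x).1

/-- The permuted tuple `(f (e 0), …, f (e (n - 1)))`. -/
def homPerm {m n : ℕ} (e : Fin m ≃ Fin n) {c : Fin n → K} {d : Fin m → K}
    (h : ∀ i, d i = c (e i)) {t : K} (f : ∀ i, c i ⟶ t) (i : Fin m) : d i ⟶ t :=
  eqToHom (h i) ≫ f (e i)

/-- The object `C(c, t) ⊗ P(n) = ∐_{f ∈ C(c, t)} P(n)`. -/
noncomputable abbrev pcOps (P : ColoredOperad M PUnit.{v + 1}) {n : ℕ} (c : Fin n → K) (t : K) : M :=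
  ∐ fun _ : (∀ i, c i ⟶ t) => P.ar n

/-- The inclusion of the summand labeled by `f`. -/
noncomputable abbrev pcι (P : ColoredOperad M PUnit.{v + 1}) {n : ℕ} {c : Fin n → K} {t : K}
    (f : ∀ i, c i ⟶ t) : P.ar n ⟶ pcOps P c t :=
  Sigma.ι (fun _ : (∀ i, c i ⟶ t) => P.ar n) f

variable (P : ColoredOperad M PUnit.{v + 1})

/-- The permutation action permutes the labels of the summands and acts on `P`. -/
noncomputable def pcPerm {m n : ℕ} (e : Fin m ≃ Fin n) {c : Fin n → K} {d : Fin m → K}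
    (h : ∀ i, d i = c (e i)) (t : K) : pcOps P c t ⟶ pcOps P d t :=
  Sigma.desc fun f => P.arPerm e ≫ pcι P (homPerm e h f)

theorem ι_pcPerm {m n : ℕ} (e : Fin m ≃ Fin n) {c : Fin n → K} {d : Fin m → K}
    (h : ∀ i, d i = c (e i)) {t : K} (f : ∀ i, c i ⟶ t) :
    pcι P f ≫ pcPerm P e h t = P.arPerm e ≫ pcι P (homPerm e h f) :=
  Sigma.ι_desc _ _

/-- The composition composes the labels of the summands and the operations of `P`. -/
noncomputable def pcComp {n : ℕ} {k : Fin n → ℕ} (a : Fin n → K) (b : ∀ i, Fin (k i) → K) (t : K) :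
    pcOps P a t ⊗ tens (fun i => pcOps P (b i) (a i)) ⟶ pcOps P (concat b) t :=
  descRight fun f => MonoidalClosed.uncurry (tensDesc fun g =>
    MonoidalClosed.curry (P.arComp k ≫ pcι P (homComp f g)))

theorem ι_pcComp {n : ℕ} {k : Fin n → ℕ} {a : Fin n → K} {b : ∀ i, Fin (k i) → K} {t : K}
    (f : ∀ i, a i ⟶ t) (g : ∀ i j, b i j ⟶ a i) :
    (pcι P f ⊗ₘ tensMap (fun i => pcι P (g i))) ≫ pcComp P a b t =
      P.arComp k ≫ pcι P (homComp f g) := by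
  rw [pcComp, tensorHom_def', Category.assoc, ι_descRight,
    ← MonoidalClosed.uncurry_natural_left]
  have h := ι_tensDesc (S := fun i => ∀ j, b i j ⟶ a i) (X := fun i _ => P.ar (k i))
    (fun g => MonoidalClosed.curry (P.arComp k ≫ pcι P (homComp f g))) g
  rw [h]
  exact MonoidalClosed.uncurry_curry _

theorem jointEpi_pcι {n : ℕ} (c : Fin n → K) (t : K) :
    JointEpi (fun f : (∀ i, c i ⟶ t) => pcι P f) :=
  jointEpi_sigma _

theorem jointEpi_pcComp {n : ℕ} {k : Fin n → ℕ} (a : Fin n → K) (b : ∀ i, Fin (k i) → K) (t : K) :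
    JointEpi (fun p : (∀ i, a i ⟶ t) × (∀ i j, b i j ⟶ a i) =>
      pcι P p.1 ⊗ₘ tensMap (fun i => pcι (c := b i) P (p.2 i))) :=
  (jointEpi_pcι P a t).tensor (jointEpi_tens fun i => jointEpi_pcι P (b i) (a i))

/-- Transport of the summand label along an equality. -/
theorem pcι_congr {n : ℕ} {c : Fin n → K} {t : K} {f g : ∀ i, c i ⟶ t} (h : f = g) :
    pcι P f = pcι P g := by rw [h]

theorem hom_whisker_assoc {N : Type*} [Category N] [MonoidalCategory N] {A A' B B' D Z : N}
    (a : A ⟶ A') (b : B ⟶ B') (c : B' ⟶ D) (z : A' ⊗ D ⟶ Z) :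
    (a ⊗ₘ b) ≫ (A' ◁ c) ≫ z = (a ⊗ₘ (b ≫ c)) ≫ z := by
  rw [← Category.assoc, hom_whisker]

theorem assoc_push {N : Type*} [Category N] [MonoidalCategory N]
    {A A' B B' D D' E E' F F' G G' X X' : N} {x : A ⟶ A'} {y : B ⟶ B'} {y' : D ⟶ D'}
    {μ : A ⊗ B ⟶ E} {μ' : A' ⊗ B' ⟶ E'} {ε : E ⟶ E'} (hμ : (x ⊗ₘ y) ≫ μ' = μ ≫ ε)
    {ν : E ⊗ D ⟶ F} {ν' : E' ⊗ D' ⟶ F'} {φ : F ⟶ F'} (hν : (ε ⊗ₘ y') ≫ ν' = ν ≫ φ)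
    {p : F ⟶ G} {p' : F' ⟶ G'} {γ : G ⟶ G'} (hp : φ ≫ p' = p ≫ γ)
    {w : X ⟶ X'} {z : X ⟶ B ⊗ D} {z' : X' ⟶ B' ⊗ D'} (hz : w ≫ z' = z ≫ (y ⊗ₘ y')) :
    (x ⊗ₘ w) ≫ (A' ◁ z') ≫ (α_ A' B' D').inv ≫ (μ' ▷ D') ≫ ν' ≫ p' =
      ((A ◁ z) ≫ (α_ A B D).inv ≫ (μ ▷ D) ≫ ν ≫ p) ≫ γ := by
  rw [hom_whisker_assoc, hz, ← whisker_hom, Category.assoc, associator_inv_naturality_assoc,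
    ← tensorHom_id μ', tensorHom_comp_tensorHom_assoc, hμ, Category.comp_id]
  have h : ((μ ≫ ε) ⊗ₘ y') = (μ ▷ D) ≫ (ε ⊗ₘ y') := by
    rw [← tensorHom_id, tensorHom_comp_tensorHom, Category.id_comp]
  rw [h, Category.assoc, ← Category.assoc (ε ⊗ₘ y'), hν, Category.assoc, hp]
  simp only [Category.assoc]

theorem one_push {N : Type*} [Category N] [MonoidalCategory N]
    {I A A' B B' F F' G G' : N} {o : I ⟶ A} {x : A ⟶ A'} {y : B ⟶ B'}
    {ν : A ⊗ B ⟶ F} {ν' : A' ⊗ B' ⟶ F'} {φ : F ⟶ F'} (hν : (x ⊗ₘ y) ≫ ν' = ν ≫ φ)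
    {p : F ⟶ G} {p' : F' ⟶ G'} {γ : G ⟶ G'} (hp : φ ≫ p' = p ≫ γ) :
    (I ◁ y) ≫ ((o ≫ x) ▷ B') ≫ ν' ≫ p' = ((o ▷ B) ≫ ν ≫ p) ≫ γ := by
  rw [comp_whiskerRight, Category.assoc, whisker_exchange_assoc, ← tensorHom_def'_assoc,
    ← Category.assoc (x ⊗ₘ y), hν]
  simp only [Category.assoc, hp]

theorem push_one {N : Type*} [Category N] [MonoidalCategory N]
    {I A A' B B' F F' G G' : N} {o : I ⟶ B} {x : A ⟶ A'} {y : B ⟶ B'}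
    {ν : A ⊗ B ⟶ F} {ν' : A' ⊗ B' ⟶ F'} {φ : F ⟶ F'} (hν : (x ⊗ₘ y) ≫ ν' = ν ≫ φ)
    {p : F ⟶ G} {p' : F' ⟶ G'} {γ : G ⟶ G'} (hp : φ ≫ p' = p ≫ γ) :
    (x ▷ I) ≫ (A' ◁ (o ≫ y)) ≫ ν' ≫ p' = ((A ◁ o) ≫ ν ≫ p) ≫ γ := by
  rw [← whisker_exchange_assoc, MonoidalCategory.whiskerLeft_comp, Category.assoc,
    ← tensorHom_def'_assoc, ← Category.assoc (x ⊗ₘ y), hν]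
  simp only [Category.assoc, hp]

theorem homPerm_comp_eq {ι : Type*} {a : ι → K} {t : K} (F : ∀ p, a p ⟶ t) {p q : ι} (h : p = q)
    (h' : a p = a q) : eqToHom h' ≫ F q = F p := by
  subst h; simp

end PC

/-- The colored operad `P_C` whose algebras are the functors from `C` to `P`-algebras. -/
noncomputable def pcOperad {M : Type u} [Category.{v} M] [MonoidalCategory M]
    [SymmetricCategory M] [MonoidalClosed M] [HasColimits M] (K : Type v) [SmallCategory K] (P : ColoredOperad M PUnit.{v + 1}) :
    ColoredOperad M K where
  ops c t := pcOps P c t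
  perm e _ _ h t := pcPerm P e h t
  comp a b t := pcComp P a b t
  one c := P.arOne ≫ pcι P (fun _ => 𝟙 c)
  perm_refl {n} c t := by
    apply jointEpi_pcι P
    intro f
    have h := P.perm_refl (fun _ : Fin n => PUnit.unit) PUnit.unit
    refine (ι_pcPerm P (Equiv.refl (Fin n)) (fun _ => rfl) f).trans ?_
    refine ((eq_whisker h _).trans (Category.id_comp _)).trans ?_
    refine (pcι_congr P (funext fun i => ?_)).trans (Category.comp_id _).symm
    exact Category.id_comp _
  perm_trans {l m n} e e' c c' c'' h h' t := by
    apply jointEpi_pcι P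
    intro f
    dsimp only
    have hp := P.perm_trans e e' (c := fun _ => PUnit.unit) (c' := fun _ => PUnit.unit)
      (c'' := fun _ => PUnit.unit) (fun _ => rfl) (fun _ => rfl) PUnit.unit
    rw [← Category.assoc, ι_pcPerm, Category.assoc, ι_pcPerm, ι_pcPerm, ← Category.assoc, hp]
    exact congrArg _ (pcι_congr P (funext fun i => by simp [homPerm]))
  comp_perm_block {m n} e k a b t := by
    apply jointEpi_pcComp P
    rintro ⟨f, g⟩
    dsimp only
    have hp := P.comp_perm_block e (k := k) (fun _ => PUnit.unit) (fun _ _ => PUnit.unit)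
      PUnit.unit
    have hn := tensPerm_natural e (fun i => pcι P (g i))
    rw [tensorHom_comp_tensorHom_assoc, ι_pcPerm, hn, ← tensorHom_comp_tensorHom_assoc, ι_pcComp,
      ← Category.assoc, hp, ← Category.assoc, ι_pcComp, Category.assoc, Category.assoc, ι_pcPerm]
    refine whisker_eq _ (whisker_eq _ (pcι_congr P (funext fun x => ?_)))
    have hx := homPerm_comp_eq (fun p : Σ i, Fin (k i) => g p.1 p.2 ≫ f p.1)
      (unpos_blockEquiv e k x).symm (congrArg (fun p : Σ i, Fin (k i) => b p.1 p.2)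
        (unpos_blockEquiv e k x).symm)
    refine Eq.trans ?_ hx.symm
    exact congrArg (fun z => g (e (unpos x).1) (unpos x).2 ≫ z) (Category.id_comp _)
  comp_perm_sum {n k k'} e a b t := by
    apply jointEpi_pcComp P
    rintro ⟨f, g⟩
    dsimp only
    have hp := P.comp_perm_sum e (fun _ => PUnit.unit) (fun _ _ => PUnit.unit)
      PUnit.unit
    have hs : ∀ i, pcι P (g i) ≫ pcPerm P (e i) (fun _ => rfl) (a i) = P.arPerm (e i) ≫
        pcι P (homPerm (e i) (fun _ => rfl) (g i)) := fun i => ι_pcPerm P _ _ _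
    rw [hom_whisker_assoc, ← tensMap_comp]
    simp only [hs]
    rw [tensMap_comp, ← whisker_hom, Category.assoc, ι_pcComp, ← Category.assoc, hp,
      ← Category.assoc, ι_pcComp, Category.assoc, Category.assoc, ι_pcPerm]
    refine whisker_eq _ (whisker_eq _ (pcι_congr P (funext fun x => ?_)))
    have hx := homPerm_comp_eq (fun p : Σ i, Fin (k i) => g p.1 p.2 ≫ f p.1)
      (unpos_sumEquiv e x).symm (congrArg (fun p : Σ i, Fin (k i) => b p.1 p.2)
        (unpos_sumEquiv e x).symm)
    refine Eq.trans ?_ hx.symm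
    exact congrArg (fun z => z ≫ f (unpos x).1) (Category.id_comp _)
  comp_assoc {n k m} a b c t := by
    apply (jointEpi_pcι P a t).tensor (jointEpi_tens fun i =>
      jointEpi_pcComp P (b i) (c i) (a i))
    rintro ⟨f, gh⟩
    obtain ⟨g, h, rfl⟩ : ∃ (g : ∀ i j, b i j ⟶ a i) (h : ∀ i j l, c i j l ⟶ b i j),
      gh = fun i => (g i, h i) := ⟨fun i => (gh i).1, fun i => (gh i).2, rfl⟩
    dsimp only
    have hp := P.comp_assoc (m := m) (fun _ => PUnit.unit) (fun _ _ => PUnit.unit)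
      (fun _ _ _ => PUnit.unit) PUnit.unit
    have hs : ∀ i, (pcι P (g i) ⊗ₘ tensMap (fun j => pcι P (h i j))) ≫ pcComp P (b i) (c i) (a i) =
      P.arComp (m i) ≫ pcι P (homComp (g i) (h i)) := fun i => ι_pcComp P _ _
    have hz := tensZip_natural (fun i => pcι P (g i)) (fun i => tensMap (fun j => pcι P (h i j)))
    have hf := tensFlat_natural (fun i j => pcι P (h i j))
    rw [hom_whisker_assoc, ← tensMap_comp]
    simp only [hs]
    rw [tensMap_comp, ← whisker_hom, Category.assoc, ι_pcComp, ← Category.assoc, hp]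
    have hzf : tensMap (fun i => pcι P (g i) ⊗ₘ tensMap (fun j => pcι P (h i j))) ≫
        (tensZip (fun i => pcOps P (b i) (a i))
            (fun i => tens fun j => pcOps P (c i j) (b i j)) ≫
          (tens (fun i => pcOps P (b i) (a i)) ◁
            tensFlat fun i j => pcOps P (c i j) (b i j))) =
        (tensZip (fun i => P.ar (k i)) (fun i => tens fun j => P.ar (m i j)) ≫
          (tens (fun i => P.ar (k i)) ◁ tensFlat fun i j => P.ar (m i j))) ≫
        (tensMap (fun i => pcι P (g i)) ⊗ₘ
          tensMap (fun x => pcι P (h (unpos x).1 (unpos x).2))) := by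
      refine ((Category.assoc _ _ _).symm.trans (eq_whisker hz _)).trans ?_
      rw [Category.assoc, hom_whisker, hf, ← whisker_hom, ← Category.assoc]
    refine Eq.trans ?_ (assoc_push (ι_pcComp P f g)
      (ι_pcComp P (t := t) (k := fun z => concat m z) (homComp f g) (fun z => h (unpos z).1 (unpos z).2))
      (ι_pcPerm P (assocEquiv m) (concat_assocEquiv c) _) hzf).symm
    · refine whisker_eq _ (pcι_congr P (funext fun x => ?_))
      have hx := homPerm_comp_eq
        (fun q : Σ p : (Σ i, Fin (k i)), Fin (m p.1 p.2) => h q.1.1 q.1.2 q.2 ≫ g q.1.1 q.1.2 ≫ f q.1.1)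
        (unpos_assocEquiv m x).symm (congrArg
        (fun q : Σ p : (Σ i, Fin (k i)), Fin (m p.1 p.2) => c q.1.1 q.1.2 q.2)
          (unpos_assocEquiv m x).symm)
      exact (Category.assoc _ _ _).trans hx.symm
  one_comp {n} c t := by
    apply ((jointEpi_tens (n := 1) fun _ => jointEpi_pcι P c t)).whiskerLeft
    intro f
    dsimp only
    have hp := P.one_comp (fun _ : Fin n => PUnit.unit) PUnit.unit
    refine (one_push (ι_pcComp P (fun _ : Fin 1 => 𝟙 t) f)
      (ι_pcPerm P (oneSumEquiv n) (concat_oneSumEquiv c) _)).trans ?_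
    refine (eq_whisker hp _).trans ?_
    rw [leftUnitor_naturality_assoc, Category.assoc]
    refine whisker_eq _ ?_
    refine Eq.trans ?_ ((rightUnitor_naturality (pcι P (f 0))).symm.trans
      (eq_whisker (tensorHom_id _ _).symm _))
    refine whisker_eq _ (pcι_congr P (funext fun x => ?_))
    have hx := homPerm_comp_eq (fun p : Σ i : Fin 1, Fin n => f p.1 p.2 ≫ 𝟙 t)
      (unpos_oneSumEquiv x).symm (congrArg (fun p : Σ i : Fin 1, Fin n => c p.2)
        (unpos_oneSumEquiv x).symm)
    exact hx.trans (Category.comp_id _)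
  comp_one {n} c t := by
    apply ((jointEpi_pcι P c t)).whiskerRight
    intro f
    dsimp only
    have hp := P.comp_one (fun _ : Fin n => PUnit.unit) PUnit.unit
    rw [tensMap_comp, ← Category.assoc (tensUnit n)]
    refine (push_one (ι_pcComp P f (fun (i : Fin n) (_ : Fin 1) => 𝟙 (c i)))
      (ι_pcPerm P (sumOneEquiv n) (concat_sumOneEquiv c) _)).trans ?_
    refine (eq_whisker hp _).trans ?_
    rw [rightUnitor_naturality]
    refine whisker_eq _ (pcι_congr P (funext fun x => ?_))
    have hx := homPerm_comp_eq (fun p : Σ i : Fin n, Fin 1 => 𝟙 (c p.1) ≫ f p.1)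
      (unpos_sumOneEquiv x).symm (congrArg (fun p : Σ i : Fin n, Fin 1 => c p.1)
        (unpos_sumOneEquiv x).symm)
    exact hx.trans (Category.id_comp _)

section Diagrams

theorem assoc_push₀ {N : Type*} [Category N] [MonoidalCategory N]
    {A A' B B' D D' E E' F X X' : N} {x : A ⟶ A'} {y : B ⟶ B'} {y' : D ⟶ D'}
    {μ : A ⊗ B ⟶ E} {μ' : A' ⊗ B' ⟶ E'} {ε : E ⟶ E'} (hμ : (x ⊗ₘ y) ≫ μ' = μ ≫ ε)
    {ν : E ⊗ D ⟶ F} {ν' : E' ⊗ D' ⟶ F} (hν : (ε ⊗ₘ y') ≫ ν' = ν)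
    {w : X ⟶ X'} {z : X ⟶ B ⊗ D} {z' : X' ⟶ B' ⊗ D'} (hz : w ≫ z' = z ≫ (y ⊗ₘ y')) :
    (x ⊗ₘ w) ≫ (A' ◁ z') ≫ (α_ A' B' D').inv ≫ (μ' ▷ D') ≫ ν' =
      (A ◁ z) ≫ (α_ A B D).inv ≫ (μ ▷ D) ≫ ν := by
  have h := assoc_push hμ (ν := ν) (ν' := ν') (φ := 𝟙 F) (by rw [hν, Category.comp_id])
    (p := 𝟙 F) (p' := 𝟙 F) (γ := 𝟙 F) rfl hz
  simpa using h

variable {M : Type u} [Category.{v} M] [MonoidalCategory M] [SymmetricCategory M]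
  [MonoidalClosed M] [HasColimits M]

/-- The algebra over `pcOperad K P` given by a functor from `K` to `P`-algebras: on the summand
labeled by `f`, one acts with the morphisms `A.map (f i)` and then with the operations of `P` on
the algebra `A.obj t`. -/
noncomputable def diagramAct {K : Type v} [SmallCategory K] {P : ColoredOperad M PUnit.{v + 1}}
    (A : K ⥤ OpAlgebra P) {n : ℕ} (c : Fin n → K) (t : K) :
    pcOps P c t ⊗ tens (fun i => (A.obj (c i)).pt) ⟶ (A.obj t).pt :=
  descRight fun f : (∀ i, c i ⟶ t) =>
    (P.ar n ◁ tensMap (fun i => (A.map (f i)).app PUnit.unit)) ≫ (A.obj t).actPt n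

theorem ι_diagramAct {K : Type v} [SmallCategory K] {P : ColoredOperad M PUnit.{v + 1}}
    (A : K ⥤ OpAlgebra P) {n : ℕ} {c : Fin n → K} {t : K} (f : ∀ i, c i ⟶ t) :
    (pcι P f ▷ tens (fun i => (A.obj (c i)).pt)) ≫ diagramAct A c t =
      (P.ar n ◁ tensMap (fun i => (A.map (f i)).app PUnit.unit)) ≫ (A.obj t).actPt n :=
  ι_descRight _ _

theorem ι_hom_diagramAct {K : Type v} [SmallCategory K] {P : ColoredOperad M PUnit.{v + 1}}
    (A : K ⥤ OpAlgebra P) {n : ℕ} {c : Fin n → K} {t : K} (f : ∀ i, c i ⟶ t) {X : Fin n → M}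
    (x : ∀ i, X i ⟶ (A.obj (c i)).pt) :
    (pcι P f ⊗ₘ tensMap x) ≫ diagramAct A c t =
      (P.ar n ◁ tensMap (fun i => x i ≫ (A.map (f i)).app PUnit.unit)) ≫
        (A.obj t).actPt n := by
  rw [tensorHom_def', Category.assoc, ι_diagramAct, tensMap_comp,
    MonoidalCategory.whiskerLeft_comp, Category.assoc]

theorem diagramAct_assoc {K : Type v} [SmallCategory K] {P : ColoredOperad M PUnit.{v + 1}}
    (A : K ⥤ OpAlgebra P) {n : ℕ} {k : Fin n → ℕ} (a : Fin n → K) (b : ∀ i, Fin (k i) → K)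
    (t : K) :
    (pcOps P a t ◁ tensMap (fun i => diagramAct A (b i) (a i))) ≫ diagramAct A a t =
      (pcOps P a t ◁ (tensZip (fun i => pcOps P (b i) (a i))
          (fun i => tens (fun j => (A.obj (b i j)).pt)) ≫
        (tens (fun i => pcOps P (b i) (a i)) ◁ tensFlat (fun i j => (A.obj (b i j)).pt)))) ≫
      (α_ _ _ _).inv ≫
      (pcComp P a b t ▷ tens (fun x => (A.obj (concat b x)).pt)) ≫
      diagramAct A (concat b) t := by
  apply (jointEpi_pcι P a t).tensor (jointEpi_tens fun i =>
    (jointEpi_pcι P (b i) (a i)).whiskerRight (tens (fun j => (A.obj (b i j)).pt)))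
  rintro ⟨f, g⟩
  dsimp only
  have hp := (A.obj t).act_assoc (k := k) (fun _ => PUnit.unit) (fun _ _ => PUnit.unit) PUnit.unit
  have hs : ∀ i, (pcι P (g i) ▷ tens (fun j => (A.obj (b i j)).pt)) ≫ diagramAct A (b i) (a i) =
    (P.ar (k i) ◁ tensMap (fun j => (A.map (g i j)).app PUnit.unit)) ≫
      (A.obj (a i)).actPt (k i) := fun i => ι_diagramAct A (g i)
  have hl : ∀ i, ((P.ar (k i) ◁ tensMap (fun j => (A.map (g i j)).app PUnit.unit)) ≫
      (A.obj (a i)).actPt (k i)) ≫ (A.map (f i)).app PUnit.unit =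
      (P.ar (k i) ◁ tensMap (fun j => (A.map (g i j ≫ f i)).app PUnit.unit)) ≫
        (A.obj t).actPt (k i) := by
    intro i
    have ha := (A.map (f i)).app_act (fun _ : Fin (k i) => PUnit.unit) PUnit.unit
    refine (Category.assoc _ _ _).trans ((whisker_eq _ ha).trans ?_)
    rw [← Category.assoc, ← MonoidalCategory.whiskerLeft_comp, ← tensMap_comp]
    simp only [Functor.map_comp, OpAlgebra.comp_app]
  have hz := tensZip_natural (fun i => pcι P (g i))
    (fun i => 𝟙 (tens (fun j => (A.obj (b i j)).pt)))
  rw [tensMap_id] at hz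
  simp only [tensorHom_id] at hz
  have hzf : tensMap (fun i => pcι P (g i) ▷ tens (fun j => (A.obj (b i j)).pt)) ≫
      (tensZip (fun i => pcOps P (b i) (a i)) (fun i => tens fun j => (A.obj (b i j)).pt) ≫
        (tens (fun i => pcOps P (b i) (a i)) ◁ tensFlat fun i j => (A.obj (b i j)).pt)) =
      (tensZip (fun i => P.ar (k i)) (fun i => tens fun j => (A.obj (b i j)).pt) ≫
        (tens (fun i => P.ar (k i)) ◁ tensFlat fun i j => (A.obj (b i j)).pt)) ≫
      (tensMap (fun i => pcι P (g i)) ⊗ₘ 𝟙 (tens (fun x => (A.obj (concat b x)).pt))) := by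
    refine ((Category.assoc _ _ _).symm.trans (eq_whisker hz _)).trans ?_
    rw [Category.assoc, ← whisker_exchange, tensorHom_id, ← Category.assoc]
  have hν : (pcι P (homComp f g) ⊗ₘ 𝟙 (tens (fun x => (A.obj (concat b x)).pt))) ≫
      diagramAct A (concat b) t =
      (P.ar _ ◁ tensMap (fun x => (A.map (homComp f g x)).app PUnit.unit)) ≫
        (A.obj t).actPt _ := by
    rw [tensorHom_id]
    exact ι_diagramAct A (homComp f g)
  refine Eq.trans ?_ (assoc_push₀ (ι_pcComp P f g) hν hzf).symm
  have hz₂ := tensZip_natural (fun i => 𝟙 (P.ar (k i)))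
    (fun i => tensMap (fun j => (A.map (g i j ≫ f i)).app PUnit.unit))
  rw [tensMap_id] at hz₂
  simp only [id_tensorHom] at hz₂
  have hf₂ := tensFlat_natural (fun i j => (A.map (g i j ≫ f i)).app PUnit.unit)
  have hzf₂ : tensMap (fun i => P.ar (k i) ◁
        tensMap (fun j => (A.map (g i j ≫ f i)).app PUnit.unit)) ≫
      (tensZip (fun i => P.ar (k i)) (fun i => tens fun _ => (A.obj t).pt) ≫
        (tens (fun i => P.ar (k i)) ◁ tensFlat fun _ _ => (A.obj t).pt)) =
      (tensZip (fun i => P.ar (k i)) (fun i => tens fun j => (A.obj (b i j)).pt) ≫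
        (tens (fun i => P.ar (k i)) ◁ tensFlat fun i j => (A.obj (b i j)).pt)) ≫
      (𝟙 (tens (fun i => P.ar (k i))) ⊗ₘ
        tensMap (fun x => (A.map (homComp f g x)).app PUnit.unit)) := by
    refine ((Category.assoc _ _ _).symm.trans (eq_whisker hz₂ _)).trans ?_
    rw [Category.assoc, ← MonoidalCategory.whiskerLeft_comp, hf₂, Category.assoc,
      MonoidalCategory.whiskerLeft_comp, id_tensorHom]
    rfl
  have hm : (𝟙 (P.ar n) ⊗ₘ 𝟙 (tens (fun i => P.ar (k i)))) ≫ P.arComp k =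
      P.arComp k ≫ 𝟙 _ := by simp
  have hn : (𝟙 (P.ar (∑ i, k i)) ⊗ₘ
        tensMap (fun x => (A.map (homComp f g x)).app PUnit.unit)) ≫ (A.obj t).actPt _ =
      (P.ar _ ◁ tensMap (fun x => (A.map (homComp f g x)).app PUnit.unit)) ≫
        (A.obj t).actPt _ := by
    rw [id_tensorHom]
  refine Eq.trans ?_ (assoc_push₀ hm hn hzf₂)
  rw [hom_whisker_assoc, ← tensMap_comp]
  simp only [hs]
  rw [ι_hom_diagramAct]
  simp only [hl]
  rw [tensMap_comp, MonoidalCategory.whiskerLeft_comp, Category.assoc, id_tensorHom]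
  exact whisker_eq _ hp

theorem diagramAct_perm {K : Type v} [SmallCategory K] {P : ColoredOperad M PUnit.{v + 1}}
    (A : K ⥤ OpAlgebra P) {m n : ℕ} (e : Fin m ≃ Fin n) (c : Fin n → K) (t : K) :
    (pcPerm P e (fun _ => rfl) t ⊗ₘ tensPerm e (fun i => (A.obj (c i)).pt)) ≫
      diagramAct A (fun i => c (e i)) t = diagramAct A c t := by
  apply (jointEpi_pcι P c t).whiskerRight
  intro f
  dsimp only
  have h1 := (A.obj t).act_perm e (fun _ => PUnit.unit) PUnit.unit
  have hn := tensPerm_natural e (fun i => (A.map (f i)).app PUnit.unit)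
  have hd := ι_diagramAct A (homPerm e (c := c) (fun _ => rfl) f)
  have hf : ∀ i, homPerm e (c := c) (fun _ => rfl) f i = f (e i) := fun i => Category.id_comp _
  simp only [hf] at hd
  rw [ι_diagramAct]
  refine Eq.trans ?_ (whisker_eq _ h1)
  rw [← tensorHom_id, tensorHom_comp_tensorHom_assoc, ι_pcPerm,
    Category.id_comp, ← id_tensorHom, tensorHom_comp_tensorHom_assoc, Category.id_comp, hn]
  have hs : ((P.arPerm e ≫ pcι P (homPerm e (c := c) (fun _ => rfl) f)) ⊗ₘ
      tensPerm e (fun i => (A.obj (c i)).pt)) =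
      (P.arPerm e ⊗ₘ tensPerm e (fun i => (A.obj (c i)).pt)) ≫
        (pcι P (homPerm e (c := c) (fun _ => rfl) f) ▷ _) := by
    rw [← tensorHom_id, tensorHom_comp_tensorHom, Category.comp_id]
  rw [hs, Category.assoc]
  refine (whisker_eq _ hd).trans ?_
  rw [hom_whisker_assoc]

theorem diagramAct_map {K : Type v} [SmallCategory K] {P : ColoredOperad M PUnit.{v + 1}}
    {A B : K ⥤ OpAlgebra P} (η : A ⟶ B) {n : ℕ} (c : Fin n → K) (t : K) :
    diagramAct A c t ≫ (η.app t).app PUnit.unit =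
      (pcOps P c t ◁ tensMap (fun i => (η.app (c i)).app PUnit.unit)) ≫ diagramAct B c t := by
  apply (jointEpi_pcι P c t).whiskerRight
  intro f
  dsimp only
  have h := (η.app t).app_act (fun _ : Fin n => PUnit.unit) PUnit.unit
  have hn : ∀ i, (A.map (f i)).app PUnit.unit ≫ (η.app t).app PUnit.unit =
      (η.app (c i)).app PUnit.unit ≫ (B.map (f i)).app PUnit.unit := fun i => by
    rw [← OpAlgebra.comp_app, ← OpAlgebra.comp_app, η.naturality]
  rw [← whisker_exchange_assoc, ι_diagramAct, ← Category.assoc, ι_diagramAct, Category.assoc]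
  refine (whisker_eq _ h).trans ?_
  rw [← MonoidalCategory.whiskerLeft_comp_assoc, ← MonoidalCategory.whiskerLeft_comp_assoc,
    ← tensMap_comp, ← tensMap_comp]
  simp only [hn]

/-- A functor from `K` to `P`-algebras, as an algebra over `pcOperad K P`. -/
noncomputable def diagramAlgebra (K : Type v) [SmallCategory K]
    (P : ColoredOperad M PUnit.{v + 1}) :
    (K ⥤ OpAlgebra P) ⥤ OpAlgebra (pcOperad K P) where
  obj A :=
    { carrier := fun c => (A.obj c).pt
      act := fun c t => diagramAct A c t
      act_assoc := fun a b t => diagramAct_assoc A a b t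
      act_one := fun c => by
        have h1 := (A.obj c).act_one PUnit.unit
        refine Eq.trans ?_ h1
        have h := ι_diagramAct A (fun _ : Fin 1 => 𝟙 c)
        refine (eq_whisker (comp_whiskerRight _ _ _) _).trans ((Category.assoc _ _ _).trans ?_)
        refine whisker_eq _ (h.trans ?_)
        have hi : (fun _ : Fin 1 => OpAlgebra.Hom.app (A.map (𝟙 c)) PUnit.unit) =
            fun _ => 𝟙 (A.obj c).pt := by
          rw [A.map_id, OpAlgebra.id_app]
        rw [hi, tensMap_id, MonoidalCategory.whiskerLeft_id, Category.id_comp]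
      act_perm := fun {m n} e c t => diagramAct_perm A e c t }
  map {A B} η :=
    { app := fun c => (η.app c).app PUnit.unit
      app_act := fun {n} c t => diagramAct_map η c t }

end Diagrams

section Relations

variable {M : Type u} [Category.{v} M] [MonoidalCategory M] [SymmetricCategory M]
  [MonoidalClosed M] [HasColimits M]

variable (M) in
/-- The sequence `R_⊥`: in arity `2` the coproduct of copies of the monoidal unit over the
orthogonal pairs, initial otherwise. -/
noncomputable def perpSeq (C : OrthCat.{v}) : ColoredSeq M C.carrier := fun n =>
  match n with
  | 2 => fun c t => ∐ fun _ : {f : (∀ i, c i ⟶ t) // C.perp (f 0) (f 1)} => 𝟙_ M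
  | _ => fun _ _ => ⊥_ M

/-- The morphism `R_⊥ ⟶ P_C` that sends the orthogonal pair `f` to the operation `r` in the summand
labeled by `f`. -/
noncomputable def perpMap (C : OrthCat.{v}) (P : BipointedOperad M)
    (r : arityTwo M ⟶ (forgetSeq _).obj P.operad) :
    perpSeq M C ⟶ (forgetSeq C.carrier).obj (pcOperad C.carrier P.operad) := fun n =>
  match n with
  | 0 => fun _ _ => initial.to _
  | 1 => fun _ _ => initial.to _
  | 2 => fun c t => Sigma.desc fun f : {f : (∀ i, c i ⟶ t) // C.perp (f 0) (f 1)} =>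
      P.point r ≫ pcι P.operad f.1
  | _ + 3 => fun _ _ => initial.to _

/-- A field theory operad for `C` and `P`: a quotient of `P_C` by the relations that the two
distinguished operations agree on the summands labeled by orthogonal pairs. -/
structure FTOperad (C : OrthCat.{v}) (P : BipointedOperad M) where
  operad : ColoredOperad M C.carrier
  proj : pcOperad C.carrier P.operad ⟶ operad
  isQuotient : IsQuotientBy (perpMap C P P.r₁) (perpMap C P P.r₂) proj

/-- `P_C` as an operad with varying colors. -/
noncomputable def auxObj (C : OrthCat.{v}) (P : BipointedOperad M) : OperadVar.{v} M :=
  ⟨C.carrier, pcOperad C.carrier P.operad⟩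

/-- The components of the morphism `P_C ⟶ Q_D` induced by `F : C ⟶ D` and `φ : P ⟶ Q`:
on the summand labeled by `f` it is `φ`, with values in the summand labeled by `F f`. -/
noncomputable def auxApp {C D : OrthCat.{v}} {P Q : BipointedOperad M} (F : C ⟶ D) (φ : P ⟶ Q)
    {n : ℕ} (c : Fin n → C.carrier) (t : C.carrier) :
    pcOps P.operad c t ⟶ pcOps Q.operad (fun i => F.functor.obj (c i)) (F.functor.obj t) :=
  Sigma.desc fun f => φ.hom.app (fun _ => PUnit.unit) PUnit.unit ≫
    pcι Q.operad (fun i => F.functor.map (f i))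

theorem ι_auxApp {C D : OrthCat.{v}} {P Q : BipointedOperad M} (F : C ⟶ D) (φ : P ⟶ Q)
    {n : ℕ} {c : Fin n → C.carrier} {t : C.carrier} (f : ∀ i, c i ⟶ t) :
    pcι P.operad f ≫ auxApp F φ c t = φ.hom.app (fun _ => PUnit.unit) PUnit.unit ≫
      pcι Q.operad (fun i => F.functor.map (f i)) :=
  Sigma.ι_desc _ _

theorem auxApp_perm {C D : OrthCat.{v}} {P Q : BipointedOperad M} (F : C ⟶ D) (φ : P ⟶ Q)
    {m n : ℕ} (e : Fin m ≃ Fin n) {c : Fin n → C.carrier} {d : Fin m → C.carrier}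
    (h : ∀ i, d i = c (e i)) (t : C.carrier) :
    pcPerm P.operad e h t ≫ auxApp F φ d t =
      auxApp F φ c t ≫ pcPerm Q.operad e (fun i => congrArg F.functor.obj (h i)) _ := by
  apply jointEpi_pcι P.operad c t
  intro f
  dsimp only
  have hp := φ.hom.app_perm e (c := fun _ => PUnit.unit) (d := fun _ => PUnit.unit)
    (fun _ => rfl) PUnit.unit
  rw [← Category.assoc, ι_pcPerm, Category.assoc, ι_auxApp, ← Category.assoc, hp,
    ← Category.assoc (pcι P.operad f), ι_auxApp, Category.assoc, Category.assoc, ι_pcPerm]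
  refine whisker_eq _ (whisker_eq _ (pcι_congr Q.operad (funext fun i => ?_)))
  simp [homPerm, eqToHom_map]

theorem auxApp_comp {C D : OrthCat.{v}} {P Q : BipointedOperad M} (F : C ⟶ D) (φ : P ⟶ Q)
    {n : ℕ} {k : Fin n → ℕ} (a : Fin n → C.carrier) (b : ∀ i, Fin (k i) → C.carrier)
    (t : C.carrier) :
    pcComp P.operad a b t ≫ auxApp F φ (concat b) t =
      (auxApp F φ a t ⊗ₘ tensMap (fun i => auxApp F φ (b i) (a i))) ≫
        pcComp Q.operad (fun i => F.functor.obj (a i)) (fun i j => F.functor.obj (b i j))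
          (F.functor.obj t) := by
  apply jointEpi_pcComp P.operad a b t
  rintro ⟨f, g⟩
  dsimp only
  have hp := φ.hom.app_comp (k := k) (fun _ => PUnit.unit) (fun _ _ => PUnit.unit) PUnit.unit
  have hg : ∀ i, pcι P.operad (g i) ≫ auxApp F φ (b i) (a i) = _ := fun i => ι_auxApp F φ (g i)
  rw [← Category.assoc, ι_pcComp, Category.assoc, ι_auxApp, ← Category.assoc, hp,
    tensorHom_comp_tensorHom_assoc, ← tensMap_comp, ι_auxApp]
  simp only [hg]
  rw [tensMap_comp, ← tensorHom_comp_tensorHom_assoc, ι_pcComp, Category.assoc]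
  refine whisker_eq _ (whisker_eq _ (pcι_congr Q.operad (funext fun i => ?_)))
  exact F.functor.map_comp _ _

theorem auxApp_one {C D : OrthCat.{v}} {P Q : BipointedOperad M} (F : C ⟶ D) (φ : P ⟶ Q)
    (c : C.carrier) :
    (P.operad.arOne ≫ pcι P.operad (fun _ : Fin 1 => 𝟙 c)) ≫ auxApp F φ (fun _ => c) c =
      Q.operad.arOne ≫ pcι Q.operad (fun _ : Fin 1 => 𝟙 (F.functor.obj c)) := by
  have hp := φ.hom.app_one PUnit.unit
  rw [Category.assoc, ι_auxApp, ← Category.assoc, hp]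
  exact whisker_eq _ (pcι_congr Q.operad (funext fun i => F.functor.map_id c))

/-- The morphism `P_C ⟶ Q_D` induced by `F : C ⟶ D` and `φ : P ⟶ Q`. -/
noncomputable def auxMap {C D : OrthCat.{v}} {P Q : BipointedOperad M} (F : C ⟶ D) (φ : P ⟶ Q) :
    auxObj C P ⟶ auxObj D Q :=
  ({ onColors := F.functor.obj
     onOps :=
      { app := fun c t => auxApp F φ c t
        app_perm := fun e _ _ h t => auxApp_perm F φ e h t
        app_comp := fun a b t => auxApp_comp F φ a b t
        app_one := fun c => auxApp_one F φ c } } : OperadVar.Hom (auxObj C P) (auxObj D Q))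

end Relations

section Functoriality

/-- An extension of a map on objects to a functor. -/
structure FunctorOn {A : Type*} {B : Type*} [Category A] [Category B] (obj : A → B) where
  map : {X Y : A} → (X ⟶ Y) → (obj X ⟶ obj Y)
  map_id : ∀ X : A, map (𝟙 X) = 𝟙 (obj X)
  map_comp : ∀ {X Y Z : A} (f : X ⟶ Y) (g : Y ⟶ Z), map (f ≫ g) = map f ≫ map g

/-- The functor. -/
def FunctorOn.toFunctor {A : Type*} {B : Type*} [Category A] [Category B] {obj : A → B}
    (Φ : FunctorOn obj) : A ⥤ B where
  obj := obj
  map := Φ.map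
  map_id := Φ.map_id
  map_comp := Φ.map_comp

end Functoriality

end FieldTheory

/-! Everything rests on presentations by generators and relations in `M` (`Presents`). Since the tensor
product of a closed symmetric monoidal category preserves colimits in both variables, a tensor
product of objects with *reflexive* presentations is presented by the products of generators and
the products of relations (`Presents.exists_desc_tensor`, `Presents.tens`). Hence, if a set of shapes
of relations contains the trivial ones and is closed under the operations of some kind of
algebraic structure, these operations descend from the generators to the presented objects, and
the axioms can be tested on generators because iterated tensor products of the projections are
jointly epimorphic. This is used twice.

* The quotient of an operad by relations `r₁ = r₂` is constructed from the closure `QRel` of the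
  relations under permutations and compositions (`quotOperad`, `isQuotientBy_quotProj`). So the
  field theory operads exist, and the components of an arbitrary choice of them are presented in the
  same way (`IsQuotientBy.presents`).
* The left adjoint of the pullback of algebras along a morphism of operads is constructed from formal
  operations (`LTerm`) modulo the axioms of an algebra (`LRel`), see `isRightAdjoint_algPullback`.

The functor `Φ` and its uniqueness come from the universal property of the quotients: an orthogonal
functor maps the relations for `C` to relations for `D` (`perpMap_auxMap_proj`).

For the comparison of algebras and field theories, both are embedded into algebras over `P_C`.
Pullback along the projection `π` is fully faithful, and its essential image consists of the
algebras on which both sides of the relations act in the same way (`IsQuotientBy.exists_algebra`).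
The functor `diagramAlgebra` from diagrams of `P`-algebras to algebras over `P_C` is an equivalence:
the morphisms of `C` act as unary operations of `P_C`, the summands labeled by identities form the
operad `P`, and every summand is the composite of one of these with unary operations
(`ι_act_eq_pre`, `diagramAlgebraIso`). Under it the relations become the defining property of field
theories (`isFieldTheory_iff`). So both embeddings have the same essential image, which gives the
equivalences `K`. The two pullback functors correspond to each other because they do so after the
fully faithful embedding into algebras over `P_C` (`nonempty_algPullback_iso`), and the
left adjoint on field theories is transported along `K`. -/

namespace FieldTheory

/-! ### Presentations by generators and relations -/

section Presentations

variable {M : Type u} [Category.{v} M]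

/-- The morphisms `ι τ : G τ ⟶ B` present `B` by the generators `G τ` and the relations
`l s`, `r s`: `B` is universal among the objects with a morphism from every `G τ` such that `l s`
followed by the morphism from `G (a s)` agrees with `r s` followed by the morphism from `G (b s)`.
Equivalently, `B` is the coequalizer of the two induced morphisms `∐ X ⟶ ∐ G`. -/
structure Presents {T S : Type*} {G : T → M} {X : S → M} {a b : S → T}
    (l : ∀ s, X s ⟶ G (a s)) (r : ∀ s, X s ⟶ G (b s)) {B : M} (ι : ∀ τ, G τ ⟶ B) : Prop where
  condition : ∀ s, l s ≫ ι (a s) = r s ≫ ι (b s)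
  jointEpi : JointEpi ι
  exists_desc : ∀ {Z : M} (f : ∀ τ, G τ ⟶ Z), (∀ s, l s ≫ f (a s) = r s ≫ f (b s)) →
    ∃ g : B ⟶ Z, ∀ τ, ι τ ≫ g = f τ

/-- Every generator has a relation with a common section of both of its sides. The sections are
compared in a sigma type because `a s` and `b s` need only be propositionally equal to `τ`. -/
def ReflexiveRel {T S : Type*} {G : T → M} {X : S → M} {a b : S → T}
    (l : ∀ s, X s ⟶ G (a s)) (r : ∀ s, X s ⟶ G (b s)) : Prop :=
  ∀ τ, ∃ (s : S) (σ : G τ ⟶ X s),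
    (⟨a s, σ ≫ l s⟩ : Σ τ', (G τ ⟶ G τ')) = ⟨τ, 𝟙 _⟩ ∧
    (⟨b s, σ ≫ r s⟩ : Σ τ', (G τ ⟶ G τ')) = ⟨τ, 𝟙 _⟩

theorem exists_presents [HasColimits M] {T S : Type v} {G : T → M} {X : S → M} {a b : S → T}
    (l : ∀ s, X s ⟶ G (a s)) (r : ∀ s, X s ⟶ G (b s)) :
    ∃ (B : M) (ι : ∀ τ, G τ ⟶ B), Presents l r ι := by
  let p : ∐ X ⟶ ∐ G := Sigma.desc fun s => l s ≫ Sigma.ι G (a s)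
  let q : ∐ X ⟶ ∐ G := Sigma.desc fun s => r s ≫ Sigma.ι G (b s)
  refine ⟨coequalizer p q, fun τ => Sigma.ι G τ ≫ coequalizer.π p q, ?_, ?_, ?_⟩
  · intro s
    have h := Sigma.ι X s ≫= coequalizer.condition p q
    simpa [p, q] using h
  · intro Z f g h
    apply coequalizer.hom_ext
    apply Sigma.hom_ext
    intro τ
    simpa using h τ
  · intro Z f h
    refine ⟨coequalizer.desc (Sigma.desc f) ?_, fun τ => by
      rw [Category.assoc, coequalizer.π_desc, Sigma.ι_desc]⟩
    apply Sigma.hom_ext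
    intro s
    simpa [p, q] using h s

/-- The object presented by generators and relations. -/
noncomputable def presented [HasColimits M] {T S : Type v} {G : T → M} {X : S → M} {a b : S → T}
    (l : ∀ s, X s ⟶ G (a s)) (r : ∀ s, X s ⟶ G (b s)) : M :=
  (exists_presents l r).choose

/-- The inclusion of a generator into the object presented by generators and relations. -/
noncomputable def presentedι [HasColimits M] {T S : Type v} {G : T → M} {X : S → M} {a b : S → T}
    (l : ∀ s, X s ⟶ G (a s)) (r : ∀ s, X s ⟶ G (b s)) (τ : T) : G τ ⟶ presented l r :=
  (exists_presents l r).choose_spec.choose τ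

theorem presents_presentedι [HasColimits M] {T S : Type v} {G : T → M} {X : S → M} {a b : S → T}
    (l : ∀ s, X s ⟶ G (a s)) (r : ∀ s, X s ⟶ G (b s)) : Presents l r (presentedι l r) :=
  (exists_presents l r).choose_spec.choose_spec

section Desc

variable {T S : Type*} {G : T → M} {X : S → M} {a b : S → T}
  {l : ∀ s, X s ⟶ G (a s)} {r : ∀ s, X s ⟶ G (b s)} {B : M} {ι : ∀ τ, G τ ⟶ B}

theorem Presents.of_iso (H : Presents l r ι) {B' : M} (e : B ≅ B') {ι' : ∀ τ, G τ ⟶ B'}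
    (h : ∀ τ, ι τ ≫ e.hom = ι' τ) : Presents l r ι' := by
  obtain rfl : (fun τ => ι τ ≫ e.hom) = ι' := funext h
  refine ⟨fun s => by simp only [← Category.assoc, H.condition], fun Z f g hfg => ?_,
    fun f hf => ?_⟩
  · rw [← cancel_epi e.hom]
    exact H.jointEpi fun τ => by simpa using hfg τ
  · obtain ⟨g, hg⟩ := H.exists_desc f hf
    exact ⟨e.inv ≫ g, fun τ => by simpa using hg τ⟩

end Desc

section Tensor

variable [MonoidalCategory M]

/-- Every product of generators has the product of the chosen relations as a relation with a common
section. -/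
theorem ReflexiveRel.tens {n : ℕ} {T S : Fin n → Type*} {G : ∀ i, T i → M} {X : ∀ i, S i → M}
    {a b : ∀ i, S i → T i} {l : ∀ i s, X i s ⟶ G i (a i s)} {r : ∀ i s, X i s ⟶ G i (b i s)}
    (hr : ∀ i, ReflexiveRel (l i) (r i)) :
    ReflexiveRel (T := ∀ i, T i) (S := ∀ i, S i) (G := fun τ => FieldTheory.tens fun i => G i (τ i))
      (X := fun s => FieldTheory.tens fun i => X i (s i)) (a := fun s i => a i (s i))
      (b := fun s i => b i (s i)) (fun s => tensMap fun i => l i (s i))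
      (fun s => tensMap fun i => r i (s i)) := by
  intro τ
  choose s σ ha hb using fun i => hr i (τ i)
  have key : ∀ {p q : ∀ i, Σ τ', (G i (τ i) ⟶ G i τ')}, p = q →
      (⟨fun i => (p i).1, tensMap fun i => (p i).2⟩ : Σ τ' : (∀ i, T i),
        (FieldTheory.tens (fun i => G i (τ i)) ⟶ FieldTheory.tens (fun i => G i (τ' i)))) =
      ⟨fun i => (q i).1, tensMap fun i => (q i).2⟩ := by
    rintro p q rfl
    rfl
  refine ⟨s, tensMap σ, ?_, ?_⟩
  · rw [← tensMap_comp, ← tensMap_id]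
    exact key (funext ha)
  · rw [← tensMap_comp, ← tensMap_id]
    exact key (funext hb)

variable [SymmetricCategory M] [MonoidalClosed M]

/-- In a closed symmetric monoidal category `B ⊗ B'` is presented by the products of generators and
the products of relations. Reflexivity makes the products of relations with generators
available. -/
theorem Presents.exists_desc_tensor
    {T S : Type*} {G : T → M} {X : S → M} {a b : S → T}
    {l : ∀ s, X s ⟶ G (a s)} {r : ∀ s, X s ⟶ G (b s)} {B : M} {ι : ∀ τ, G τ ⟶ B}
    {T' S' : Type*} {G' : T' → M} {X' : S' → M} {a' b' : S' → T'}
    {l' : ∀ s, X' s ⟶ G' (a' s)} {r' : ∀ s, X' s ⟶ G' (b' s)} {B' : M} {ι' : ∀ τ, G' τ ⟶ B'}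
    (H : Presents l r ι) (hr : ReflexiveRel l r) (H' : Presents l' r' ι')
    (hr' : ReflexiveRel l' r') {Z : M} (f : ∀ τ τ', G τ ⊗ G' τ' ⟶ Z)
    (hf : ∀ s s', (l s ⊗ₘ l' s') ≫ f (a s) (a' s') = (r s ⊗ₘ r' s') ≫ f (b s) (b' s')) :
    ∃ g : B ⊗ B' ⟶ Z, ∀ τ τ', (ι τ ⊗ₘ ι' τ') ≫ g = f τ τ' := by
  -- a relation times a generator: insert the trivial relation of the generator
  have h₁ : ∀ τ s', (G τ ◁ l' s') ≫ f τ (a' s') = (G τ ◁ r' s') ≫ f τ (b' s') := by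
    intro τ s'
    obtain ⟨s, σ, ha, hb⟩ := hr τ
    have e₁ := congrArg (fun p : Σ τ', (G τ ⟶ G τ') => (p.2 ⊗ₘ l' s') ≫ f p.1 (a' s')) ha
    have e₂ := congrArg (fun p : Σ τ', (G τ ⟶ G τ') => (p.2 ⊗ₘ r' s') ≫ f p.1 (b' s')) hb
    have := (σ ▷ X' s') ≫= hf s s'
    simp only [← tensorHom_id, tensorHom_comp_tensorHom_assoc, Category.id_comp] at this
    simp only [id_tensorHom] at e₁ e₂
    exact e₁.symm.trans (this.trans e₂)
  have h₂ : ∀ s τ', (l s ▷ G' τ') ≫ f (a s) τ' = (r s ▷ G' τ') ≫ f (b s) τ' := by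
    intro s τ'
    obtain ⟨s', σ, ha, hb⟩ := hr' τ'
    have e₁ := congrArg (fun p : Σ t, (G' τ' ⟶ G' t) => (l s ⊗ₘ p.2) ≫ f (a s) p.1) ha
    have e₂ := congrArg (fun p : Σ t, (G' τ' ⟶ G' t) => (r s ⊗ₘ p.2) ≫ f (b s) p.1) hb
    have := (X s ◁ σ) ≫= hf s s'
    simp only [← id_tensorHom, tensorHom_comp_tensorHom_assoc, Category.id_comp] at this
    simp only [tensorHom_id] at e₁ e₂
    exact e₁.symm.trans (this.trans e₂)
  -- descend in the second factor for every generator of the first one, then in the first factor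
  have h₃ : ∀ τ, ∃ g : G τ ⊗ B' ⟶ Z, ∀ τ', (G τ ◁ ι' τ') ≫ g = f τ τ' := by
    intro τ
    obtain ⟨g, hg⟩ := H'.exists_desc (fun τ' => MonoidalClosed.curry (f τ τ')) (by
      intro s'
      rw [← MonoidalClosed.curry_natural_left, ← MonoidalClosed.curry_natural_left, h₁])
    refine ⟨MonoidalClosed.uncurry g, fun τ' => ?_⟩
    rw [← MonoidalClosed.uncurry_natural_left, hg, MonoidalClosed.uncurry_curry]
  choose k hk using h₃
  obtain ⟨g, hg⟩ := H.exists_desc (fun τ => MonoidalClosed.curry ((β_ _ _).hom ≫ k τ)) (by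
    intro s
    rw [← MonoidalClosed.curry_natural_left, ← MonoidalClosed.curry_natural_left]
    congr 1
    rw [BraidedCategory.braiding_naturality_right_assoc,
      BraidedCategory.braiding_naturality_right_assoc]
    congr 1
    apply H'.jointEpi.whiskerLeft
    intro τ'
    dsimp only
    rw [whisker_exchange_assoc, whisker_exchange_assoc, hk, hk, h₂])
  refine ⟨(β_ _ _).hom ≫ MonoidalClosed.uncurry g, fun τ τ' => ?_⟩
  rw [tensorHom_def', Category.assoc, BraidedCategory.braiding_naturality_left_assoc,
    ← MonoidalClosed.uncurry_natural_left, hg, MonoidalClosed.uncurry_curry]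
  simpa using hk τ τ'

theorem Presents.exists_desc_tens : ∀ {n : ℕ} {T S : Fin n → Type*} {G : ∀ i, T i → M}
    {X : ∀ i, S i → M} {a b : ∀ i, S i → T i} {l : ∀ i s, X i s ⟶ G i (a i s)}
    {r : ∀ i s, X i s ⟶ G i (b i s)} {B : Fin n → M} {ι : ∀ i τ, G i τ ⟶ B i}
    (_ : ∀ i, Presents (l i) (r i) (ι i)) (_ : ∀ i, ReflexiveRel (l i) (r i)) {Z : M}
    (f : ∀ τ : (∀ i, T i), FieldTheory.tens (fun i => G i (τ i)) ⟶ Z)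
    (_ : ∀ s : (∀ i, S i), tensMap (fun i => l i (s i)) ≫ f (fun i => a i (s i)) =
      tensMap (fun i => r i (s i)) ≫ f (fun i => b i (s i))),
    ∃ g : FieldTheory.tens B ⟶ Z, ∀ τ : (∀ i, T i), tensMap (fun i => ι i (τ i)) ≫ g = f τ
  | 0, T, S, G, X, a, b, l, r, B, ι, H, hr, Z, f, hf => by
    refine ⟨f (fun i => i.elim0), fun τ => ?_⟩
    obtain rfl : τ = fun i => i.elim0 := funext fun i => i.elim0
    exact Category.id_comp _
  | n + 1, T, S, G, X, a, b, l, r, B, ι, H, hr, Z, f, hf => by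
    have H' : Presents (T := ∀ i : Fin n, T i.succ) (S := ∀ i : Fin n, S i.succ)
        (G := fun τ => FieldTheory.tens fun i => G i.succ (τ i))
        (X := fun s => FieldTheory.tens fun i => X i.succ (s i)) (a := fun s i => a i.succ (s i))
        (b := fun s i => b i.succ (s i)) (fun s => tensMap fun i => l i.succ (s i))
        (fun s => tensMap fun i => r i.succ (s i)) (fun τ => tensMap fun i => ι i.succ (τ i)) :=
      { condition := fun s => by
          rw [← tensMap_comp, ← tensMap_comp]
          simp only [(H _).condition]
        jointEpi := jointEpi_tens fun i => (H i.succ).jointEpi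
        exists_desc := fun f hf =>
          Presents.exists_desc_tens (fun i => H i.succ) (fun i => hr i.succ) f hf }
    obtain ⟨g, hg⟩ := (H 0).exists_desc_tensor (hr 0) H' (ReflexiveRel.tens fun i => hr i.succ)
      (fun τ τ' => f (Fin.cons τ τ')) (fun s s' => by
        have e : ∀ (c : ∀ i, S i → T i), (fun i => c i ((Fin.cons s s' : ∀ i, S i) i)) =
            Fin.cons (c 0 s) (fun i => c i.succ (s' i)) := by
          intro c
          funext i
          cases i using Fin.cases <;> rfl
        have key : ∀ (c : ∀ i, S i → T i) (m : ∀ i s, X i s ⟶ G i (c i s)),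
            tensMap (fun i => m i ((Fin.cons s s' : ∀ i, S i) i)) ≫
              f (fun i => c i ((Fin.cons s s' : ∀ i, S i) i)) =
            (m 0 s ⊗ₘ tensMap (fun i => m i.succ (s' i))) ≫
              f (Fin.cons (c 0 s) (fun i => c i.succ (s' i))) := by
          intro c m
          have : ∀ (τ : ∀ i, T i) (h : (fun i => c i ((Fin.cons s s' : ∀ i, S i) i)) = τ),
              tensMap (fun i => m i ((Fin.cons s s' : ∀ i, S i) i)) ≫
                f (fun i => c i ((Fin.cons s s' : ∀ i, S i) i)) =
              tensMap (fun i => m i ((Fin.cons s s' : ∀ i, S i) i) ≫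
                eqToHom (congrArg (G i) (congrFun h i))) ≫ f τ := by
            rintro τ rfl
            simp
          rw [this _ (e c)]
          refine eq_whisker ?_ _
          rw [tensMap_succ]
          have h0 : m 0 s ≫ 𝟙 _ = m 0 s := Category.comp_id _
          refine congrArg₂ _ h0 (congrArg tensMap (funext fun i => ?_))
          exact Category.comp_id _
        exact (key a l).symm.trans ((hf (Fin.cons s s')).trans (key b r)))
    refine ⟨g, fun τ => ?_⟩
    obtain ⟨τ₀, τ', rfl⟩ : ∃ τ₀ τ', τ = Fin.cons τ₀ τ' :=
      ⟨τ 0, Fin.tail τ, (Fin.cons_self_tail τ).symm⟩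
    exact hg τ₀ τ'

/-- An iterated tensor product of reflexively presented objects is presented by the products of
generators and the products of relations. -/
theorem Presents.tens {n : ℕ} {T S : Fin n → Type*} {G : ∀ i, T i → M}
    {X : ∀ i, S i → M} {a b : ∀ i, S i → T i} {l : ∀ i s, X i s ⟶ G i (a i s)}
    {r : ∀ i s, X i s ⟶ G i (b i s)} {B : Fin n → M} {ι : ∀ i τ, G i τ ⟶ B i}
    (H : ∀ i, Presents (l i) (r i) (ι i)) (hr : ∀ i, ReflexiveRel (l i) (r i)) :
    Presents (T := ∀ i, T i) (S := ∀ i, S i) (G := fun τ => FieldTheory.tens fun i => G i (τ i))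
      (X := fun s => FieldTheory.tens fun i => X i (s i)) (a := fun s i => a i (s i))
      (b := fun s i => b i (s i)) (fun s => tensMap fun i => l i (s i))
      (fun s => tensMap fun i => r i (s i)) (fun τ => tensMap fun i => ι i (τ i)) where
  condition s := by
    rw [← tensMap_comp, ← tensMap_comp]
    simp only [(H _).condition]
  jointEpi := jointEpi_tens fun i => (H i).jointEpi
  exists_desc f hf := Presents.exists_desc_tens H hr f hf

end Tensor

end Presentations

/-! ### Quotients of operads -/

section QuotientOperad

/-- The shapes of the relations in the quotient of an operad by the relations between the images of
two morphisms from a sequence: the closure of the given relations and of the trivial ones under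
permutations and operadic compositions. The trivial relations make it possible to close under
compositions in all variables at once. -/
inductive QRel (C : Type w) : {n : ℕ} → (Fin n → C) → C → Type w
  | refl {n : ℕ} (c : Fin n → C) (t : C) : QRel C c t
  | base {n : ℕ} (c : Fin n → C) (t : C) : QRel C c t
  | perm {m n : ℕ} (e : Fin m ≃ Fin n) {c : Fin n → C} {d : Fin m → C}
      (h : ∀ i, d i = c (e i)) (t : C) (ρ : QRel C c t) : QRel C d t
  | comp {n : ℕ} {k : Fin n → ℕ} (a : Fin n → C) (b : ∀ i, Fin (k i) → C) (t : C)
      (ρ : QRel C a t) (ρ' : ∀ i, QRel C (b i) (a i)) : QRel C (concat b) t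

variable {M : Type u} [Category.{v} M] [MonoidalCategory M] [SymmetricCategory M]

/-- The object that parametrizes the relations of a given shape. -/
@[reducible]
def QRel.ob {C : Type w} (O : ColoredOperad M C) (R : ColoredSeq M C) :
    {n : ℕ} → {c : Fin n → C} → {t : C} → QRel C c t → M
  | _, _, _, .refl c t => O.ops c t
  | _, _, _, .base c t => R _ c t
  | _, _, _, .perm _ _ _ ρ => ρ.ob O R
  | _, _, _, .comp _ _ _ ρ ρ' => ρ.ob O R ⊗ tens (fun i => (ρ' i).ob O R)

/-- One side of the relations of a given shape. -/
def QRel.side {C : Type w} {O : ColoredOperad M C} {R : ColoredSeq M C}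
    (r : R ⟶ (forgetSeq C).obj O) :
    {n : ℕ} → {c : Fin n → C} → {t : C} → (ρ : QRel C c t) → (ρ.ob O R ⟶ O.ops c t)
  | _, _, _, .refl _ _ => 𝟙 _
  | _, _, _, .base c t => r _ c t
  | _, _, _, .perm e h t ρ => ρ.side r ≫ O.perm e h t
  | _, _, _, .comp a b t ρ ρ' => (ρ.side r ⊗ₘ tensMap (fun i => (ρ' i).side r)) ≫ O.comp a b t

theorem QRel.reflexiveRel {C : Type w} {O : ColoredOperad M C} {R : ColoredSeq M C}
    (r₁ r₂ : R ⟶ (forgetSeq C).obj O) {n : ℕ} (c : Fin n → C) (t : C) :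
    ReflexiveRel (T := PUnit.{w + 1}) (G := fun _ => O.ops c t) (a := fun _ => PUnit.unit)
      (b := fun _ => PUnit.unit) (fun ρ : QRel C c t => ρ.side r₁) (fun ρ => ρ.side r₂) :=
  fun _ => ⟨.refl c t, 𝟙 (O.ops c t),
    congrArg (Sigma.mk PUnit.unit) (Category.id_comp (𝟙 (O.ops c t))),
    congrArg (Sigma.mk PUnit.unit) (Category.id_comp (𝟙 (O.ops c t)))⟩

/-- An operad morphism that identifies `r₁` and `r₂` identifies both sides of all relations that
they generate. -/
theorem QRel.side_comp_eq {C : Type w} {O P : ColoredOperad M C} {R : ColoredSeq M C}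
    {r₁ r₂ : R ⟶ (forgetSeq C).obj O} (φ : O ⟶ P)
    (h : r₁ ≫ (forgetSeq C).map φ = r₂ ≫ (forgetSeq C).map φ) {n : ℕ} {c : Fin n → C} {t : C}
    (ρ : QRel C c t) : ρ.side r₁ ≫ φ.app c t = ρ.side r₂ ≫ φ.app c t := by
  induction ρ with
  | refl => rfl
  | base c t => exact congrFun (congrFun (congrFun h _) c) t
  | perm e h t ρ ih =>
    have key : ∀ {A : M} (x y : A ⟶ _), x ≫ φ.app _ t = y ≫ φ.app _ t →
        (x ≫ O.perm e h t) ≫ φ.app _ t = (y ≫ O.perm e h t) ≫ φ.app _ t := by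
      intro A x y hxy
      rw [Category.assoc, Category.assoc, φ.app_perm, ← Category.assoc, hxy, Category.assoc]
    exact key _ _ ih
  | comp a b t ρ ρ' ih ih' =>
    have key : ∀ {A : M} {B : _ → M} (x y : A ⟶ _) (x' y' : ∀ i, B i ⟶ _),
        x ≫ φ.app a t = y ≫ φ.app a t →
        (∀ i, x' i ≫ φ.app (b i) (a i) = y' i ≫ φ.app (b i) (a i)) →
        ((x ⊗ₘ tensMap x') ≫ O.comp a b t) ≫ φ.app _ t =
          ((y ⊗ₘ tensMap y') ≫ O.comp a b t) ≫ φ.app _ t := by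
      intro A B x y x' y' hxy hxy'
      simp only [Category.assoc, φ.app_comp, tensorHom_comp_tensorHom_assoc, ← tensMap_comp, hxy,
        hxy']
    exact key _ _ _ _ ih ih'

variable [HasColimits M] {C : Type v} {O : ColoredOperad M C}
  {R : ColoredSeq M C}

variable (r₁ r₂ : R ⟶ (forgetSeq C).obj O)

/-- The operations of the quotient operad. -/
noncomputable def quotOps {n : ℕ} (c : Fin n → C) (t : C) : M :=
  presented (T := PUnit.{v + 1}) (G := fun _ => O.ops c t) (a := fun _ => PUnit.unit)
    (b := fun _ => PUnit.unit) (fun ρ : QRel C c t => ρ.side r₁) (fun ρ => ρ.side r₂)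

/-- The projection to the operations of the quotient operad. -/
noncomputable def quotπ {n : ℕ} (c : Fin n → C) (t : C) : O.ops c t ⟶ quotOps r₁ r₂ c t :=
  presentedι (T := PUnit.{v + 1}) (G := fun _ => O.ops c t) (a := fun _ => PUnit.unit)
    (b := fun _ => PUnit.unit) (fun ρ : QRel C c t => ρ.side r₁) (fun ρ => ρ.side r₂) PUnit.unit

theorem presents_quotπ {n : ℕ} (c : Fin n → C) (t : C) :
    Presents (T := PUnit.{v + 1}) (G := fun _ => O.ops c t) (a := fun _ => PUnit.unit)
      (b := fun _ => PUnit.unit) (fun ρ : QRel C c t => ρ.side r₁) (fun ρ => ρ.side r₂)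
      (fun _ => quotπ r₁ r₂ c t) :=
  presents_presentedι _ _

theorem side_quotπ {n : ℕ} {c : Fin n → C} {t : C} (ρ : QRel C c t) :
    ρ.side r₁ ≫ quotπ r₁ r₂ c t = ρ.side r₂ ≫ quotπ r₁ r₂ c t :=
  (presents_quotπ r₁ r₂ c t).condition ρ

theorem jointEpi_quotπ {n : ℕ} (c : Fin n → C) (t : C) :
    JointEpi (fun _ : PUnit.{v + 1} => quotπ r₁ r₂ c t) :=
  (presents_quotπ r₁ r₂ c t).jointEpi

theorem exists_quotPerm {m n : ℕ} (e : Fin m ≃ Fin n) {c : Fin n → C} {d : Fin m → C}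
    (h : ∀ i, d i = c (e i)) (t : C) : ∃ p : quotOps r₁ r₂ c t ⟶ quotOps r₁ r₂ d t,
      quotπ r₁ r₂ c t ≫ p = O.perm e h t ≫ quotπ r₁ r₂ d t := by
  obtain ⟨g, hg⟩ := (presents_quotπ r₁ r₂ c t).exists_desc
    (fun _ => O.perm e h t ≫ quotπ r₁ r₂ d t) (fun ρ => by
      have := side_quotπ r₁ r₂ (.perm e h t ρ)
      exact (Category.assoc _ _ _).symm.trans (this.trans (Category.assoc _ _ _)))
  exact ⟨g, hg PUnit.unit⟩

/-- The permutation action of the quotient operad. -/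
noncomputable def quotPerm {m n : ℕ} (e : Fin m ≃ Fin n) {c : Fin n → C} {d : Fin m → C}
    (h : ∀ i, d i = c (e i)) (t : C) : quotOps r₁ r₂ c t ⟶ quotOps r₁ r₂ d t :=
  (exists_quotPerm r₁ r₂ e h t).choose

theorem π_quotPerm {m n : ℕ} (e : Fin m ≃ Fin n) {c : Fin n → C} {d : Fin m → C}
    (h : ∀ i, d i = c (e i)) (t : C) :
    quotπ r₁ r₂ c t ≫ quotPerm r₁ r₂ e h t = O.perm e h t ≫ quotπ r₁ r₂ d t :=
  (exists_quotPerm r₁ r₂ e h t).choose_spec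

variable [MonoidalClosed M]

theorem exists_quotComp {n : ℕ} {k : Fin n → ℕ} (a : Fin n → C) (b : ∀ i, Fin (k i) → C) (t : C) :
    ∃ p : quotOps r₁ r₂ a t ⊗ tens (fun i => quotOps r₁ r₂ (b i) (a i)) ⟶
        quotOps r₁ r₂ (concat b) t,
      (quotπ r₁ r₂ a t ⊗ₘ tensMap (fun i => quotπ r₁ r₂ (b i) (a i))) ≫ p =
        O.comp a b t ≫ quotπ r₁ r₂ (concat b) t := by
  obtain ⟨g, hg⟩ := (presents_quotπ r₁ r₂ a t).exists_desc_tensor (QRel.reflexiveRel r₁ r₂ a t)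
    (Presents.tens (T := fun _ => PUnit) (S := fun i => QRel C (b i) (a i))
      (G := fun i _ => O.ops (b i) (a i)) (X := fun _ ρ => ρ.ob O R) (a := fun _ _ => PUnit.unit)
      (b := fun _ _ => PUnit.unit) (ι := fun i _ => quotπ r₁ r₂ (b i) (a i))
      (fun i => presents_quotπ r₁ r₂ (b i) (a i))
      fun i => QRel.reflexiveRel r₁ r₂ (b i) (a i))
    (ReflexiveRel.tens (T := fun _ => PUnit) (S := fun i => QRel C (b i) (a i))
      (G := fun i _ => O.ops (b i) (a i)) (X := fun _ ρ => ρ.ob O R) (a := fun _ _ => PUnit.unit)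
      (b := fun _ _ => PUnit.unit) fun i => QRel.reflexiveRel r₁ r₂ (b i) (a i))
    (fun _ _ => O.comp a b t ≫ quotπ r₁ r₂ (concat b) t) (fun ρ ρ' => by
      have := side_quotπ r₁ r₂ (.comp a b t ρ ρ')
      exact (Category.assoc _ _ _).symm.trans (this.trans (Category.assoc _ _ _)))
  exact ⟨g, hg PUnit.unit fun _ => PUnit.unit⟩

/-- The composition of the quotient operad. -/
noncomputable def quotComp {n : ℕ} {k : Fin n → ℕ} (a : Fin n → C) (b : ∀ i, Fin (k i) → C)
    (t : C) : quotOps r₁ r₂ a t ⊗ tens (fun i => quotOps r₁ r₂ (b i) (a i)) ⟶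
      quotOps r₁ r₂ (concat b) t :=
  (exists_quotComp r₁ r₂ a b t).choose

theorem π_quotComp {n : ℕ} {k : Fin n → ℕ} (a : Fin n → C) (b : ∀ i, Fin (k i) → C) (t : C) :
    (quotπ r₁ r₂ a t ⊗ₘ tensMap (fun i => quotπ r₁ r₂ (b i) (a i))) ≫ quotComp r₁ r₂ a b t =
      O.comp a b t ≫ quotπ r₁ r₂ (concat b) t :=
  (exists_quotComp r₁ r₂ a b t).choose_spec

theorem jointEpi_quotComp {n : ℕ} {k : Fin n → ℕ} (a : Fin n → C) (b : ∀ i, Fin (k i) → C)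
    (t : C) : JointEpi (fun _ : PUnit.{v + 1} × (Fin n → PUnit.{v + 1}) =>
      quotπ r₁ r₂ a t ⊗ₘ tensMap (fun i => quotπ r₁ r₂ (b i) (a i))) :=
  (jointEpi_quotπ r₁ r₂ a t).tensor (jointEpi_tens fun i => jointEpi_quotπ r₁ r₂ (b i) (a i))

/-- The quotient of an operad by the relations between the images of two morphisms from a
sequence. The objects of operations are quotients in `M`, and the axioms follow from those of the
given operad because iterated tensor products of the projections are epimorphisms. -/
noncomputable def quotOperad : ColoredOperad M C where
  ops c t := quotOps r₁ r₂ c t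
  perm e _ _ h t := quotPerm r₁ r₂ e h t
  comp a b t := quotComp r₁ r₂ a b t
  one c := O.one c ≫ quotπ r₁ r₂ _ c
  perm_refl c t := by
    apply jointEpi_quotπ r₁ r₂
    intro _
    dsimp only
    refine (π_quotPerm r₁ r₂ (Equiv.refl _) (fun _ => rfl) t).trans ?_
    refine (eq_whisker (O.perm_refl c t) _).trans ?_
    rw [Category.id_comp, Category.comp_id]
  perm_trans e e' c c' c'' h h' t := by
    apply jointEpi_quotπ r₁ r₂
    intro _
    dsimp only
    rw [← Category.assoc, π_quotPerm, Category.assoc, π_quotPerm, π_quotPerm, ← Category.assoc,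
      O.perm_trans]
  comp_perm_block e k a b t := by
    apply jointEpi_quotComp r₁ r₂
    intro _
    dsimp only
    have hn := tensPerm_natural e (fun i => quotπ r₁ r₂ (b i) (a i))
    rw [tensorHom_comp_tensorHom_assoc, π_quotPerm, hn, ← tensorHom_comp_tensorHom_assoc,
      π_quotComp, ← Category.assoc, O.comp_perm_block, ← Category.assoc, π_quotComp,
      Category.assoc, Category.assoc, π_quotPerm]
  comp_perm_sum e a b t := by
    apply jointEpi_quotComp r₁ r₂
    intro _
    dsimp only
    rw [hom_whisker_assoc, ← tensMap_comp]
    simp only [π_quotPerm]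
    rw [tensMap_comp, ← whisker_hom, Category.assoc, π_quotComp, ← Category.assoc,
      O.comp_perm_sum, ← Category.assoc, π_quotComp, Category.assoc, Category.assoc, π_quotPerm]
  comp_assoc {n k m} a b c t := by
    apply (jointEpi_quotπ r₁ r₂ a t).tensor (jointEpi_tens fun i =>
      jointEpi_quotComp r₁ r₂ (b i) (c i) (a i))
    intro _
    dsimp only
    have hz := tensZip_natural (fun i => quotπ r₁ r₂ (b i) (a i))
      (fun i => tensMap (fun j => quotπ r₁ r₂ (c i j) (b i j)))
    have hf := tensFlat_natural (fun i j => quotπ r₁ r₂ (c i j) (b i j))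
    rw [hom_whisker_assoc, ← tensMap_comp]
    simp only [π_quotComp]
    rw [tensMap_comp, ← whisker_hom, Category.assoc, π_quotComp, ← Category.assoc, O.comp_assoc]
    have hzf : tensMap (fun i => quotπ r₁ r₂ (b i) (a i) ⊗ₘ
          tensMap (fun j => quotπ r₁ r₂ (c i j) (b i j))) ≫
        (tensZip (fun i => quotOps r₁ r₂ (b i) (a i))
            (fun i => tens fun j => quotOps r₁ r₂ (c i j) (b i j)) ≫
          (tens (fun i => quotOps r₁ r₂ (b i) (a i)) ◁
            tensFlat fun i j => quotOps r₁ r₂ (c i j) (b i j))) =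
        (tensZip (fun i => O.ops (b i) (a i)) (fun i => tens fun j => O.ops (c i j) (b i j)) ≫
          (tens (fun i => O.ops (b i) (a i)) ◁ tensFlat fun i j => O.ops (c i j) (b i j))) ≫
        (tensMap (fun i => quotπ r₁ r₂ (b i) (a i)) ⊗ₘ
          tensMap (fun x => quotπ r₁ r₂ (c (unpos x).1 (unpos x).2)
            (b (unpos x).1 (unpos x).2))) := by
      refine ((Category.assoc _ _ _).symm.trans (eq_whisker hz _)).trans ?_
      rw [Category.assoc, hom_whisker, hf, ← whisker_hom, ← Category.assoc]
    exact (assoc_push (π_quotComp r₁ r₂ a b t)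
      (π_quotComp r₁ r₂ (k := fun z => concat m z) (concat b)
        (fun z => c (unpos z).1 (unpos z).2) t)
      (π_quotPerm r₁ r₂ (assocEquiv m) (concat_assocEquiv c) _) hzf).symm
  one_comp {n} c t := by
    apply (jointEpi_tens (n := 1) fun _ => jointEpi_quotπ r₁ r₂ c t).whiskerLeft
    intro _
    dsimp only
    refine (one_push (π_quotComp r₁ r₂ (fun _ : Fin 1 => t) (fun _ => c) t)
      (π_quotPerm r₁ r₂ (oneSumEquiv n) (concat_oneSumEquiv c) _)).trans ?_
    rw [O.one_comp, leftUnitor_naturality_assoc, Category.assoc]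
    exact whisker_eq _ ((rightUnitor_naturality _).symm.trans
      (eq_whisker (tensorHom_id _ _).symm _))
  comp_one {n} c t := by
    apply (jointEpi_quotπ r₁ r₂ c t).whiskerRight
    intro _
    dsimp only
    rw [tensMap_comp, ← Category.assoc (tensUnit n)]
    refine (push_one (π_quotComp r₁ r₂ c (fun i (_ : Fin 1) => c i) t)
      (π_quotPerm r₁ r₂ (sumOneEquiv n) (concat_sumOneEquiv c) _)).trans ?_
    rw [O.comp_one, rightUnitor_naturality]

/-- The projection to the quotient operad. -/
noncomputable def quotProj : O ⟶ quotOperad r₁ r₂ :=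
  ({ app := fun c t => quotπ r₁ r₂ c t
     app_perm := fun e _ _ h t => (π_quotPerm r₁ r₂ e h t).symm
     app_comp := fun a b t => (π_quotComp r₁ r₂ a b t).symm
     app_one := fun _ => rfl } : ColoredOperad.Hom O (quotOperad r₁ r₂))

theorem isQuotientBy_quotProj : IsQuotientBy r₁ r₂ (quotProj r₁ r₂) where
  condition := by
    funext n c t
    exact side_quotπ r₁ r₂ (.base c t)
  existsUnique {X} φ h := by
    have key : ∀ {n : ℕ} (c : Fin n → C) (t : C), ∃ g : quotOps r₁ r₂ c t ⟶ X.ops c t,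
        quotπ r₁ r₂ c t ≫ g = φ.app c t := fun c t => by
      obtain ⟨g, hg⟩ := (presents_quotπ r₁ r₂ c t).exists_desc (fun _ => φ.app c t)
        (fun ρ => QRel.side_comp_eq φ h ρ)
      exact ⟨g, hg PUnit.unit⟩
    choose g hg using @key
    let ψ : ColoredOperad.Hom (quotOperad r₁ r₂) X :=
      { app := fun c t => g c t
        app_perm := fun e c d h t => by
          apply jointEpi_quotπ r₁ r₂
          intro _
          change quotπ r₁ r₂ _ _ ≫ quotPerm r₁ r₂ e h t ≫ _ = _
          rw [← Category.assoc, π_quotPerm, Category.assoc, hg, φ.app_perm, ← hg c t]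
          exact Category.assoc _ _ _
        app_comp := fun a b t => by
          apply jointEpi_quotComp r₁ r₂ a b t
          intro _
          change _ ≫ quotComp r₁ r₂ a b t ≫ _ = (_ ⊗ₘ _) ≫ _
          rw [← Category.assoc, π_quotComp, Category.assoc, hg, φ.app_comp]
          simp only [← hg]
          rw [tensMap_comp]
          exact (tensorHom_comp_tensorHom_assoc _ _ _ _ _).symm
        app_one := fun c => by
          change (_ ≫ quotπ r₁ r₂ _ _) ≫ _ = _
          rw [Category.assoc, hg, φ.app_one] }
    refine ⟨ψ, ?_, fun ψ' h' => ?_⟩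
    · ext n c t
      exact hg c t
    · ext n c t
      apply jointEpi_quotπ r₁ r₂
      intro _
      refine Eq.trans ?_ (hg c t).symm
      rw [← h']
      rfl

variable {r₁ r₂}

/-- The components of every quotient operad are the quotients in `M` by the relations generated by
the given ones. -/
theorem IsQuotientBy.presents {Q : ColoredOperad M C} {π : O ⟶ Q} (H : IsQuotientBy r₁ r₂ π)
    {n : ℕ} (c : Fin n → C) (t : C) :
    Presents (T := PUnit.{v + 1}) (G := fun _ => O.ops c t) (a := fun _ => PUnit.unit)
      (b := fun _ => PUnit.unit) (fun ρ : QRel C c t => ρ.side r₁) (fun ρ => ρ.side r₂)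
      (fun _ => π.app c t) := by
  have H' := isQuotientBy_quotProj r₁ r₂
  obtain ⟨f, hf, -⟩ := H'.existsUnique π H.condition
  obtain ⟨g, hg, -⟩ := H.existsUnique (quotProj r₁ r₂) H'.condition
  have hfg : f ≫ g = 𝟙 _ := (H'.existsUnique (quotProj r₁ r₂) H'.condition).unique
    (by rw [← Category.assoc, hf, hg]) (Category.comp_id _)
  have hgf : g ≫ f = 𝟙 _ := (H.existsUnique π H.condition).unique
    (by rw [← Category.assoc, hg, hf]) (Category.comp_id _)
  refine (presents_quotπ r₁ r₂ c t).of_iso ⟨f.app c t, g.app c t, ?_, ?_⟩ fun _ => ?_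
  · exact congrArg (fun φ : quotOperad r₁ r₂ ⟶ quotOperad r₁ r₂ => φ.app c t) hfg
  · exact congrArg (fun φ : Q ⟶ Q => φ.app c t) hgf
  · exact congrArg (fun φ : O ⟶ Q => φ.app c t) hf

theorem IsQuotientBy.jointEpi {Q : ColoredOperad M C} {π : O ⟶ Q} (H : IsQuotientBy r₁ r₂ π)
    {n : ℕ} (c : Fin n → C) (t : C) : JointEpi (fun _ : PUnit.{v + 1} => π.app c t) :=
  (H.presents c t).jointEpi

end QuotientOperad

/-! ### Left adjoints of pullback functors of algebras -/

section LeftKanExtension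

/-- The shapes of the generators of the left Kan extension of an algebra along a morphism of
operads that is `f : C → D` on colors: formal operadic compositions starting from the colors of
the given algebra. -/
inductive LTerm {C D : Type w} (f : C → D) : D → Type w
  | gen (c : C) : LTerm f (f c)
  | op {n : ℕ} (u : Fin n → D) (t : D) (τ : ∀ i, LTerm f (u i)) : LTerm f t

/-- The shapes of the relations of the left Kan extension of an algebra: the axioms of an algebra,
the agreement with the given action, the trivial relations, and the closure under operations. -/
inductive LRel {C D : Type w} (f : C → D) : D → Type w
  | refl {t : D} (τ : LTerm f t) : LRel f t
  | assoc {n : ℕ} {k : Fin n → ℕ} (u : Fin n → D) (x : ∀ i, Fin (k i) → D) (t : D)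
      (τ : ∀ i j, LTerm f (x i j)) : LRel f t
  | unit {t : D} (τ : LTerm f t) : LRel f t
  | perm {m n : ℕ} (e : Fin m ≃ Fin n) (u : Fin n → D) (t : D) (τ : ∀ i, LTerm f (u i)) : LRel f t
  | gen {n : ℕ} (c : Fin n → C) (s : C) : LRel f (f s)
  | cong {n : ℕ} (u : Fin n → D) (t : D) (ρ : ∀ i, LRel f (u i)) : LRel f t

variable {M : Type u} [Category.{v} M] [MonoidalCategory M]

theorem whisker_whisker {A A' B B' : M} (x : A ⟶ A') (y : B ⟶ B') :
    (x ▷ B) ≫ (A' ◁ y) = (A ◁ y) ≫ (x ▷ B') :=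
  (whisker_exchange x y).symm

theorem whiskerLeft_tensMap_comp_assoc {n : ℕ} (A : M) {X Y Z : Fin n → M} (f : ∀ i, X i ⟶ Y i)
    (g : ∀ i, Y i ⟶ Z i) {W : M} (k : A ⊗ tens Z ⟶ W) :
    (A ◁ tensMap f) ≫ (A ◁ tensMap g) ≫ k = (A ◁ tensMap (fun i => f i ≫ g i)) ≫ k := by
  rw [tensMap_comp, MonoidalCategory.whiskerLeft_comp_assoc]

variable [SymmetricCategory M]

section Shapes

variable {C D : Type w} (f : C → D) (O : ColoredOperad M C) (P : ColoredOperad M D) (A : C → M)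

variable {f} in
/-- The generators of a given shape. -/
@[reducible]
def LTerm.ob : {t : D} → LTerm f t → M
  | _, .gen c => A c
  | _, .op u t τ => P.ops u t ⊗ tens (fun i => (τ i).ob)

variable {f} in
/-- The shape of the generators on the left hand side of a relation. -/
@[reducible]
def LRel.lhs : {t : D} → LRel f t → LTerm f t
  | _, .refl τ => τ
  | _, .assoc u x t τ => .op u t fun i => .op (x i) (u i) (τ i)
  | _, .unit (t := t) τ => .op (fun _ : Fin 1 => t) t fun _ => τ
  | _, .perm e u t τ => .op (fun i => u (e i)) t fun i => τ (e i)
  | _, .gen c s => .op (fun i => f (c i)) (f s) fun i => .gen (c i)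
  | _, .cong u t ρ => .op u t fun i => (ρ i).lhs

variable {f} in
/-- The shape of the generators on the right hand side of a relation. -/
@[reducible]
def LRel.rhs : {t : D} → LRel f t → LTerm f t
  | _, .refl τ => τ
  | _, .assoc _ x t τ => .op (concat x) t fun z => τ (unpos z).1 (unpos z).2
  | _, .unit τ => τ
  | _, .perm _ u t τ => .op u t τ
  | _, .gen _ s => .gen s
  | _, .cong u t ρ => .op u t fun i => (ρ i).rhs

variable {f} in
/-- The object that parametrizes the relations of a given shape. -/
@[reducible]
def LRel.ob : {t : D} → LRel f t → M
  | _, .refl τ => τ.ob P A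
  | _, .assoc u x t τ => P.ops u t ⊗
      tens (fun i => (P.ops (x i) (u i) ⊗ tens (fun j => (τ i j).ob P A) : M))
  | _, .unit τ => 𝟙_ M ⊗ tens (fun _ : Fin 1 => τ.ob P A)
  | _, .perm _ u t τ => P.ops u t ⊗ tens (fun i => (τ i).ob P A)
  | _, .gen c s => O.ops c s ⊗ tens (fun i => A (c i))
  | _, .cong u t ρ => P.ops u t ⊗ tens (fun i => (ρ i).ob)

end Shapes

section Maps

variable {X Y : OperadVar.{w} M} (φ : X ⟶ Y) (A : OpAlgebra X.operad)

/-- The left hand side of the relations of a given shape. -/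
def LRel.lmap : {t : Y.colors} → (ρ : LRel φ.onColors t) →
    (ρ.ob X.operad Y.operad A.carrier ⟶ ρ.lhs.ob Y.operad A.carrier)
  | _, .refl _ => 𝟙 _
  | _, .assoc _ _ _ _ => 𝟙 _
  | _, .unit _ => Y.operad.one _ ▷ _
  | _, .perm e _ t τ => Y.operad.perm e (fun _ => rfl) t ⊗ₘ
      tensPerm e (fun i => (τ i).ob Y.operad A.carrier)
  | _, .gen c s => OperadVar.opsMap φ c s ▷ _
  | _, .cong u t ρ => Y.operad.ops u t ◁ tensMap (fun i => (ρ i).lmap)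

/-- The right hand side of the relations of a given shape. -/
def LRel.rmap : {t : Y.colors} → (ρ : LRel φ.onColors t) →
    (ρ.ob X.operad Y.operad A.carrier ⟶ ρ.rhs.ob Y.operad A.carrier)
  | _, .refl _ => 𝟙 _
  | _, .assoc u x t τ =>
      (Y.operad.ops u t ◁ (tensZip (fun i => Y.operad.ops (x i) (u i))
          (fun i => tens (fun j => (τ i j).ob Y.operad A.carrier)) ≫
        (tens (fun i => Y.operad.ops (x i) (u i)) ◁
          tensFlat (fun i j => (τ i j).ob Y.operad A.carrier)))) ≫
      (α_ _ _ _).inv ≫ (Y.operad.comp u x t ▷ _)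
  | _, .unit _ => (λ_ _).hom ≫ (ρ_ _).hom
  | _, .perm _ _ _ _ => 𝟙 _
  | _, .gen c s => A.act c s
  | _, .cong u t ρ => Y.operad.ops u t ◁ tensMap (fun i => (ρ i).rmap)

theorem LRel.reflexiveRel (t : Y.colors) :
    ReflexiveRel (G := fun τ : LTerm φ.onColors t => τ.ob Y.operad A.carrier)
      (fun ρ : LRel φ.onColors t => ρ.lmap φ A) (fun ρ => ρ.rmap φ A) :=
  fun τ => ⟨.refl τ, 𝟙 (τ.ob Y.operad A.carrier),
    congrArg (Sigma.mk τ) (Category.id_comp (𝟙 (τ.ob Y.operad A.carrier))),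
    congrArg (Sigma.mk τ) (Category.id_comp (𝟙 (τ.ob Y.operad A.carrier)))⟩

variable {φ A}

/-- The values on the generators of the morphism from the left Kan extension of `A` to `B` given by
a morphism from `A` to the pullback of `B`. -/
def LTerm.eval {B : OpAlgebra Y.operad} (h : A ⟶ (algPullback φ).obj B) :
    {t : Y.colors} → (τ : LTerm φ.onColors t) → (τ.ob Y.operad A.carrier ⟶ B.carrier t)
  | _, .gen c => h.app c
  | _, .op u t τ => (Y.operad.ops u t ◁ tensMap (fun i => (τ i).eval h)) ≫ B.act u t

/-- Naturality, in the inputs, of the composition of operations with operations. -/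
theorem inputs_natural {D : Type w} (P : ColoredOperad M D) {n : ℕ} {k : Fin n → ℕ}
    (u : Fin n → D) (x : ∀ i, Fin (k i) → D) (t : D) {V W : ∀ i, Fin (k i) → M}
    (y : ∀ i j, V i j ⟶ W i j) :
    ((P.ops u t ◁ (tensZip (fun i => P.ops (x i) (u i)) (fun i => tens (V i)) ≫
        (tens (fun i => P.ops (x i) (u i)) ◁ tensFlat V))) ≫
      (α_ _ _ _).inv ≫ (P.comp u x t ▷ _)) ≫
      (P.ops (concat x) t ◁ tensMap (fun z => y (unpos z).1 (unpos z).2)) =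
    (P.ops u t ◁ tensMap (fun i => P.ops (x i) (u i) ◁ tensMap (y i))) ≫
      (P.ops u t ◁ (tensZip (fun i => P.ops (x i) (u i)) (fun i => tens (W i)) ≫
        (tens (fun i => P.ops (x i) (u i)) ◁ tensFlat W))) ≫
      (α_ _ _ _).inv ≫ (P.comp u x t ▷ _) := by
  have hz := tensZip_natural (fun i => 𝟙 (P.ops (x i) (u i))) (fun i => tensMap (y i))
  rw [tensMap_id] at hz
  simp only [id_tensorHom] at hz
  have hf := tensFlat_natural y
  rw [← MonoidalCategory.whiskerLeft_comp_assoc, ← Category.assoc (tensMap _), hz]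
  simp only [Category.assoc, MonoidalCategory.whiskerLeft_comp, ← whisker_exchange]
  rw [← MonoidalCategory.whiskerLeft_comp_assoc _ (_ ◁ tensMap fun i => tensMap (y i)),
    ← MonoidalCategory.whiskerLeft_comp, hf, MonoidalCategory.whiskerLeft_comp,
    MonoidalCategory.whiskerLeft_comp_assoc]
  exact whisker_eq _ (whisker_eq _ (associator_inv_naturality_right_assoc _ _ _ _).symm)

/-- The values on the generators respect the relations, because `B` is an algebra and `h` is a morphism
of algebras. -/
theorem LTerm.eval_rel {B : OpAlgebra Y.operad} (h : A ⟶ (algPullback φ).obj B)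
    {t : Y.colors} (ρ : LRel φ.onColors t) :
    ρ.lmap φ A ≫ ρ.lhs.eval h = ρ.rmap φ A ≫ ρ.rhs.eval h := by
  induction ρ with
  | refl => rfl
  | assoc u x t τ =>
    have h₁ := inputs_natural Y.operad u x t (fun i j => (τ i j).eval h)
    have h₂ := B.act_assoc u x t
    refine (Category.id_comp _).trans ?_
    change (_ ◁ tensMap (fun i => (_ ◁ tensMap (fun j => (τ i j).eval h)) ≫ B.act _ _)) ≫ _ =
      (_ ≫ _ ≫ _) ≫ (_ ◁ tensMap (fun z => (τ (unpos z).1 (unpos z).2).eval h)) ≫ B.act _ t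
    refine Eq.trans ?_ (eq_whisker h₁.symm (B.act (concat x) t) |>.trans (Category.assoc _ _ _))
    rw [tensMap_comp, MonoidalCategory.whiskerLeft_comp, Category.assoc, h₂]
    simp only [Category.assoc]
  | unit τ =>
    have h₁ := B.act_one ‹_›
    change (_ ▷ _) ≫ (_ ◁ tensMap (fun _ => τ.eval h)) ≫ B.act _ _ = (_ ≫ _) ≫ τ.eval h
    rw [← Category.assoc, whisker_whisker, Category.assoc, h₁, leftUnitor_naturality_assoc,
      Category.assoc]
    refine whisker_eq _ (Eq.trans ?_ (rightUnitor_naturality _))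
    exact eq_whisker (tensorHom_id _ _) _
  | perm e u t τ =>
    have h₁ := B.act_perm e u t
    have h₂ := tensPerm_natural e (fun i => (τ i).eval h)
    change (_ ⊗ₘ _) ≫ (_ ◁ tensMap (fun i => (τ (e i)).eval h)) ≫ B.act _ _ =
      𝟙 _ ≫ (_ ◁ tensMap (fun i => (τ i).eval h)) ≫ B.act _ _
    rw [hom_whisker_assoc, ← h₂, Category.id_comp, ← h₁, ← Category.assoc, whisker_hom]
  | gen c s =>
    have h₁ := h.app_act c s
    change (_ ▷ _) ≫ (_ ◁ tensMap (fun i => h.app (c i))) ≫ B.act _ _ = A.act c s ≫ h.app s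
    refine Eq.trans ?_ h₁.symm
    exact (Category.assoc _ _ _).symm.trans
      ((eq_whisker (whisker_whisker _ _) _).trans (Category.assoc _ _ _))
  | cong u t ρ ih =>
    change (_ ◁ tensMap (fun i => (ρ i).lmap φ A)) ≫
        (_ ◁ tensMap (fun i => (ρ i).lhs.eval h)) ≫ B.act _ _ =
      (_ ◁ tensMap (fun i => (ρ i).rmap φ A)) ≫
        (_ ◁ tensMap (fun i => (ρ i).rhs.eval h)) ≫ B.act _ _
    rw [← MonoidalCategory.whiskerLeft_comp_assoc, ← MonoidalCategory.whiskerLeft_comp_assoc,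
      ← tensMap_comp, ← tensMap_comp]
    simp only [ih]

end Maps

section Construction

variable [HasColimits M] {X Y : OperadVar.{v} M} (φ : X ⟶ Y) (A : OpAlgebra X.operad)

/-- The objects underlying the left Kan extension of an algebra. -/
noncomputable def lanOb (t : Y.colors) : M :=
  presented (G := fun τ : LTerm φ.onColors t => τ.ob Y.operad A.carrier)
    (fun ρ : LRel φ.onColors t => ρ.lmap φ A) (fun ρ => ρ.rmap φ A)

/-- The inclusions of the generators into the left Kan extension of an algebra. -/
noncomputable def lanι {t : Y.colors} (τ : LTerm φ.onColors t) :
    τ.ob Y.operad A.carrier ⟶ lanOb φ A t :=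
  presentedι (G := fun τ : LTerm φ.onColors t => τ.ob Y.operad A.carrier)
    (fun ρ : LRel φ.onColors t => ρ.lmap φ A) (fun ρ => ρ.rmap φ A) τ

theorem presents_lanι (t : Y.colors) :
    Presents (G := fun τ : LTerm φ.onColors t => τ.ob Y.operad A.carrier)
      (fun ρ : LRel φ.onColors t => ρ.lmap φ A) (fun ρ => ρ.rmap φ A) (fun τ => lanι φ A τ) :=
  presents_presentedι _ _

theorem lanι_rel {t : Y.colors} (ρ : LRel φ.onColors t) :
    ρ.lmap φ A ≫ lanι φ A ρ.lhs = ρ.rmap φ A ≫ lanι φ A ρ.rhs :=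
  (presents_lanι φ A t).condition ρ

theorem jointEpi_lanι (t : Y.colors) : JointEpi (fun τ : LTerm φ.onColors t => lanι φ A τ) :=
  (presents_lanι φ A t).jointEpi

variable [MonoidalClosed M]

theorem exists_lanAct {n : ℕ} (u : Fin n → Y.colors) (t : Y.colors) :
    ∃ g : Y.operad.ops u t ⊗ tens (fun i => lanOb φ A (u i)) ⟶ lanOb φ A t,
      ∀ τ : (∀ i, LTerm φ.onColors (u i)),
        (Y.operad.ops u t ◁ tensMap (fun i => lanι φ A (τ i))) ≫ g = lanι φ A (.op u t τ) := by
  obtain ⟨g, hg⟩ := Presents.exists_desc_tens (T := fun i => LTerm φ.onColors (u i))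
    (S := fun i => LRel φ.onColors (u i)) (G := fun _ τ => τ.ob Y.operad A.carrier)
    (l := fun _ ρ => ρ.lmap φ A) (r := fun _ ρ => ρ.rmap φ A) (ι := fun _ τ => lanι φ A τ)
    (fun i => presents_lanι φ A (u i)) (fun i => LRel.reflexiveRel φ A (u i))
    (fun τ => MonoidalClosed.curry (A := Y.operad.ops u t) (lanι φ A (.op u t τ))) (fun ρ => by
      refine (MonoidalClosed.curry_natural_left _ _).symm.trans
        (Eq.trans ?_ (MonoidalClosed.curry_natural_left _ _))
      exact congrArg MonoidalClosed.curry (lanι_rel φ A (.cong u t ρ)))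
  refine ⟨MonoidalClosed.uncurry g, fun τ => ?_⟩
  rw [← MonoidalClosed.uncurry_natural_left, hg]
  exact MonoidalClosed.uncurry_curry _

/-- The action on the left Kan extension of an algebra. -/
noncomputable def lanAct {n : ℕ} (u : Fin n → Y.colors) (t : Y.colors) :
    Y.operad.ops u t ⊗ tens (fun i => lanOb φ A (u i)) ⟶ lanOb φ A t :=
  (exists_lanAct φ A u t).choose

theorem ι_lanAct {n : ℕ} (u : Fin n → Y.colors) (t : Y.colors)
    (τ : ∀ i, LTerm φ.onColors (u i)) :
    (Y.operad.ops u t ◁ tensMap (fun i => lanι φ A (τ i))) ≫ lanAct φ A u t =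
      lanι φ A (.op u t τ) :=
  (exists_lanAct φ A u t).choose_spec τ

theorem jointEpi_lanAct {n : ℕ} (u : Fin n → Y.colors) (B : M) :
    JointEpi (fun τ : (∀ i, LTerm φ.onColors (u i)) => B ◁ tensMap (fun i => lanι φ A (τ i))) :=
  (jointEpi_tens fun i => jointEpi_lanι φ A (u i)).whiskerLeft B

/-- The left Kan extension of an algebra along a morphism of operads. Each axiom holds because it
is one of the defining relations. -/
noncomputable def lanAlgebra : OpAlgebra Y.operad where
  carrier := lanOb φ A
  act u t := lanAct φ A u t
  act_assoc {n k} u x t := by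
    apply (jointEpi_tens fun i => jointEpi_lanAct φ A (x i) (Y.operad.ops (x i) (u i))).whiskerLeft
    intro τ
    have h := lanι_rel φ A (.assoc u x t τ)
    have h₁ := inputs_natural Y.operad u x t (fun i j => lanι φ A (τ i j))
    have h₂ := ι_lanAct φ A (concat x) t (fun z => τ (unpos z).1 (unpos z).2)
    dsimp only
    rw [← MonoidalCategory.whiskerLeft_comp_assoc, ← tensMap_comp]
    simp only [ι_lanAct]
    refine Eq.trans ((Category.id_comp _).symm.trans h) ?_
    refine (whisker_eq _ h₂.symm).trans ?_
    refine (Category.assoc _ _ _).symm.trans ((eq_whisker h₁ _).trans ?_)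
    simp only [Category.assoc]
  act_one c := by
    apply (jointEpi_tens (n := 1) fun _ => jointEpi_lanι φ A c).whiskerLeft
    intro τ
    obtain ⟨τ, rfl⟩ : ∃ τ₀, τ = fun _ => τ₀ :=
      ⟨τ 0, funext fun i => congrArg τ (Subsingleton.elim i 0)⟩
    have h := lanι_rel φ A (.unit τ)
    have h₁ := ι_lanAct φ A (fun _ : Fin 1 => c) c (fun _ => τ)
    dsimp only
    rw [← Category.assoc, whisker_exchange, Category.assoc, h₁]
    refine h.trans ?_
    rw [leftUnitor_naturality_assoc]
    refine (Category.assoc _ _ _).trans (whisker_eq _ ?_)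
    exact (rightUnitor_naturality _).symm.trans (eq_whisker (tensorHom_id _ _).symm _)
  act_perm e u t := by
    apply jointEpi_lanAct φ A u
    intro τ
    have h := lanι_rel φ A (.perm e u t τ)
    have h₁ := ι_lanAct φ A (fun i => u (e i)) t (fun i => τ (e i))
    have h₂ := tensPerm_natural e (fun i => lanι φ A (τ i))
    dsimp only
    rw [ι_lanAct, ← Category.assoc, whisker_hom, h₂, ← hom_whisker, Category.assoc, h₁]
    exact h.trans (Category.id_comp _)

/-- The unit of the left Kan extension of an algebra. -/
noncomputable def lanUnit : A ⟶ (algPullback φ).obj (lanAlgebra φ A) :=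
  ({ app := fun c => lanι φ A (.gen c)
     app_act := fun c s => by
       have h := lanι_rel φ A (.gen c s)
       have h₁ := ι_lanAct φ A (fun i => φ.onColors (c i)) (φ.onColors s) (fun i => .gen (c i))
       refine h.symm.trans ((whisker_eq _ h₁.symm).trans ?_)
       refine (Category.assoc _ _ _).symm.trans (Eq.trans ?_ (Category.assoc _ _ _))
       exact eq_whisker (whisker_whisker _ _) _ } :
    OpAlgebra.Hom A ((algPullback φ).obj (lanAlgebra φ A)))

variable {φ A}

theorem exists_lanDesc {B : OpAlgebra Y.operad} (h : A ⟶ (algPullback φ).obj B) :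
    ∃ g : lanAlgebra φ A ⟶ B, ∀ {t : Y.colors} (τ : LTerm φ.onColors t),
      lanι φ A τ ≫ g.app t = τ.eval h := by
  have key : ∀ t, ∃ g : lanOb φ A t ⟶ B.carrier t, ∀ τ : LTerm φ.onColors t,
      lanι φ A τ ≫ g = τ.eval h := fun t =>
    (presents_lanι φ A t).exists_desc (fun τ => τ.eval h) (fun ρ => LTerm.eval_rel h ρ)
  choose g hg using key
  refine ⟨({ app := g, app_act := fun u t => ?_ } : OpAlgebra.Hom (lanAlgebra φ A) B), hg _⟩
  apply jointEpi_lanAct φ A u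
  intro τ
  change _ ≫ lanAct φ A u t ≫ g t = _
  rw [← Category.assoc, ι_lanAct, hg]
  refine Eq.trans ?_ (whiskerLeft_tensMap_comp_assoc _ _ _ _).symm
  simp only [hg]
  rfl

/-- The unit generates: the formal operations are obtained from it by the action. -/
theorem lan_hom_ext {B : OpAlgebra Y.operad} {g g' : lanAlgebra φ A ⟶ B}
    (h : lanUnit φ A ≫ (algPullback φ).map g = lanUnit φ A ≫ (algPullback φ).map g') : g = g' := by
  have key : ∀ {t : Y.colors} (τ : LTerm φ.onColors t),
      lanι φ A τ ≫ g.app t = lanι φ A τ ≫ g'.app t := by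
    intro t τ
    induction τ with
    | gen c => exact congrArg (fun k : A ⟶ (algPullback φ).obj B => k.app c) h
    | op u t τ ih =>
      have e : ∀ k : lanAlgebra φ A ⟶ B, lanι φ A (.op u t τ) ≫ k.app t =
          (Y.operad.ops u t ◁ tensMap (fun i => lanι φ A (τ i) ≫ k.app (u i))) ≫ B.act u t := by
        intro k
        have hk := k.app_act u t
        rw [← ι_lanAct]
        exact (Category.assoc _ _ _).trans
          ((whisker_eq _ hk).trans (whiskerLeft_tensMap_comp_assoc _ _ _ _))
      rw [e g, e g']
      simp only [ih]
  apply OpAlgebra.hom_ext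
  intro t
  exact jointEpi_lanι φ A t key

variable (φ) in
/-- Operadic left Kan extensions exist. -/
theorem isRightAdjoint_algPullback : (algPullback φ).IsRightAdjoint := by
  have : ∀ A, HasInitial (StructuredArrow A (algPullback φ)) := by
    intro A
    have hi : IsInitial (StructuredArrow.mk (lanUnit φ A)) := by
      refine IsInitial.ofUniqueHom (fun Z => ?_) (fun Z m => ?_)
      · refine StructuredArrow.homMk (exists_lanDesc Z.hom).choose ?_
        apply OpAlgebra.hom_ext
        intro c
        exact (exists_lanDesc Z.hom).choose_spec (.gen c)
      · apply StructuredArrow.ext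
        apply lan_hom_ext
        refine (StructuredArrow.w m).trans ?_
        symm
        apply OpAlgebra.hom_ext
        intro c
        exact (exists_lanDesc Z.hom).choose_spec (.gen c)
    exact hi.hasInitial
  exact isRightAdjointOfStructuredArrowInitials _

end Construction

end LeftKanExtension

/-! ### Coherence of the canonical isomorphisms -/

section Coherence

variable {M : Type u} [Category.{v} M] [MonoidalCategory M]

theorem tens_congr {m n : ℕ} (h : m = n) {X : Fin m → M} {Y : Fin n → M}
    (hX : ∀ i, X i = Y (Fin.cast h i)) : tens X = tens Y := by
  subst h
  exact congrArg tens (funext hX)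

theorem whiskerLeft_tensCast {m n : ℕ} (h : m = n) {X : Fin m → M} {Y : Fin n → M}
    (hX : ∀ i, X i = Y (Fin.cast h i)) (A : M) :
    A ◁ tensCast h hX = eqToHom (congrArg (A ⊗ ·) (tens_congr h hX)) :=
  whiskerLeft_eqToHom A _

theorem consCast_eq {n : ℕ} {A : M} {Y : Fin n → M} {Z : Fin (n + 1) → M} (hA : A = Z 0)
    (hY : ∀ i, Y i = Z i.succ) :
    consCast hA hY = eqToHom (congrArg₂ (· ⊗ ·) hA (tens_congr rfl hY)) := by
  subst hA
  obtain rfl : Y = fun i => Z i.succ := funext hY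
  simp [consCast, tensCast]

/-- Appending the empty list is the right unitor. -/
theorem tensAppend_zero : ∀ (m : ℕ) (Z : Fin (m + 0) → M),
    tensAppend m 0 Z = (ρ_ _).hom ≫ tensCast (m := m) (n := m + 0) rfl (fun _ => rfl)
  | 0, Z => by
    simp only [tensAppend, unitors_equal]
    rfl
  | m + 1, Z => by
    have ih := tensAppend_zero m (fun i => Z (Fin.cast (by omega) i.succ))
    simp only [tensAppend]
    rw [ih]
    have h0 : tensCast (M := M) (m := 0) (n := 0) (X := fun i => Z (Fin.natAdd (m + 1) i))
      (Y := fun i => Z (Fin.cast (by omega) (Fin.natAdd m i).succ)) rfl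
      (fun i => i.elim0) = 𝟙 _ := rfl
    rw [h0, MonoidalCategory.whiskerLeft_id, Category.id_comp,
      MonoidalCategory.whiskerLeft_comp, whiskerLeft_tensCast, consCast_eq]
    simp only [tensCast, eqToHom_trans, Category.assoc]
    simp

theorem tens_one_add {n : ℕ} (Z : Fin (1 + n) → M) :
    (Z (Fin.castAdd n 0) ⊗ tens fun i => Z (Fin.natAdd 1 i)) = tens Z :=
  (congrArg₂ (· ⊗ ·)
    (congrArg Z (Fin.ext (by simp) : Fin.castAdd n 0 = Fin.cast (Nat.add_comm n 1) 0))
    (tens_congr (Y := fun i : Fin n => Z (Fin.cast (Nat.add_comm n 1) i.succ)) rfl fun i =>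
      congrArg Z (Fin.ext (by simp; omega)))).trans
    (tens_congr (m := n + 1) (X := fun i => Z (Fin.cast (Nat.add_comm n 1) i))
      (Nat.add_comm n 1) fun _ => rfl)

/-- Appending to a list with one entry is the right unitor of that entry. -/
theorem tensAppend_one (n : ℕ) (Z : Fin (1 + n) → M)
    (h : (Z (Fin.castAdd n 0) ⊗ tens fun i => Z (Fin.natAdd 1 i)) = tens Z) :
    tensAppend 1 n Z = ((ρ_ _).hom ▷ _) ≫ eqToHom h := by
  have key : ∀ {A X Y V W : M} (e : X = Y) (h' : Y = V) (h₀ : (A ⊗ V : M) = W)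
      (h : (A ⊗ X : M) = W),
      (α_ A (𝟙_ M) X).hom ≫ (A ◁ ((𝟙_ M ◁ eqToHom e) ≫ (λ_ Y).hom ≫ eqToHom h')) ≫ eqToHom h₀ =
        ((ρ_ A).hom ▷ X) ≫ eqToHom h := by
    intro A X Y V W e h' h₀ h
    subst e h' h₀
    simp
  simp only [tensAppend]
  rw [consCast_eq]
  simp only [tensCast, eqToHom_trans]
  exact key _ _ _ _

/-- Flattening a list of one list is the right unitor. -/
theorem tensFlat_one {k : ℕ} (X : Fin k → M)
    (h : tens X = tens (concat fun _ : Fin 1 => X)) :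
    tensFlat (fun _ : Fin 1 => X) = (ρ_ (tens X)).hom ≫ eqToHom h := by
  have key : ∀ {A B V W : M} (e : A = B) (h' : B = V) (h'' : V = W) (h : A = W),
      (eqToHom e ⊗ₘ 𝟙 (𝟙_ M)) ≫ ((ρ_ B).hom ≫ eqToHom h') ≫ eqToHom h'' =
        (ρ_ A).hom ≫ eqToHom h := by
    intro A B V W e h' h'' h
    subst e h' h''
    simp
  have ha := tensAppend_zero k
    (fun x => concat (fun _ : Fin 1 => X) (Fin.cast (Fin.sum_univ_succ _).symm x))
  refine Eq.trans (congrArg₂ (fun y z => (_ ⊗ₘ y) ≫ z ≫ _) (Category.id_comp _) ha) ?_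
  exact key _ _ _ _

theorem sumOneEquiv_val {n : ℕ} (x : Fin n) : (sumOneEquiv n x).val = x.val := by
  have h := unpos_sumOneEquiv x
  rw [unpos, Equiv.symm_apply_eq] at h
  rw [h, finSigmaFinEquiv_apply]
  simp

theorem tens_singletons {n : ℕ} (X : Fin n → M) :
    tens X = tens (concat fun (i : Fin n) (_ : Fin 1) => X i) :=
  tens_congr (by simp) fun i =>
    (concat_sumOneEquiv X i).trans (congrArg (concat _) (Fin.ext (sumOneEquiv_val i)))

/-- Flattening a list of lists with one entry consists of right unitors. -/
theorem tensFlat_singletons : ∀ {n : ℕ} (X : Fin n → M)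
    (h : tens X = tens (concat fun (i : Fin n) (_ : Fin 1) => X i)),
    tensFlat (fun (i : Fin n) (_ : Fin 1) => X i) =
      tensMap (X := fun i => (X i ⊗ 𝟙_ M : M)) (fun i => (ρ_ (X i)).hom) ≫ eqToHom h
  | 0, X, h => (Category.id_comp _).symm
  | n + 1, X, h => by
    have ih := tensFlat_singletons (fun i => X i.succ) (tens_singletons _)
    have key : ∀ {A B S S' T T' U W : M} (r : S' ⟶ S) (e : (A ⊗ 𝟙_ M : M) = (B ⊗ 𝟙_ M : M))
        (e' : A = B) (h₁ : S = T) (h₂ : T = T') (h₃ : (B ⊗ T' : M) = U) (h₄ : U = W) (h : (A ⊗ S : M) = W),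
        (eqToHom e ⊗ₘ ((r ≫ eqToHom h₁) ≫ eqToHom h₂)) ≫ (((ρ_ B).hom ▷ T') ≫ eqToHom h₃) ≫
          eqToHom h₄ = ((ρ_ A).hom ⊗ₘ r) ≫ eqToHom h := by
      intro A B S S' T T' U W r e e' h₁ h₂ h₃ h₄ h
      subst e' h₁ h₂ h₃ h₄
      simp [MonoidalCategory.tensorHom_def]
    let Z : Fin (1 + ∑ _i : Fin n, 1) → M := fun x => concat (fun (i : Fin (n + 1)) (_ : Fin 1) => X i)
      (Fin.cast (Fin.sum_univ_succ _).symm x)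
    have ha := tensAppend_one (M := M) (∑ _i : Fin n, 1) Z (tens_one_add Z)
    rw [tensMap_succ]
    refine Eq.trans (congrArg₂ (fun y z => (_ ⊗ₘ (y ≫ _)) ≫ z ≫ _) ih ha) ?_
    exact key _ _ (congrArg (fun p : Σ _ : Fin (n + 1), Fin 1 => X p.1)
      (unpos_zero (fun _ : Fin (n + 1) => 1) 0)).symm _ _ _ _ _

theorem oneSumEquiv_val {n : ℕ} (x : Fin n) : (oneSumEquiv n x).val = x.val := by
  have h := unpos_oneSumEquiv x
  rw [unpos, Equiv.symm_apply_eq] at h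
  rw [h, finSigmaFinEquiv_apply]
  simp

variable [BraidedCategory M]

theorem tensPull_zero : ∀ {n : ℕ} (X : Fin (n + 1) → M)
    (h : tens X = (X 0 ⊗ tens fun j => X ((0 : Fin (n + 1)).succAbove j))),
    tensPull 0 X = eqToHom h
  | 0, X, h => by simp [tensPull]
  | n + 1, X, h => whiskerLeft_tensCast _ _ _

theorem tensPerm_refl : ∀ {n : ℕ} (e : Fin n ≃ Fin n) (X : Fin n → M)
    (_ : e = Equiv.refl _) (h : tens X = tens (fun i => X (e i))), tensPerm e X = eqToHom h
  | 0, e, X, he, h => rfl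
  | n + 1, e, X, he, h => by
    have he' : removeZero e = Equiv.refl _ := by
      subst he
      ext j
      have h := succAbove_removeZero (Equiv.refl (Fin (n + 1))) j
      simpa [Fin.ext_iff] using h
    have ih := tensPerm_refl (removeZero e) (fun j => X ((e 0).succAbove j)) he'
      (tens_congr rfl fun i => congrArg (fun e' : Fin n ≃ Fin n => X ((e 0).succAbove (e' i)))
        he'.symm)
    have hp := tensPull_zero X (tens_congr rfl fun i => by cases i using Fin.cases <;> rfl)
    rw [tensPerm, ih]
    subst he
    refine (eq_whisker hp _).trans ?_
    rw [MonoidalCategory.whiskerLeft_comp, whiskerLeft_tensCast, whiskerLeft_eqToHom]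
    refine (whisker_eq _ (eqToHom_trans _ _)).trans (eqToHom_trans _ _)

/-- An order preserving permutation acts by the identity. -/
theorem tensPerm_of_val {m n : ℕ} (e : Fin m ≃ Fin n) (he : ∀ i, (e i).val = i.val)
    (X : Fin n → M) (h : tens X = tens (fun i => X (e i))) : tensPerm e X = eqToHom h := by
  obtain rfl : m = n := by simpa using Fintype.card_congr e
  exact tensPerm_refl e X (Equiv.ext fun i => Fin.ext (he i)) h

/-- The comparison of `⊗ i, (𝟙_ M ⊗ X i)` with `(⊗ i, 𝟙_ M) ⊗ (⊗ i, X i)` is unital. -/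
theorem leftUnitor_tensZip : ∀ {n : ℕ} (X : Fin n → M),
    tensMap (Y := fun i => (𝟙_ M ⊗ X i : M)) (fun i => (λ_ (X i)).inv) ≫
      tensZip (fun _ => 𝟙_ M) X = (λ_ (tens X)).inv ≫ (tensUnit n ▷ tens X)
  | 0, X => by simp [tensMap, tensZip, tensUnit]
  | n + 1, X => by
    have ih := leftUnitor_tensZip (fun i => X i.succ)
    have hμ := tensorμ_natural (𝟙 (𝟙_ M)) (𝟙 (X 0)) (tensUnit n) (𝟙 (tens fun i => X i.succ))
    have hl := leftUnitor_monoidal (X 0) (tens fun i => X i.succ)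
    have hl' : ((λ_ (X 0)).inv ⊗ₘ (λ_ (tens fun i => X i.succ)).inv) ≫
        tensorμ (𝟙_ M) (X 0) (𝟙_ M) (tens fun i => X i.succ) =
        (λ_ (X 0 ⊗ tens fun i => X i.succ)).inv ≫ ((λ_ (𝟙_ M)).inv ▷ _) := by
      rw [← cancel_epi ((λ_ (X 0)).hom ⊗ₘ (λ_ (tens fun i => X i.succ)).hom),
        tensorHom_comp_tensorHom_assoc, hl]
      simp
    simp only [tensMap_succ, tensZip, tensUnit]
    rw [hom_whisker_assoc]
    refine (eq_whisker (congrArg (fun z => (λ_ (X 0)).inv ⊗ₘ z) ih) _).trans ?_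
    simp only [id_tensorHom, tensorHom_id] at hμ
    rw [← hom_whisker, Category.assoc]
    rw [id_whiskerRight, id_tensorHom, id_whiskerRight, tensorHom_id] at hμ
    refine (whisker_eq _ hμ).trans ?_
    rw [← Category.assoc, hl', Category.assoc, ← comp_whiskerRight]

theorem tensZip_one (A B : M) :
    tensZip (fun _ : Fin 1 => A) (fun _ => B) =
      (ρ_ (A ⊗ B)).hom ≫ ((ρ_ A).inv ⊗ₘ (ρ_ B).inv) := by
  simp only [tensZip, tensorμ]
  rw [braiding_tensorUnit_right]
  monoidal

end Coherence

/-! ### Unary operations -/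

section Unary

variable {M : Type u} [Category.{v} M] [MonoidalCategory M]

/-- Moves a change of the operations and of the inputs past the composition of operations, in the form
in which it occurs on the right hand side of the associativity of an action. -/
theorem act_assoc_congr {A B B' D E F : M} {z : F ⟶ B ⊗ D} {W : M} {w : D ⟶ W}
    {μ : A ⊗ B ⟶ E} {p : E ⟶ B'} {Z : M} {f : B' ⊗ W ⟶ Z} :
    (A ◁ z) ≫ (α_ A B D).inv ≫ (μ ▷ D) ≫ (p ⊗ₘ w) ≫ f =
      (A ◁ (z ≫ (B ◁ w))) ≫ (α_ A B W).inv ≫ ((μ ≫ p) ▷ W) ≫ f := by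
  rw [MonoidalCategory.whiskerLeft_comp_assoc, associator_inv_naturality_right_assoc,
    MonoidalCategory.tensorHom_def', comp_whiskerRight]
  simp only [Category.assoc, whisker_exchange_assoc]

theorem unary_whisker {A : M} (o : 𝟙_ M ⟶ A) (X T : M) :
    (ρ_ (X ⊗ T)).inv ≫ (λ_ _).inv ≫ (o ▷ ((X ⊗ T) ⊗ 𝟙_ M)) ≫
      (A ◁ ((ρ_ (X ⊗ T)).hom ≫ (ρ_ X).inv ▷ T)) ≫ (α_ _ _ _).inv =
    ((ρ_ X).inv ≫ (λ_ _).inv ≫ (o ▷ (X ⊗ 𝟙_ M))) ▷ T := by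
  monoidal

theorem whisker_unary {A B : M} (y : 𝟙_ M ⟶ B) (T : M) :
    (A ◁ ((λ_ T).inv ≫ (y ▷ T))) ≫ (α_ _ _ _).inv = ((ρ_ A).inv ≫ (A ◁ y)) ▷ T := by
  monoidal

variable [SymmetricCategory M]

/-- Equivariance of an action with the permuted list of colors given up to propositional equality. -/
theorem OpAlgebra.act_perm_of_eq {C : Type w} {O : ColoredOperad M C} (A : OpAlgebra O) {m n : ℕ}
    (e : Fin m ≃ Fin n) {c : Fin n → C} {d : Fin m → C} (h : ∀ i, d i = c (e i)) (t : C)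
    (h' : (tens (fun i => A.carrier (c (e i))) : M) = tens (fun i => A.carrier (d i))) :
    (O.perm e h t ⊗ₘ (tensPerm e (fun i => A.carrier (c i)) ≫ eqToHom h')) ≫ A.act d t =
      A.act c t := by
  obtain rfl : d = fun i => c (e i) := funext h
  rw [eqToHom_refl, Category.comp_id]
  exact A.act_perm e c t

/-- The morphism by which a unary operation acts on an algebra. -/
def OpAlgebra.unary {C : Type w} {O : ColoredOperad M C} (A : OpAlgebra O) {s t : C}
    (o : 𝟙_ M ⟶ O.ops (fun _ : Fin 1 => s) t) : A.carrier s ⟶ A.carrier t :=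
  (ρ_ _).inv ≫ (λ_ _).inv ≫ (o ▷ tens (fun _ : Fin 1 => A.carrier s)) ≫
    A.act (fun _ : Fin 1 => s) t

/-- Postcomposition of operations with a unary operation. -/
def ColoredOperad.postUnary {C : Type w} (O : ColoredOperad M C) {s t : C}
    (o : 𝟙_ M ⟶ O.ops (fun _ : Fin 1 => s) t) {n : ℕ} (c : Fin n → C) :
    O.ops c s ⟶ O.ops c t :=
  (ρ_ _).inv ≫ (λ_ _).inv ≫ (o ▷ tens (fun _ : Fin 1 => O.ops c s)) ≫
    O.comp (fun _ : Fin 1 => s) (fun _ => c) t ≫ O.perm (oneSumEquiv n) (concat_oneSumEquiv c) t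

/-- Precomposition of operations with unary operations in all inputs. -/
def ColoredOperad.preUnary {C : Type w} (O : ColoredOperad M C) {n : ℕ} {c a : Fin n → C}
    (o : ∀ i, 𝟙_ M ⟶ O.ops (fun _ : Fin 1 => c i) (a i)) (t : C) : O.ops a t ⟶ O.ops c t :=
  (ρ_ _).inv ≫ (O.ops a t ◁ (tensUnit n ≫ tensMap o)) ≫ O.comp a (fun i _ => c i) t ≫
    O.perm (sumOneEquiv n) (concat_sumOneEquiv c) t

/-- A unary operation acts on an algebra after operations as the composite operations. -/
theorem OpAlgebra.act_unary {C : Type w} {O : ColoredOperad M C} (A : OpAlgebra O) {s t : C}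
    (o : 𝟙_ M ⟶ O.ops (fun _ : Fin 1 => s) t) {n : ℕ} (c : Fin n → C) :
    A.act c s ≫ A.unary o = (O.postUnary o c ▷ tens (fun i => A.carrier (c i))) ≫ A.act c t := by
  have h := A.act_assoc (fun _ : Fin 1 => s) (fun _ => c) t
  have h₀ : tens (fun i => A.carrier (c i)) = tens (concat fun (_ : Fin 1) i => A.carrier (c i)) :=
    tens_congr (by simp) fun i => congrArg A.carrier
      ((concat_oneSumEquiv c i).trans (congrArg (concat _) (Fin.ext (oneSumEquiv_val i))))
  have h₁ : (tens (fun i => A.carrier (concat (fun _ : Fin 1 => c) (oneSumEquiv n i))) : M) =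
      tens fun i => A.carrier (c i) :=
    tens_congr rfl fun i => congrArg A.carrier (concat_oneSumEquiv c i).symm
  have hp := A.act_perm_of_eq (oneSumEquiv n) (concat_oneSumEquiv c) t h₁
  have hw : tensFlat (fun (_ : Fin 1) i => A.carrier (c i)) ≫
      tensPerm (oneSumEquiv n) (fun i => A.carrier (concat (fun _ => c) i)) ≫ eqToHom h₁ =
      (ρ_ _).hom := by
    rw [tensFlat_one _ h₀, tensPerm_of_val _ oneSumEquiv_val _ (h₀.symm.trans h₁.symm)]
    simp
  have hz : (tensZip (fun _ : Fin 1 => O.ops c s) (fun _ => tens fun i => A.carrier (c i)) ≫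
        (tens (fun _ : Fin 1 => O.ops c s) ◁ tensFlat (fun (_ : Fin 1) i => A.carrier (c i)))) ≫
      (tens (fun _ : Fin 1 => O.ops c s) ◁
        (tensPerm (oneSumEquiv n) (fun i => A.carrier (concat (fun _ => c) i)) ≫ eqToHom h₁)) =
      (ρ_ _).hom ≫ ((ρ_ _).inv ▷ _) := by
    rw [Category.assoc, ← MonoidalCategory.whiskerLeft_comp, hw, tensZip_one, Category.assoc,
      hom_whisker]
    simp
  have h₂ := h.trans ((whisker_eq _ (whisker_eq _ (whisker_eq _ hp.symm))).trans
    (act_assoc_congr.trans (eq_whisker (congrArg (_ ◁ ·) hz) _)))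
  have h₃ : A.act c s ≫ A.unary o = (ρ_ _).inv ≫ (λ_ _).inv ≫ (o ▷ _) ≫
      (O.ops (fun _ : Fin 1 => s) t ◁ tensMap (fun _ : Fin 1 => A.act c s)) ≫
        A.act (fun _ : Fin 1 => s) t := by
    have : tensMap (fun _ : Fin 1 => A.act c s) = A.act c s ▷ 𝟙_ M := tensorHom_id _ _
    rw [this, ← whisker_exchange_assoc, ← leftUnitor_inv_naturality_assoc,
      ← rightUnitor_inv_naturality_assoc]
    rfl
  have h₄ := unary_whisker o (O.ops c s) (tens fun i => A.carrier (c i))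
  rw [h₃, h₂]
  refine Eq.trans ?_ (eq_whisker (congrArg (· ▷ _) (Category.assoc _ _ _ |>.trans
    (whisker_eq _ (Category.assoc _ _ _)))) _)
  refine Eq.trans ?_ (eq_whisker (comp_whiskerRight _ _ _).symm _)
  refine Eq.trans ?_ (eq_whisker (eq_whisker h₄ _) _)
  simp only [Category.assoc]

/-- Operations act on an algebra after unary operations as the composite operations. -/
theorem OpAlgebra.unary_act {C : Type w} {O : ColoredOperad M C} (A : OpAlgebra O) {n : ℕ}
    {c a : Fin n → C} (o : ∀ i, 𝟙_ M ⟶ O.ops (fun _ : Fin 1 => c i) (a i)) (t : C) :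
    (O.ops a t ◁ tensMap (fun i => A.unary (o i))) ≫ A.act a t =
      (O.preUnary o t ▷ tens (fun i => A.carrier (c i))) ≫ A.act c t := by
  have h := A.act_assoc a (fun i (_ : Fin 1) => c i) t
  have h₀ : tens (fun i => A.carrier (c i)) =
      tens (concat fun i (_ : Fin 1) => A.carrier (c i)) := tens_singletons _
  have h₁ : (tens (fun i => A.carrier (concat (fun i (_ : Fin 1) => c i) (sumOneEquiv n i))) : M) =
      tens fun i => A.carrier (c i) :=
    tens_congr rfl fun i => congrArg A.carrier (concat_sumOneEquiv c i).symm
  have hp := A.act_perm_of_eq (sumOneEquiv n) (concat_sumOneEquiv c) t h₁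
  have hw : tensFlat (fun i (_ : Fin 1) => A.carrier (c i)) ≫
      tensPerm (sumOneEquiv n) (fun i => A.carrier (concat (fun i _ => c i) i)) ≫ eqToHom h₁ =
      tensMap (X := fun i => (A.carrier (c i) ⊗ 𝟙_ M : M)) fun i => (ρ_ (A.carrier (c i))).hom := by
    rw [tensFlat_singletons _ h₀, tensPerm_of_val _ sumOneEquiv_val _ (h₀.symm.trans h₁.symm)]
    simp
  have h₂ := h.trans ((whisker_eq _ (whisker_eq _ (whisker_eq _ hp.symm))).trans act_assoc_congr)
  have hz := tensZip_natural (fun i => 𝟙 (O.ops (fun _ : Fin 1 => c i) (a i)))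
    (fun i => (ρ_ (A.carrier (c i))).hom)
  have hz₁ := tensZip_natural o (fun i => 𝟙 (A.carrier (c i)))
  have hz₂ := leftUnitor_tensZip (fun i => A.carrier (c i))
  rw [tensMap_id] at hz hz₁
  simp only [id_tensorHom, tensorHom_id] at hz hz₁
  have h₃ : tensMap (fun i => (ρ_ (A.carrier (c i))).inv ≫ (λ_ _).inv ≫ (o i ▷ _)) ≫
      (tensZip (fun i => O.ops (fun _ : Fin 1 => c i) (a i))
          (fun i => tens fun _ : Fin 1 => A.carrier (c i)) ≫
        (_ ◁ tensFlat (fun i (_ : Fin 1) => A.carrier (c i)))) ≫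
      (_ ◁ (tensPerm (sumOneEquiv n) (fun i => A.carrier (concat (fun i _ => c i) i)) ≫
        eqToHom h₁)) = (λ_ _).inv ≫ ((tensUnit n ≫ tensMap o) ▷ _) := by
    have e : ∀ i, ((ρ_ (A.carrier (c i))).inv ≫ (λ_ _).inv ≫ (o i ▷ _)) ≫
        (O.ops (fun _ : Fin 1 => c i) (a i) ◁ (ρ_ (A.carrier (c i))).hom) =
        (λ_ _).inv ≫ (o i ▷ A.carrier (c i)) := fun i => by monoidal
    rw [Category.assoc, ← MonoidalCategory.whiskerLeft_comp, hw]
    refine (whisker_eq _ hz.symm).trans ?_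
    rw [← Category.assoc]
    refine (eq_whisker (tensMap_comp _ _).symm _).trans ?_
    simp only [e]
    rw [tensMap_comp, Category.assoc, hz₁, ← Category.assoc, hz₂, Category.assoc,
      comp_whiskerRight]
  have h₄ := whisker_unary (A := O.ops a t) (tensUnit n ≫ tensMap o)
    (tens fun i => A.carrier (c i))
  have h₅ : tensMap (fun i => A.unary (o i)) =
      tensMap (fun i => (ρ_ (A.carrier (c i))).inv ≫ (λ_ _).inv ≫ (o i ▷ _)) ≫
        tensMap (fun i => A.act (fun _ : Fin 1 => c i) (a i)) := by
    rw [← tensMap_comp]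
    refine congrArg tensMap (funext fun i => ?_)
    simp only [Category.assoc]
    rfl
  rw [h₅, MonoidalCategory.whiskerLeft_comp, Category.assoc]
  refine (whisker_eq _ h₂).trans ?_
  rw [← MonoidalCategory.whiskerLeft_comp_assoc]
  refine (eq_whisker (congrArg (_ ◁ ·) h₃) _).trans ?_
  refine Eq.trans ?_ (eq_whisker (congrArg (· ▷ _) (Category.assoc _ _ _)) _)
  refine Eq.trans ?_ (eq_whisker (comp_whiskerRight _ _ _).symm _)
  refine Eq.trans ?_ (eq_whisker (eq_whisker h₄ _) _)
  simp only [Category.assoc]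

end Unary

/-! ### Diagrams of algebras as algebras over `P_K` -/

section Algebras

variable {M : Type u} [Category.{v} M] [MonoidalCategory M]

theorem comp_unitors_inv {X Y Z : M} (x : X ⟶ Y) (k : 𝟙_ M ⊗ tens (fun _ : Fin 1 => Y) ⟶ Z) :
    x ≫ (ρ_ Y).inv ≫ (λ_ _).inv ≫ k =
      (ρ_ X).inv ≫ (λ_ _).inv ≫ (𝟙_ M ◁ tensMap (fun _ : Fin 1 => x)) ≫ k := by
  have h : tensMap (fun _ : Fin 1 => x) = x ▷ 𝟙_ M := tensorHom_id _ _
  rw [h, ← leftUnitor_inv_naturality_assoc, ← rightUnitor_inv_naturality_assoc]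

variable [SymmetricCategory M]

/-- An isomorphism of algebras from compatible isomorphisms of the underlying objects. -/
def OpAlgebra.isoMk {C : Type w} {O : ColoredOperad M C} {A B : OpAlgebra O}
    (e : ∀ c, A.carrier c ≅ B.carrier c)
    (h : ∀ {n : ℕ} (c : Fin n → C) (t : C),
      A.act c t ≫ (e t).hom = (O.ops c t ◁ tensMap (fun i => (e (c i)).hom)) ≫ B.act c t) :
    A ≅ B where
  hom := ({ app := fun c => (e c).hom, app_act := h } : OpAlgebra.Hom A B)
  inv := ({
    app := fun c => (e c).inv
    app_act := fun c t => by
      have hi : (O.ops c t ◁ tensMap (fun i => (e (c i)).inv)) ≫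
          (O.ops c t ◁ tensMap (fun i => (e (c i)).hom)) = 𝟙 _ := by
        rw [← MonoidalCategory.whiskerLeft_comp, ← tensMap_comp]
        simp only [Iso.inv_hom_id, tensMap_id, MonoidalCategory.whiskerLeft_id]
      rw [← cancel_mono (e t).hom, Category.assoc, Category.assoc, h, reassoc_of% hi,
        Iso.inv_hom_id, Category.comp_id] } : OpAlgebra.Hom B A)
  hom_inv_id := by
    apply OpAlgebra.hom_ext
    intro c
    exact (e c).hom_inv_id
  inv_hom_id := by
    apply OpAlgebra.hom_ext
    intro c
    exact (e c).inv_hom_id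

/-- The compatibility condition of `OpAlgebra.isoMk` for two algebras with the same underlying objects
and identity isomorphisms: the actions agree. -/
theorem act_comp_id {C : Type w} {O : ColoredOperad M C} {X : C → M} {n : ℕ} {c : Fin n → C} {t : C}
    {α β : O.ops c t ⊗ tens (fun i => X (c i)) ⟶ X t} (h : α = β) :
    α ≫ 𝟙 (X t) = (O.ops c t ◁ tensMap (fun i => 𝟙 (X (c i)))) ≫ β := by
  rw [tensMap_id, MonoidalCategory.whiskerLeft_id, Category.id_comp, Category.comp_id, h]

theorem OpAlgebra.unary_one {C : Type w} {O : ColoredOperad M C} (A : OpAlgebra O) (c : C) :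
    A.unary (O.one c) = 𝟙 (A.carrier c) := by
  have h := A.act_one c
  rw [OpAlgebra.unary, h]
  simp

theorem OpAlgebra.Hom.unary_comp_app {C : Type w} {O : ColoredOperad M C} {A B : OpAlgebra O}
    (φ : A ⟶ B) {s t : C} (o : 𝟙_ M ⟶ O.ops (fun _ : Fin 1 => s) t) :
    A.unary o ≫ φ.app t = φ.app s ≫ B.unary o := by
  have h := φ.app_act (fun _ : Fin 1 => s) t
  simp only [OpAlgebra.unary, Category.assoc]
  rw [h, ← whisker_exchange_assoc, comp_unitors_inv (φ.app s)]

theorem OpAlgebra.act_unary_of_eq {C : Type w} {O : ColoredOperad M C} (A : OpAlgebra O) {s t : C}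
    {o : 𝟙_ M ⟶ O.ops (fun _ : Fin 1 => s) t} {n : ℕ} {c : Fin n → C} {X : M} {i : X ⟶ O.ops c s}
    {j : X ⟶ O.ops c t} (h : i ≫ O.postUnary o c = j) :
    ((i ▷ tens (fun i => A.carrier (c i))) ≫ A.act c s) ≫ A.unary o =
      (j ▷ tens (fun i => A.carrier (c i))) ≫ A.act c t := by
  rw [Category.assoc, A.act_unary, ← comp_whiskerRight_assoc, h]

theorem OpAlgebra.unary_act_of_eq {C : Type w} {O : ColoredOperad M C} (A : OpAlgebra O) {n : ℕ}
    {c a : Fin n → C} {o : ∀ i, 𝟙_ M ⟶ O.ops (fun _ : Fin 1 => c i) (a i)} {t : C} {X : M}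
    {i : X ⟶ O.ops a t} {j : X ⟶ O.ops c t} (h : i ≫ O.preUnary o t = j) :
    (X ◁ tensMap (fun i => A.unary (o i))) ≫ (i ▷ _) ≫ A.act a t =
      (j ▷ tens (fun i => A.carrier (c i))) ≫ A.act c t := by
  rw [whisker_exchange_assoc, A.unary_act, ← comp_whiskerRight_assoc, h]

end Algebras

section DiagramEquivalence

variable {M : Type u} [Category.{v} M] [MonoidalCategory M] [SymmetricCategory M]
  [MonoidalClosed M] [HasColimits M]

variable {K : Type v} [SmallCategory K] (P : ColoredOperad M PUnit.{v + 1})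

/-- The unary operation of `P_K` given by a morphism of `K`. -/
noncomputable def pcUnary {s t : K} (g : s ⟶ t) :
    𝟙_ M ⟶ (pcOperad K P).ops (fun _ : Fin 1 => s) t :=
  P.arOne ≫ pcι P (fun _ => g)

theorem ι_postUnary {n : ℕ} {c : Fin n → K} {s t : K} (f : ∀ i, c i ⟶ s) (g : s ⟶ t) :
    pcι P f ≫ (pcOperad K P).postUnary (pcUnary P g) c = pcι P (fun i => f i ≫ g) := by
  have h := one_push (o := P.arOne) (ι_pcComp P (fun _ : Fin 1 => g) (fun _ => f))
    (ι_pcPerm P (oneSumEquiv n) (concat_oneSumEquiv c) _)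
  have hp := P.one_comp (fun _ : Fin n => PUnit.unit) PUnit.unit
  have h₁ : (pcOperad K P).postUnary (pcUnary P g) c = (ρ_ _).inv ≫ (λ_ _).inv ≫
      ((P.arOne ≫ pcι P (fun _ : Fin 1 => g)) ▷ _) ≫ pcComp P (fun _ : Fin 1 => s) (fun _ => c) t ≫
        pcPerm P (oneSumEquiv n) (concat_oneSumEquiv c) t := rfl
  refine (whisker_eq _ h₁).trans ((comp_unitors_inv (pcι P f) _).trans ?_)
  refine (whisker_eq _ (whisker_eq _ (h.trans (eq_whisker hp _)))).trans ?_
  simp only [Category.assoc, Iso.inv_hom_id_assoc]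
  refine pcι_congr P (funext fun x => ?_)
  exact homPerm_comp_eq (fun p : Σ i : Fin 1, Fin n => f p.2 ≫ g)
    (unpos_oneSumEquiv x).symm (congrArg (fun p : Σ i : Fin 1, Fin n => c p.2)
      (unpos_oneSumEquiv x).symm)

theorem ι_preUnary {n : ℕ} {c a : Fin n → K} {t : K} (g : ∀ i, c i ⟶ a i) (f : ∀ i, a i ⟶ t) :
    pcι P f ≫ (pcOperad K P).preUnary (fun i => pcUnary P (g i)) t =
      pcι P (fun i => g i ≫ f i) := by
  have h := push_one (o := tensUnit n ≫ tensMap (fun _ => P.arOne))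
    (ι_pcComp P f (fun i (_ : Fin 1) => g i)) (ι_pcPerm P (sumOneEquiv n) (concat_sumOneEquiv c) _)
  have hp := P.comp_one (fun _ : Fin n => PUnit.unit) PUnit.unit
  have hg : tensMap (fun i => pcUnary P (g i)) =
      tensMap (fun _ => P.arOne) ≫ tensMap (fun i => pcι P (fun _ : Fin 1 => g i)) :=
    tensMap_comp _ _
  have h₁ : (pcOperad K P).preUnary (fun i => pcUnary P (g i)) t = (ρ_ _).inv ≫
      (_ ◁ ((tensUnit n ≫ tensMap (fun _ => P.arOne)) ≫
        tensMap (fun i => pcι P (fun _ : Fin 1 => g i)))) ≫ pcComp P a (fun i _ => c i) t ≫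
        pcPerm P (sumOneEquiv n) (concat_sumOneEquiv c) t := by
    rw [Category.assoc, ← hg]
    rfl
  refine (whisker_eq _ h₁).trans ((rightUnitor_inv_naturality_assoc (pcι P f) _).trans ?_)
  refine (whisker_eq _ (h.trans (eq_whisker hp _))).trans ?_
  simp only [Iso.inv_hom_id_assoc]
  refine pcι_congr P (funext fun x => ?_)
  exact homPerm_comp_eq (fun p : Σ i : Fin n, Fin 1 => g p.1 ≫ f p.1)
    (unpos_sumOneEquiv x).symm (congrArg (fun p : Σ i : Fin n, Fin 1 => c p.1)
      (unpos_sumOneEquiv x).symm)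

/-- The morphism `P ⟶ P_K` to the summands labeled by the identities of an object of `K`. -/
noncomputable def pcIncl (c : K) :
    (⟨PUnit.{v + 1}, P⟩ : OperadVar.{v} M) ⟶ ⟨K, pcOperad K P⟩ :=
  ({ onColors := fun _ => c
     onOps :=
      { app := fun _ _ => pcι P (fun _ => 𝟙 c)
        app_perm := fun e a d h t => by
          refine Eq.trans ?_ (ι_pcPerm P e _ _).symm
          exact whisker_eq _ (pcι_congr P (funext fun i => by simp [homPerm]))
        app_comp := fun a b t => by
          refine Eq.trans ?_ (ι_pcComp P (fun _ => 𝟙 c) (fun _ _ => 𝟙 c)).symm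
          exact whisker_eq _ (pcι_congr P (funext fun i => (Category.comp_id _).symm))
        app_one := fun _ => rfl } } :
    OperadVar.Hom (⟨PUnit.{v + 1}, P⟩ : OperadVar.{v} M) ⟨K, pcOperad K P⟩)

variable {P}

/-- If all inputs have the same color `s`, a summand of `P_K` labeled by copies of `g : s ⟶ t` acts by
the operations of `P` at `s` followed by the unary operation `g`. -/
theorem ι_act_eq_post (A : OpAlgebra (pcOperad K P)) {n : ℕ} {s t : K} (g : s ⟶ t) :
    ((pcι P (fun _ : Fin n => 𝟙 s) ▷ tens (fun _ => A.carrier s)) ≫ A.act (fun _ => s) s) ≫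
        A.unary (pcUnary P g) =
      (pcι P (fun _ : Fin n => g) ▷ tens (fun _ => A.carrier s)) ≫ A.act (fun _ => s) t := by
  have h := ι_postUnary P (fun _ : Fin n => 𝟙 s) g
  simp only [Category.id_comp] at h
  exact A.act_unary_of_eq h

/-- The summand of `P_K` labeled by `f` acts by the unary operations `f i` followed by the operations
of `P` at `t`. So the action is determined by the unary operations and by the actions of `P`. -/
theorem ι_act_eq_pre (A : OpAlgebra (pcOperad K P)) {n : ℕ} {c : Fin n → K} {t : K}
    (f : ∀ i, c i ⟶ t) :
    (P.ar n ◁ tensMap (fun i => A.unary (pcUnary P (f i)))) ≫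
        (pcι P (fun _ : Fin n => 𝟙 t) ▷ tens (fun _ => A.carrier t)) ≫ A.act (fun _ => t) t =
      (pcι P f ▷ tens (fun i => A.carrier (c i))) ≫ A.act c t := by
  have h := ι_preUnary P f (fun _ : Fin n => 𝟙 t)
  simp only [Category.comp_id] at h
  exact A.unary_act_of_eq h

theorem unary_comp (A : OpAlgebra (pcOperad K P)) {r s t : K} (f : r ⟶ s) (g : s ⟶ t) :
    A.unary (pcUnary P f) ≫ A.unary (pcUnary P g) = A.unary (pcUnary P (f ≫ g)) := by
  have h := ι_postUnary P (fun _ : Fin 1 => f) g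
  have h₁ := A.act_unary (pcUnary P g) (fun _ : Fin 1 => r)
  have h₂ : pcUnary P f ≫ (pcOperad K P).postUnary (pcUnary P g) (fun _ : Fin 1 => r) =
      pcUnary P (f ≫ g) := (Category.assoc _ _ _).trans (whisker_eq _ h)
  rw [← h₂, OpAlgebra.unary, Category.assoc, Category.assoc, Category.assoc, h₁,
    ← comp_whiskerRight_assoc]
  rfl

theorem unary_diagramAlgebra (A : K ⥤ OpAlgebra P) {s t : K} (g : s ⟶ t) :
    ((diagramAlgebra K P).obj A).unary (pcUnary P g) = (A.map g).app PUnit.unit := by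
  have h := ι_diagramAct A (fun _ : Fin 1 => g)
  have h₁ := (A.obj t).unary_one PUnit.unit
  have h₂ : ((diagramAlgebra K P).obj A).unary (pcUnary P g) = (ρ_ (A.obj s).pt).inv ≫ (λ_ _).inv ≫
      ((P.arOne ≫ pcι P (fun _ : Fin 1 => g)) ▷ tens (fun _ : Fin 1 => (A.obj s).pt)) ≫
        diagramAct A (fun _ => s) t := rfl
  rw [h₂, comp_whiskerRight, Category.assoc]
  refine (whisker_eq _ (whisker_eq _ (whisker_eq _ h))).trans ?_
  rw [← whisker_exchange_assoc, ← comp_unitors_inv]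
  exact (whisker_eq _ h₁).trans (Category.comp_id _)

/-- The functor from `K` to `P`-algebras given by an algebra over `P_K`: the summands labeled by
identities act at every object, and the morphisms of `K` act as unary operations. -/
noncomputable def algebraDiagram (A : OpAlgebra (pcOperad K P)) : K ⥤ OpAlgebra P where
  obj c := (algPullback (pcIncl P c)).obj A
  map {s t} g :=
    ({ app := fun _ => A.unary (pcUnary P g)
       app_act := fun c _ => (ι_act_eq_post A g).trans (ι_act_eq_pre A (fun _ => g)).symm } :
      OpAlgebra.Hom ((algPullback (pcIncl P s)).obj A) ((algPullback (pcIncl P t)).obj A))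
  map_id c := by
    apply OpAlgebra.hom_ext
    intro _
    exact A.unary_one c
  map_comp f g := by
    apply OpAlgebra.hom_ext
    intro _
    exact (unary_comp A f g).symm

/-- Every algebra over `P_K` is given by a functor from `K` to `P`-algebras. -/
noncomputable def diagramAlgebraIso (A : OpAlgebra (pcOperad K P)) :
    (diagramAlgebra K P).obj (algebraDiagram A) ≅ A :=
  OpAlgebra.isoMk (fun c => Iso.refl (A.carrier c)) (fun c t => by
    refine act_comp_id (O := pcOperad K P) (X := A.carrier) ?_
    apply (jointEpi_pcι P c t).whiskerRight
    intro f
    exact (ι_diagramAct (algebraDiagram A) f).trans (ι_act_eq_pre A f))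

instance : (diagramAlgebra K P).Faithful where
  map_injective {A B η θ} h := by
    ext c : 2
    apply OpAlgebra.hom_ext
    rintro ⟨⟩
    exact congrArg (fun k : (diagramAlgebra K P).obj A ⟶ (diagramAlgebra K P).obj B => k.app c) h

instance : (diagramAlgebra K P).Full where
  map_surjective {A B} φ := by
    -- a morphism of algebras is natural because it commutes with the unary operations, and a
    -- morphism of `P`-algebras because it commutes with the summands labeled by identities
    have hact : ∀ (A : K ⥤ OpAlgebra P) (n : ℕ) (c : K),
        (pcι P (fun _ : Fin n => 𝟙 c) ▷ tens (fun _ => (A.obj c).pt)) ≫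
          diagramAct A (fun _ => c) c = (A.obj c).actPt n := by
      intro A n c
      have h := ι_diagramAct A (fun _ : Fin n => 𝟙 c)
      have hi : (fun _ : Fin n => OpAlgebra.Hom.app (A.map (𝟙 c)) PUnit.unit) =
          fun _ => 𝟙 (A.obj c).pt := by
        rw [A.map_id, OpAlgebra.id_app]
      rw [h, hi, tensMap_id, MonoidalCategory.whiskerLeft_id, Category.id_comp]
    let ψ : ∀ c, A.obj c ⟶ B.obj c := fun c =>
      ({ app := fun _ => φ.app c
         app_act := fun {n} _ _ => by
           have h := φ.app_act (fun _ : Fin n => c) c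
           have h₁ := hact A n c
           have h₂ := hact B n c
           refine (eq_whisker h₁.symm _).trans ((Category.assoc _ _ _).trans ?_)
           refine (whisker_eq _ h).trans ?_
           refine Eq.trans ?_ (whisker_eq _ h₂)
           exact (Category.assoc _ _ _).symm.trans
             ((eq_whisker (whisker_whisker _ _) _).trans (Category.assoc _ _ _)) } :
        OpAlgebra.Hom (A.obj c) (B.obj c))
    refine ⟨{ app := ψ, naturality := fun s t g => ?_ }, ?_⟩
    · apply OpAlgebra.hom_ext
      rintro ⟨⟩
      have h := φ.unary_comp_app (pcUnary P g)
      rw [unary_diagramAlgebra, unary_diagramAlgebra] at h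
      exact h
    · apply OpAlgebra.hom_ext
      intro c
      rfl

end DiagramEquivalence

/-! ### Algebras over quotient operads -/

section CanonicalIsos

variable {M : Type u} [Category.{v} M] [MonoidalCategory M]

instance isIso_tensCast {m n : ℕ} (h : m = n) {X : Fin m → M} {Y : Fin n → M}
    (hX : ∀ i, X i = Y (Fin.cast h i)) : IsIso (tensCast h hX) := by
  unfold tensCast
  infer_instance

instance isIso_consCast {n : ℕ} {A : M} {Y : Fin n → M} {Z : Fin (n + 1) → M} (hA : A = Z 0)
    (hY : ∀ i, Y i = Z i.succ) : IsIso (consCast hA hY) := by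
  unfold consCast
  infer_instance

theorem isIso_tensAppend : ∀ (m n : ℕ) (Z : Fin (m + n) → M), IsIso (tensAppend m n Z)
  | 0, n, Z => by
    unfold tensAppend
    infer_instance
  | m + 1, n, Z => by
    have := isIso_tensAppend m n (fun i => Z (Fin.cast (by omega) i.succ))
    unfold tensAppend
    infer_instance

theorem isIso_tensFlat : ∀ {n : ℕ} {k : Fin n → ℕ} (Y : ∀ i, Fin (k i) → M), IsIso (tensFlat Y)
  | 0, _, _ => inferInstanceAs (IsIso (𝟙 (𝟙_ M)))
  | n + 1, k, Y => by
    have := isIso_tensFlat (fun i => Y i.succ)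
    have := isIso_tensAppend (k 0) (∑ i : Fin n, k i.succ)
      (fun x => concat Y (Fin.cast (Fin.sum_univ_succ k).symm x))
    unfold tensFlat
    infer_instance

theorem isIso_tensZip [BraidedCategory M] : ∀ {n : ℕ} (X Y : Fin n → M), IsIso (tensZip X Y)
  | 0, _, _ => inferInstanceAs (IsIso (λ_ (𝟙_ M)).inv)
  | n + 1, X, Y => by
    have := isIso_tensZip (fun i => X i.succ) (fun i => Y i.succ)
    have : IsIso (tensorμ (X 0) (Y 0) (tens fun i => X i.succ) (tens fun i => Y i.succ)) := by
      unfold tensorμ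
      infer_instance
    unfold tensZip
    infer_instance

theorem isIso_tensPull [BraidedCategory M] : ∀ {n : ℕ} (i : Fin (n + 1)) (X : Fin (n + 1) → M),
    IsIso (tensPull i X)
  | 0, i, X => inferInstanceAs (IsIso (_ ▷ 𝟙_ M))
  | n + 1, i, X => by
    cases i using Fin.cases with
    | zero => exact inferInstanceAs (IsIso (X 0 ◁ tensCast _ _))
    | succ j =>
      have := isIso_tensPull j (fun l => X l.succ)
      simp only [tensPull, Fin.cases_succ]
      infer_instance

theorem isIso_tensPerm [BraidedCategory M] : ∀ {m n : ℕ} (e : Fin m ≃ Fin n) (X : Fin n → M),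
    IsIso (tensPerm e X)
  | 0, 0, _, _ => inferInstanceAs (IsIso (𝟙 (𝟙_ M)))
  | 0, _ + 1, e, _ => (e.symm 0).elim0
  | _ + 1, 0, e, _ => (e 0).elim0
  | m + 1, n + 1, e, X => by
    have := isIso_tensPull (e 0) X
    have := isIso_tensPerm (removeZero e) (fun j => X ((e 0).succAbove j))
    unfold tensPerm
    infer_instance

end CanonicalIsos

section QuotientAlgebras

variable {M : Type u} [Category.{v} M] [MonoidalCategory M] [SymmetricCategory M]

/-- Whether two families of operations act in the same way is invariant under isomorphisms of
algebras. -/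
theorem OpAlgebra.whiskerRight_act_eq_of_iso {C : Type w} {O : ColoredOperad M C} {A B : OpAlgebra O}
    (i : A ≅ B) {n : ℕ} {c : Fin n → C} {t : C} {X : M} {x x' : X ⟶ O.ops c t}
    (h : (x ▷ tens (fun i => B.carrier (c i))) ≫ B.act c t = (x' ▷ _) ≫ B.act c t) :
    (x ▷ tens (fun i => A.carrier (c i))) ≫ A.act c t = (x' ▷ _) ≫ A.act c t := by
  have e : i.hom.app t ≫ i.inv.app t = 𝟙 _ :=
    congrArg (fun φ : A ⟶ A => φ.app t) i.hom_inv_id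
  have e' : A.act c t = (O.ops c t ◁ tensMap (fun j => i.hom.app (c j))) ≫ B.act c t ≫
      i.inv.app t := by
    rw [← Category.assoc, ← i.hom.app_act, Category.assoc, e, Category.comp_id]
  rw [e', ← whisker_exchange_assoc, ← whisker_exchange_assoc, reassoc_of% h]

/-- An algebra on which `r₁` and `r₂` act in the same way identifies both sides of all relations
that they generate. -/
theorem QRel.side_act_eq {C : Type w} {O : ColoredOperad M C} {R : ColoredSeq M C}
    {r₁ r₂ : R ⟶ (forgetSeq C).obj O} (A : OpAlgebra O)
    (h : ∀ {n : ℕ} (c : Fin n → C) (t : C),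
      (r₁ n c t ▷ tens (fun i => A.carrier (c i))) ≫ A.act c t =
        (r₂ n c t ▷ tens (fun i => A.carrier (c i))) ≫ A.act c t)
    {n : ℕ} {c : Fin n → C} {t : C} (ρ : QRel C c t) :
    (ρ.side r₁ ▷ tens (fun i => A.carrier (c i))) ≫ A.act c t =
      (ρ.side r₂ ▷ tens (fun i => A.carrier (c i))) ≫ A.act c t := by
  induction ρ with
  | refl => rfl
  | base c t => exact h c t
  | @perm m n e c d h t ρ ih =>
    obtain rfl : d = fun i => c (e i) := funext h
    have key : ∀ {X : M} (x : X ⟶ O.ops c t),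
        (X ◁ tensPerm e (fun i => A.carrier (c i))) ≫
          ((x ≫ O.perm e h t) ▷ _) ≫ A.act (fun i => c (e i)) t = (x ▷ _) ≫ A.act c t := by
      intro X x
      rw [comp_whiskerRight, Category.assoc, whisker_exchange_assoc, ← A.act_perm e c t,
        tensorHom_def']
      simp only [Category.assoc]
    have := isIso_tensPerm e (fun i => A.carrier (c i))
    rw [← cancel_epi (QRel.ob O R ρ ◁ tensPerm e (fun i => A.carrier (c i)))]
    exact (key _).trans (ih.trans (key _).symm)
  | @comp n k a b t ρ ρ' ih ih' =>
    have key : ∀ {X : M} {Y : Fin n → M} (x : X ⟶ O.ops a t) (y : ∀ i, Y i ⟶ O.ops (b i) (a i)),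
        (X ◁ (tensZip Y (fun i => tens (fun j => A.carrier (b i j))) ≫
          (tens Y ◁ tensFlat (fun i j => A.carrier (b i j))))) ≫ (α_ _ _ _).inv ≫
          (((x ⊗ₘ tensMap y) ≫ O.comp a b t) ▷ _) ≫ A.act (concat b) t =
        (x ⊗ₘ tensMap (fun i => (y i ▷ tens (fun j => A.carrier (b i j))) ≫
          A.act (b i) (a i))) ≫ A.act a t := by
      intro X Y x y
      have hz := tensZip_natural y (fun i => 𝟙 (tens (fun j => A.carrier (b i j))))
      rw [tensMap_id] at hz
      simp only [tensorHom_id] at hz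
      rw [tensMap_comp, ← hom_whisker_assoc, A.act_assoc]
      refine (assoc_push₀ (y' := 𝟙 _) (ε := 𝟙 _) (Category.comp_id _).symm (by
        rw [id_tensorHom_id, Category.id_comp]) ?_).symm
      refine (Category.assoc _ _ _).symm.trans ((eq_whisker hz _).trans ?_)
      rw [tensorHom_id, Category.assoc, Category.assoc, whisker_exchange]
    -- by associativity the composite operations act as iterated actions, up to the canonical
    -- isomorphism of the inputs, which can be cancelled
    have key' : ∀ {X : M} {Y : Fin n → M} (x x' : X ⟶ O.ops a t)
        (y y' : ∀ i, Y i ⟶ O.ops (b i) (a i)),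
        (x ▷ tens (fun i => A.carrier (a i))) ≫ A.act a t = (x' ▷ _) ≫ A.act a t →
        (∀ i, (y i ▷ tens (fun j => A.carrier (b i j))) ≫ A.act (b i) (a i) =
          (y' i ▷ _) ≫ A.act (b i) (a i)) →
        (((x ⊗ₘ tensMap y) ≫ O.comp a b t) ▷ tens (fun z => A.carrier (concat b z))) ≫
            A.act (concat b) t =
          (((x' ⊗ₘ tensMap y') ≫ O.comp a b t) ▷ _) ≫ A.act (concat b) t := by
      intro X Y x x' y y' hx hy
      have := isIso_tensZip Y (fun i => tens (fun j => A.carrier (b i j)))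
      have := isIso_tensFlat (fun i j => A.carrier (b i j))
      have e := (key x y).trans (Eq.trans ?_ (key x' y').symm)
      · rw [cancel_epi] at e
        exact (cancel_epi _).1 e
      · simp only [hy]
        rw [tensorHom_def', Category.assoc, hx, tensorHom_def', Category.assoc]
    exact key' _ _ _ _ ih ih'

/-- On algebras pulled back from the quotient operad both sides of the relations act in the same way.
-/
theorem IsQuotientBy.act_eq {C : Type w} {O Q : ColoredOperad M C} {R : ColoredSeq M C}
    {r₁ r₂ : R ⟶ (forgetSeq C).obj O} {π : O ⟶ Q} (H : IsQuotientBy r₁ r₂ π) (B : OpAlgebra Q)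
    {n : ℕ} (c : Fin n → C) (t : C) :
    (r₁ n c t ▷ tens (fun i => B.carrier (c i))) ≫
        ((algPullback (OperadVar.ofHom π)).obj B).act c t =
      (r₂ n c t ▷ tens (fun i => B.carrier (c i))) ≫
        ((algPullback (OperadVar.ofHom π)).obj B).act c t := by
  have e : r₁ n c t ≫ π.app c t = r₂ n c t ≫ π.app c t :=
    congrFun (congrFun (congrFun H.condition n) c) t
  have key : ∀ {X : M} (x x' : X ⟶ O.ops c t), x ≫ π.app c t = x' ≫ π.app c t →
      (x ▷ tens (fun i => B.carrier (c i))) ≫ (π.app c t ▷ _) ≫ B.act c t =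
      (x' ▷ _) ≫ (π.app c t ▷ _) ≫ B.act c t := by
    intro X x x' hx
    rw [← comp_whiskerRight_assoc, hx, comp_whiskerRight_assoc]
  exact key _ _ e

theorem faithful_algPullback_ofHom {C : Type w} {O Q : ColoredOperad M C} (π : O ⟶ Q) :
    (algPullback (OperadVar.ofHom π)).Faithful where
  map_injective {A B φ ψ} h := by
    apply OpAlgebra.hom_ext
    intro c
    exact congrArg (fun k : (algPullback (OperadVar.ofHom π)).obj A ⟶
      (algPullback (OperadVar.ofHom π)).obj B => k.app c) h

variable [MonoidalClosed M]

/-- In a closed symmetric monoidal category `B ⊗ D` is presented by the `G τ ⊗ D`; no reflexivity is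
needed for a single variable. -/
theorem Presents.exists_desc_whiskerRight
    {T S : Type*} {G : T → M} {X : S → M} {a b : S → T}
    {l : ∀ s, X s ⟶ G (a s)} {r : ∀ s, X s ⟶ G (b s)} {B : M} {ι : ∀ τ, G τ ⟶ B}
    (H : Presents l r ι) (D : M) {Z : M} (f : ∀ τ, G τ ⊗ D ⟶ Z)
    (hf : ∀ s, (l s ▷ D) ≫ f (a s) = (r s ▷ D) ≫ f (b s)) :
    ∃ g : B ⊗ D ⟶ Z, ∀ τ, (ι τ ▷ D) ≫ g = f τ := by
  obtain ⟨g, hg⟩ := H.exists_desc (fun τ => MonoidalClosed.curry ((β_ _ _).hom ≫ f τ)) (by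
    intro s
    rw [← MonoidalClosed.curry_natural_left, ← MonoidalClosed.curry_natural_left,
      BraidedCategory.braiding_naturality_right_assoc,
      BraidedCategory.braiding_naturality_right_assoc, hf])
  refine ⟨(β_ _ _).hom ≫ MonoidalClosed.uncurry g, fun τ => ?_⟩
  rw [BraidedCategory.braiding_naturality_left_assoc, ← MonoidalClosed.uncurry_natural_left, hg,
    MonoidalClosed.uncurry_curry]
  simp

variable [HasColimits M] {C : Type v} {O Q : ColoredOperad M C} {R : ColoredSeq M C}
  {r₁ r₂ : R ⟶ (forgetSeq C).obj O} {π : O ⟶ Q}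

/-- An algebra on which both sides of the relations act in the same way is, up to isomorphism, pulled
back from the quotient operad. -/
theorem IsQuotientBy.exists_algebra (H : IsQuotientBy r₁ r₂ π) (A : OpAlgebra O)
    (h : ∀ {n : ℕ} (c : Fin n → C) (t : C),
      (r₁ n c t ▷ tens (fun i => A.carrier (c i))) ≫ A.act c t =
        (r₂ n c t ▷ tens (fun i => A.carrier (c i))) ≫ A.act c t) :
    ∃ B : OpAlgebra Q, Nonempty ((algPullback (OperadVar.ofHom π)).obj B ≅ A) := by
  have key : ∀ {n : ℕ} (c : Fin n → C) (t : C),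
      ∃ g : Q.ops c t ⊗ tens (fun i => A.carrier (c i)) ⟶ A.carrier t,
        (π.app c t ▷ _) ≫ g = A.act c t := by
    intro n c t
    obtain ⟨g, hg⟩ := (H.presents c t).exists_desc_whiskerRight _ (fun _ => A.act c t)
      (fun ρ => QRel.side_act_eq A h ρ)
    exact ⟨g, hg PUnit.unit⟩
  choose g hg using @key
  refine ⟨{
    carrier := A.carrier
    act := fun c t => g c t
    act_assoc := fun {n k} a b t => ?_
    act_one := fun c => ?_
    act_perm := fun e c t => ?_ }, ⟨?_⟩⟩
  · apply (H.jointEpi a t).tensor (jointEpi_tens fun i =>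
      (H.jointEpi (b i) (a i)).whiskerRight (tens fun j => A.carrier (b i j)))
    intro _
    dsimp only
    have hz := tensZip_natural (fun i => π.app (b i) (a i))
      (fun i => 𝟙 (tens (fun j => A.carrier (b i j))))
    rw [tensMap_id] at hz
    simp only [tensorHom_id] at hz
    rw [hom_whisker_assoc, ← tensMap_comp]
    simp only [hg]
    have e : (π.app a t ⊗ₘ tensMap fun i => A.act (b i) (a i)) ≫ g a t =
        (O.ops a t ◁ tensMap (fun i => A.act (b i) (a i))) ≫ A.act a t := by
      rw [tensorHom_def', Category.assoc, hg]
    rw [e, A.act_assoc]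
    refine (assoc_push₀ (y' := 𝟙 _) (π.app_comp a b t).symm (by rw [tensorHom_id, hg]) ?_).symm
    refine (Category.assoc _ _ _).symm.trans ((eq_whisker hz _).trans ?_)
    rw [tensorHom_id, Category.assoc, Category.assoc, whisker_exchange]
  · rw [← π.app_one c, comp_whiskerRight, Category.assoc, hg, A.act_one]
  · apply (H.jointEpi c t).whiskerRight
    intro _
    dsimp only
    rw [hg, ← tensorHom_id, tensorHom_comp_tensorHom_assoc, ← π.app_perm, Category.id_comp,
      tensorHom_def', comp_whiskerRight, Category.assoc, Category.assoc, hg, ← A.act_perm e c t,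
      tensorHom_def', Category.assoc]
  · refine OpAlgebra.isoMk (fun c => Iso.refl (A.carrier c)) (fun c t => ?_)
    exact act_comp_id (O := O) (X := A.carrier) (hg c t)

theorem IsQuotientBy.full (H : IsQuotientBy r₁ r₂ π) :
    (algPullback (OperadVar.ofHom π)).Full where
  map_surjective {A B} φ := by
    refine ⟨({ app := φ.app, app_act := fun c t => ?_ } : OpAlgebra.Hom A B), rfl⟩
    apply (H.jointEpi c t).whiskerRight
    intro _
    dsimp only
    have h := φ.app_act c t
    refine (Category.assoc _ _ _).symm.trans (h.trans ?_)
    exact (whisker_exchange_assoc _ _ _)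

end QuotientAlgebras

/-! ### Field theories as algebras over field theory operads -/

/-- Two fully faithful functors with the same essential image have equivalent sources. -/
theorem exists_equivalence_of_essImage_eq {A B E : Type*} [Category A] [Category B] [Category E]
    (F : A ⥤ E) (G : B ⥤ E) [F.Full] [F.Faithful] [G.Full] [G.Faithful]
    (h : F.essImage = G.essImage) : ∃ e : A ≌ B, Nonempty (e.functor ⋙ G ≅ F) := by
  have hF : ∀ a, G.essImage (F.obj a) := fun a => h ▸ F.obj_mem_essImage a
  let i : Functor.essImage.liftFunctor F G hF ⋙ G ≅ F := Functor.essImage.liftFunctorCompIso F G hF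
  have := Functor.Faithful.of_comp_iso i
  have := Functor.Full.of_comp_faithful_iso i
  have : (Functor.essImage.liftFunctor F G hF).EssSurj :=
    ⟨fun b => by
      obtain ⟨a, ⟨j⟩⟩ : F.essImage (G.obj b) := h ▸ G.obj_mem_essImage b
      exact ⟨a, ⟨G.preimageIso (i.app a ≪≫ j)⟩⟩⟩
  have : (Functor.essImage.liftFunctor F G hF).IsEquivalence := {}
  exact ⟨(Functor.essImage.liftFunctor F G hF).asEquivalence, ⟨i⟩⟩

section FieldTheoryAlgebras

variable {M : Type u} [Category.{v} M] [MonoidalCategory M] [SymmetricCategory M]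
  [MonoidalClosed M] [HasColimits M]

/-- A field theory as an algebra over the operad `P_C`. -/
noncomputable abbrev theoryAlgebra (C : OrthCat.{v}) (P : BipointedOperad M) :
    FT C P ⥤ OpAlgebra (pcOperad C.carrier P.operad) :=
  ObjectProperty.ι _ ⋙ diagramAlgebra C.carrier P.operad

theorem ι_perpMap (C : OrthCat.{v}) (P : BipointedOperad M)
    (r : arityTwo M ⟶ (forgetSeq _).obj P.operad) {c : Fin 2 → C.carrier} {t : C.carrier}
    (f : {f : (∀ i, c i ⟶ t) // C.perp (f 0) (f 1)}) :
    Sigma.ι (fun _ : {f : (∀ i, c i ⟶ t) // C.perp (f 0) (f 1)} => 𝟙_ M) f ≫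
      perpMap C P r 2 c t = P.point r ≫ pcι P.operad f.1 :=
  Sigma.ι_desc _ _

/-- Field theories are the functors whose algebras over `P_C` satisfy the relations that define the
field theory operads. -/
theorem isFieldTheory_iff (C : OrthCat.{v}) (P : BipointedOperad M)
    (A : C.carrier ⥤ OpAlgebra P.operad) :
    IsFieldTheory C P A ↔ ∀ {n : ℕ} (c : Fin n → C.carrier) (t : C.carrier),
      (perpMap C P P.r₁ n c t ▷ tens (fun i => (A.obj (c i)).pt)) ≫ diagramAct A c t =
        (perpMap C P P.r₂ n c t ▷ tens (fun i => (A.obj (c i)).pt)) ≫ diagramAct A c t := by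
  have key : ∀ (r : arityTwo M ⟶ (forgetSeq _).obj P.operad) {c : Fin 2 → C.carrier}
      {t : C.carrier} (f : {f : (∀ i, c i ⟶ t) // C.perp (f 0) (f 1)}),
      (Sigma.ι (fun _ : {f : (∀ i, c i ⟶ t) // C.perp (f 0) (f 1)} => 𝟙_ M) f ▷ _) ≫
        (perpMap C P r 2 c t ▷ tens (fun i => (A.obj (c i)).pt)) ≫ diagramAct A c t =
      (P.point r ⊗ₘ tensMap (fun i => (A.map (f.1 i)).app PUnit.unit)) ≫
        (A.obj t).actPt 2 := by
    intro r c t f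
    refine (comp_whiskerRight_assoc _ _ _ _).symm.trans ?_
    refine (eq_whisker (congrArg (· ▷ _) (ι_perpMap C P r f)) _).trans ?_
    have key : ∀ p : 𝟙_ M ⟶ P.operad.ar 2,
        ((p ≫ pcι P.operad f.1) ▷ tens (fun i => (A.obj (c i)).pt)) ≫ diagramAct A c t =
          (p ⊗ₘ tensMap (fun i => (A.map (f.1 i)).app PUnit.unit)) ≫ (A.obj t).actPt 2 := by
      intro p
      rw [comp_whiskerRight_assoc, ι_diagramAct, MonoidalCategory.tensorHom_def, Category.assoc]
    exact key _
  constructor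
  · intro h n c t
    match n, c with
    -- outside arity `2` both relation maps are the unique morphism from the initial object
    | 0, _ => rfl
    | 1, _ => rfl
    | 2, c =>
      apply (jointEpi_sigma _).whiskerRight
      intro f
      exact (key P.r₁ f).trans ((h c t f.1 f.2).trans (key P.r₂ f).symm)
    | _ + 3, _ => rfl
  · intro h c t f hf
    exact (key P.r₁ ⟨f, hf⟩).symm.trans ((whisker_eq _ (h c t)).trans (key P.r₂ ⟨f, hf⟩))

/-- An algebra over `P_C` is given by a field theory if and only if it is pulled back from the field
theory operad. -/
theorem essImage_algPullback_proj {C : OrthCat.{v}} {P : BipointedOperad M}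
    (T : FTOperad C P) : (algPullback (OperadVar.ofHom T.proj)).essImage =
      (theoryAlgebra C P).essImage := by
  funext A
  apply propext
  constructor
  · rintro ⟨B, ⟨i⟩⟩
    refine ⟨⟨algebraDiagram ((algPullback (OperadVar.ofHom T.proj)).obj B), ?_⟩,
      ⟨diagramAlgebraIso _ ≪≫ i⟩⟩
    rw [isFieldTheory_iff]
    intro n c t
    exact OpAlgebra.whiskerRight_act_eq_of_iso (O := pcOperad C.carrier P.operad)
      (diagramAlgebraIso ((algPullback (OperadVar.ofHom T.proj)).obj B))
      (x := perpMap C P P.r₁ n c t) (x' := perpMap C P P.r₂ n c t) (T.isQuotient.act_eq B c t)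
  · rintro ⟨A', ⟨i⟩⟩
    obtain ⟨B, ⟨j⟩⟩ := T.isQuotient.exists_algebra ((theoryAlgebra C P).obj A')
      (fun c t => (isFieldTheory_iff C P A'.obj).1 A'.property c t)
    exact ⟨B, ⟨j ≪≫ i⟩⟩

/-- Algebras over a field theory operad are equivalent to field theories, compatibly with the passage
to algebras over `P_C`. -/
theorem exists_equivalence {C : OrthCat.{v}} {P : BipointedOperad M} (T : FTOperad C P) :
    ∃ e : OpAlgebra T.operad ≌ FT C P, Nonempty (e.functor ⋙ ObjectProperty.ι _ ⋙
      diagramAlgebra C.carrier P.operad ≅ algPullback (OperadVar.ofHom T.proj)) := by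
  have := T.isQuotient.full
  have := faithful_algPullback_ofHom T.proj
  exact exists_equivalence_of_essImage_eq _ _ (essImage_algPullback_proj T)

end FieldTheoryAlgebras

/-! ### Functoriality of the field theory operads -/

section Pullbacks

variable {M : Type u} [Category.{v} M] [MonoidalCategory M] [SymmetricCategory M]

/-- The universal property of a quotient operad also holds for morphisms that change the colors. -/
theorem IsQuotientBy.existsUnique_ofHom_comp {C : Type w} {R : ColoredSeq M C}
    {P Q : ColoredOperad M C} {r₁ r₂ : R ⟶ (forgetSeq C).obj P} {π : P ⟶ Q}
    (H : IsQuotientBy r₁ r₂ π) {Y : OperadVar.{w} M} (β : (⟨C, P⟩ : OperadVar.{w} M) ⟶ Y)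
    (h : r₁ ≫ (forgetSeq C).map β.onOps = r₂ ≫ (forgetSeq C).map β.onOps) :
    ∃! α : (⟨C, Q⟩ : OperadVar.{w} M) ⟶ Y, OperadVar.ofHom π ≫ α = β := by
  obtain ⟨ψ, hψ, huniq⟩ := H.existsUnique β.onOps h
  refine ⟨(⟨β.onColors, ψ⟩ : OperadVar.Hom ⟨C, Q⟩ Y),
    congrArg (OperadVar.Hom.mk (O := ⟨C, P⟩) (P := Y) β.onColors) hψ, ?_⟩
  rintro ⟨f, φ⟩ hα
  obtain ⟨g, χ⟩ := β
  injection hα with h₁ h₂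
  obtain rfl : f = g := h₁
  exact congrArg (OperadVar.Hom.mk (O := ⟨C, Q⟩) (P := Y) f) (huniq φ (eq_of_heq h₂))

/-- Algebras are pulled back along a composite morphism of operads in two steps. -/
def algPullbackComp {X Y Z : OperadVar.{w} M} (φ : X ⟶ Y) (ψ : Y ⟶ Z) :
    algPullback (φ ≫ ψ) ≅ algPullback ψ ⋙ algPullback φ :=
  NatIso.ofComponents (fun A => OpAlgebra.isoMk (fun c => Iso.refl _) (fun {n} c t => by
    refine act_comp_id (O := X.operad) (X := ((algPullback (φ ≫ ψ)).obj A).carrier) ?_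
    exact (eq_whisker (comp_whiskerRight _ _ _) _).trans (Category.assoc _ _ _)))
    (fun f => by
      apply OpAlgebra.hom_ext
      intro c
      exact (Category.comp_id _).trans (Category.id_comp _).symm)

end Pullbacks

section Functoriality

variable {M : Type u} [Category.{v} M] [MonoidalCategory M] [SymmetricCategory M]
  [MonoidalClosed M] [HasColimits M]

theorem auxMap_id (C : OrthCat.{v}) (P : BipointedOperad M) :
    auxMap (𝟙 C) (𝟙 P) = 𝟙 (auxObj C P) := by
  refine congrArg (OperadVar.Hom.mk (O := auxObj C P) (P := auxObj C P) id)
    (ColoredOperad.hom_ext fun c t => ?_)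
  apply jointEpi_pcι (K := C.carrier) P.operad c t
  intro f
  exact (ι_auxApp (𝟙 C) (𝟙 P) f).trans ((Category.id_comp _).trans (Category.comp_id _).symm)

theorem auxMap_comp {C D E : OrthCat.{v}} {P Q R : BipointedOperad M} (F : C ⟶ D) (G : D ⟶ E)
    (φ : P ⟶ Q) (ψ : Q ⟶ R) : auxMap (F ≫ G) (φ ≫ ψ) = auxMap F φ ≫ auxMap G ψ := by
  refine congrArg (OperadVar.Hom.mk (O := auxObj C P) (P := auxObj E R)
    (G.functor.obj ∘ F.functor.obj)) (ColoredOperad.hom_ext fun c t => ?_)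
  apply jointEpi_pcι (K := C.carrier) P.operad c t
  intro f
  have h₁ := ι_auxApp F φ f
  have h₂ := ι_auxApp G ψ fun i => F.functor.map (f i)
  refine (ι_auxApp (F ≫ G) (φ ≫ ψ) f).trans ((Category.assoc _ _ _).trans ?_)
  refine (whisker_eq _ h₂.symm).trans ((Category.assoc _ _ _).symm.trans ?_)
  exact (eq_whisker h₁.symm _).trans (Category.assoc _ _ _)

/-- The morphism `P_C ⟶ Q_D` maps the relations for `C` to relations for `D`. -/
theorem perpMap_auxMap_proj {C D : OrthCat.{v}} {P Q : BipointedOperad M} (F : C ⟶ D) (φ : P ⟶ Q)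
    (T : FTOperad D Q) :
    perpMap C P P.r₁ ≫ (forgetSeq C.carrier).map (auxMap F φ ≫ OperadVar.ofHom T.proj).onOps =
      perpMap C P P.r₂ ≫
        (forgetSeq C.carrier).map (auxMap F φ ≫ OperadVar.ofHom T.proj).onOps := by
  have hp₁ : P.point P.r₁ ≫ φ.hom.app (fun _ => PUnit.unit) PUnit.unit = Q.point Q.r₁ :=
    congrFun (congrFun (congrFun φ.map_r₁ 2) fun _ => PUnit.unit) PUnit.unit
  have hp₂ : P.point P.r₂ ≫ φ.hom.app (fun _ => PUnit.unit) PUnit.unit = Q.point Q.r₂ :=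
    congrFun (congrFun (congrFun φ.map_r₂ 2) fun _ => PUnit.unit) PUnit.unit
  funext n c t
  match n, c with
  | 0, _ => rfl
  | 1, _ => rfl
  | 2, c =>
    apply jointEpi_sigma
    intro f
    have key : ∀ {p : 𝟙_ M ⟶ P.operad.ar 2} {q : 𝟙_ M ⟶ Q.operad.ar 2},
        p ≫ φ.hom.app (fun _ => PUnit.unit) PUnit.unit = q →
        (p ≫ pcι P.operad f.1) ≫ auxApp F φ c t =
          q ≫ pcι Q.operad (fun i => F.functor.map (f.1 i)) := by
      rintro p _ rfl
      rw [Category.assoc, ι_auxApp, Category.assoc]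
    have hs : ∀ {r : arityTwo M ⟶ (forgetSeq _).obj P.operad}
        {s : arityTwo M ⟶ (forgetSeq _).obj Q.operad},
        P.point r ≫ φ.hom.app (fun _ => PUnit.unit) PUnit.unit = Q.point s →
        Sigma.ι (fun _ : {f : (∀ i, c i ⟶ t) // C.perp (f 0) (f 1)} => 𝟙_ M) f ≫
          perpMap C P r 2 c t ≫ auxApp F φ c t ≫ T.proj.app _ _ =
        Sigma.ι (fun _ : {f : (∀ i, F.functor.obj (c i) ⟶ F.functor.obj t) //
            D.perp (f 0) (f 1)} => 𝟙_ M) ⟨fun i => F.functor.map (f.1 i), F.map_perp f.2⟩ ≫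
          perpMap D Q s 2 (fun i => F.functor.obj (c i)) (F.functor.obj t) ≫
            T.proj.app _ _ := by
      intro r s h
      have e₁ := ι_perpMap C P r f
      have e₂ := ι_perpMap D Q s (c := fun i => F.functor.obj (c i)) (t := F.functor.obj t)
        ⟨fun i => F.functor.map (f.1 i), F.map_perp f.2⟩
      refine (Category.assoc _ _ _).symm.trans ((eq_whisker e₁ _).trans ?_)
      refine Eq.trans ?_ ((eq_whisker e₂ _).symm.trans (Category.assoc _ _ _))
      exact (Category.assoc _ _ _).symm.trans (eq_whisker (key h) _)
    have hc := congrFun (congrFun (congrFun T.isQuotient.condition 2)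
      fun i => F.functor.obj (c i)) (F.functor.obj t)
    exact (hs hp₁).trans ((whisker_eq _ hc).trans (hs hp₂).symm)
  | _ + 3, _ => rfl

/-- The pullback of field theories corresponds to the pullback of algebras over the operads `P_C`. -/
noncomputable def theoryAlgebraPullback {C D : OrthCat.{v}} {P Q : BipointedOperad M} (F : C ⟶ D)
    (φ : P ⟶ Q) :
    theoryAlgebra D Q ⋙ algPullback (auxMap F φ) ≅ ftPullback F φ ⋙ theoryAlgebra C P :=
  NatIso.ofComponents (fun A => OpAlgebra.isoMk
    (fun c => Iso.refl (A.obj.obj (F.functor.obj c)).pt) (fun {n} c t => by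
      refine act_comp_id (O := pcOperad C.carrier P.operad)
        (X := fun c => (A.obj.obj (F.functor.obj c)).pt) ?_
      apply (jointEpi_pcι (K := C.carrier) P.operad c t).whiskerRight
      intro f
      have h₁ := ι_auxApp F φ f
      have h₂ := ι_diagramAct A.obj fun i => F.functor.map (f i)
      have h₃ := ι_diagramAct (((ftPullback F φ).obj A).obj) f
      refine Eq.trans ?_ h₃.symm
      refine (comp_whiskerRight_assoc _ _ _ _).symm.trans ?_
      refine (eq_whisker (congrArg (· ▷ _) h₁) _).trans ?_
      refine (comp_whiskerRight_assoc _ _ _ _).trans ((whisker_eq _ h₂).trans ?_)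
      exact (whisker_exchange_assoc _ _ _).symm))
    (fun f => by
      apply OpAlgebra.hom_ext
      intro c
      exact (Category.comp_id _).trans (Category.id_comp _).symm)

end Functoriality

/-! ### Comparison of the adjunctions -/

section Equivalences

variable {M : Type u} [Category.{v} M] [MonoidalCategory M] [SymmetricCategory M]
  [MonoidalClosed M] [HasColimits M]

/-- Pullback functors along compatible morphisms of operads correspond to each other under
equivalences between algebras over the field theory operads and field theories. -/
theorem nonempty_algPullback_iso {C D : OrthCat.{v}} {P Q : BipointedOperad M} (F : C ⟶ D)
    (φ : P ⟶ Q) {S : FTOperad C P} {T : FTOperad D Q}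
    (α : (⟨C.carrier, S.operad⟩ : OperadVar.{v} M) ⟶ ⟨D.carrier, T.operad⟩)
    (hα : OperadVar.ofHom S.proj ≫ α = auxMap F φ ≫ OperadVar.ofHom T.proj)
    {K : OpAlgebra S.operad ⥤ FT C P} {L : OpAlgebra T.operad ⥤ FT D Q}
    (i : K ⋙ theoryAlgebra C P ≅ algPullback (OperadVar.ofHom S.proj))
    (j : L ⋙ theoryAlgebra D Q ≅ algPullback (OperadVar.ofHom T.proj)) :
    Nonempty (algPullback α ⋙ K ≅ L ⋙ ftPullback F φ) := by
  have e : algPullback α ⋙ algPullback (OperadVar.ofHom S.proj) ≅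
      algPullback (OperadVar.ofHom T.proj) ⋙ algPullback (auxMap F φ) :=
    (algPullbackComp _ _).symm ≪≫ eqToIso (congrArg algPullback hα) ≪≫ algPullbackComp _ _
  exact ⟨Functor.fullyFaithfulCancelRight (theoryAlgebra C P)
    (Functor.associator _ _ _ ≪≫ Functor.isoWhiskerLeft (algPullback α) i ≪≫ e ≪≫
      Functor.isoWhiskerRight j.symm _ ≪≫ Functor.associator _ _ _ ≪≫
      Functor.isoWhiskerLeft L (theoryAlgebraPullback F φ) ≪≫ (Functor.associator _ _ _).symm)⟩

end Equivalences

end FieldTheory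

theorem proposition3p7 {M : Type u} [Category.{v} M] [MonoidalCategory M] [SymmetricCategory M]
    [MonoidalClosed M] [HasLimits M] [HasColimits M] :
    -- the field theory operads exist
    (∀ (C : FieldTheory.OrthCat.{v}) (P : FieldTheory.BipointedOperad M),
      Nonempty (FieldTheory.FTOperad C P)) ∧
    -- and, however they are chosen,
    ∀ T : (∀ X : FieldTheory.OrthCat.{v} × FieldTheory.BipointedOperad M,
        FieldTheory.FTOperad X.1 X.2),
      -- the assignment extends to a functor,
      ∃ Φ : FieldTheory.FunctorOn (fun X => (⟨X.1.carrier, (T X).operad⟩ :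
          FieldTheory.OperadVar.{v} M)),
        -- which is induced by the morphisms `P_C ⟶ Q_D` on the quotients
        (∀ {X Y : FieldTheory.OrthCat.{v} × FieldTheory.BipointedOperad M} (f : X ⟶ Y),
          FieldTheory.OperadVar.ofHom (T X).proj ≫ Φ.map f =
            FieldTheory.auxMap f.1 f.2 ≫ FieldTheory.OperadVar.ofHom (T Y).proj) ∧
        -- and is unique with this property,
        (∀ Ψ : FieldTheory.FunctorOn (fun X => (⟨X.1.carrier, (T X).operad⟩ :
            FieldTheory.OperadVar.{v} M)),
          (∀ {X Y : FieldTheory.OrthCat.{v} × FieldTheory.BipointedOperad M} (f : X ⟶ Y),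
            FieldTheory.OperadVar.ofHom (T X).proj ≫ Ψ.map f =
              FieldTheory.auxMap f.1 f.2 ≫ FieldTheory.OperadVar.ofHom (T Y).proj) →
          Ψ = Φ) ∧
        -- operadic left Kan extensions along the values of the functor exist,
        (∀ {X Y : FieldTheory.OrthCat.{v} × FieldTheory.BipointedOperad M} (f : X ⟶ Y),
          (FieldTheory.algPullback (Φ.map f)).IsRightAdjoint) ∧
        -- so do the left adjoints of `A ↦ φ^* ∘ A ∘ F` on field theories,
        (∀ {C D : FieldTheory.OrthCat.{v}} {P Q : FieldTheory.BipointedOperad M} (F : C ⟶ D)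
          (φ : P ⟶ Q), (FieldTheory.ftPullback F φ).IsRightAdjoint) ∧
        -- and these adjunctions correspond to each other under identifications of the algebras
        -- over the field theory operads with the field theories
        ∃ K : (∀ X : FieldTheory.OrthCat.{v} × FieldTheory.BipointedOperad M,
            FieldTheory.OpAlgebra (T X).operad ≌ FieldTheory.FT X.1 X.2),
          (∀ X, Nonempty ((K X).functor ⋙ ObjectProperty.ι _ ⋙
              FieldTheory.diagramAlgebra X.1.carrier X.2.operad ≅
            FieldTheory.algPullback (FieldTheory.OperadVar.ofHom (T X).proj))) ∧
          ∀ {X Y : FieldTheory.OrthCat.{v} × FieldTheory.BipointedOperad M} (f : X ⟶ Y),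
            Nonempty (FieldTheory.algPullback (Φ.map f) ⋙ (K X).functor ≅
              (K Y).functor ⋙ FieldTheory.ftPullback f.1 f.2) := by
  refine ⟨fun C P => ⟨⟨FieldTheory.quotOperad _ _, FieldTheory.quotProj _ _,
    FieldTheory.isQuotientBy_quotProj _ _⟩⟩, fun T => ?_⟩
  have key : ∀ {X Y : FieldTheory.OrthCat.{v} × FieldTheory.BipointedOperad M} (f : X ⟶ Y),
      ∃! α : (⟨X.1.carrier, (T X).operad⟩ : FieldTheory.OperadVar.{v} M) ⟶
          ⟨Y.1.carrier, (T Y).operad⟩,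
        FieldTheory.OperadVar.ofHom (T X).proj ≫ α =
          FieldTheory.auxMap f.1 f.2 ≫ FieldTheory.OperadVar.ofHom (T Y).proj := fun {X Y} f =>
    (T X).isQuotient.existsUnique_ofHom_comp _ (FieldTheory.perpMap_auxMap_proj f.1 f.2 (T Y))
  choose g hg huniq using @key
  choose K hK using fun X : FieldTheory.OrthCat.{v} × FieldTheory.BipointedOperad M =>
    FieldTheory.exists_equivalence (T X)
  have hsq : ∀ {X Y : FieldTheory.OrthCat.{v} × FieldTheory.BipointedOperad M} (f : X ⟶ Y),
      Nonempty (FieldTheory.algPullback (g f) ⋙ (K X).functor ≅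
        (K Y).functor ⋙ FieldTheory.ftPullback f.1 f.2) := fun {X Y} f =>
    FieldTheory.nonempty_algPullback_iso f.1 f.2 (g f) (hg f) (hK X).some (hK Y).some
  refine ⟨{ map := fun f => g f, map_id := fun X => ?_, map_comp := fun {X Y Z} f f' => ?_ },
    fun f => hg f, fun Ψ hΨ => ?_,
    fun f => FieldTheory.isRightAdjoint_algPullback (g f), fun {C D P Q} F φ => ?_,
    K, hK, fun f => hsq f⟩
  · refine (huniq (𝟙 X) _ ?_).symm
    refine (Category.comp_id _).trans ?_
    exact ((eq_whisker (FieldTheory.auxMap_id X.1 X.2) _).trans (Category.id_comp _)).symm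
  · refine (huniq (f ≫ f') _ ?_).symm
    refine (Category.assoc _ _ _).symm.trans ((eq_whisker (hg f) _).trans ?_)
    refine (Category.assoc _ _ _).trans ((whisker_eq _ (hg f')).trans ?_)
    refine (Category.assoc _ _ _).symm.trans (eq_whisker ?_ _)
    exact (FieldTheory.auxMap_comp f.1 f'.1 f.2 f'.2).symm
  · obtain ⟨m, h₁, h₂⟩ := Ψ
    congr 1
    funext X Y f
    exact huniq f _ (hΨ f)
  · obtain ⟨i⟩ := hsq (X := (C, P)) (Y := (D, Q)) (F, φ)
    have := FieldTheory.isRightAdjoint_algPullback (g (X := (C, P)) (Y := (D, Q)) (F, φ))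
    have : ((K (D, Q)).inverse ⋙ FieldTheory.algPullback (g (X := (C, P)) (Y := (D, Q)) (F, φ)) ⋙
      (K (C, P)).functor).IsRightAdjoint := inferInstance
    exact Functor.isRightAdjoint_of_iso (Functor.isoWhiskerLeft _ i ≪≫
      (Functor.associator _ _ _).symm ≪≫
      Functor.isoWhiskerRight (K (D, Q)).counitIso _ ≪≫ Functor.leftUnitor _)
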